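/- Let $d\ge 1$ be an integer, $\lambda>0$ a real number, and $\mathbb R^{d+1}_+=\{(x,t):x\in\mathbb R^d,\ t>0\}$. Functions are real-valued, $m_n$ is Lebesgue measure on $\mathbb R^n$, and $h_A=\frac1{m_n(A)}\int_A h\,dm_n$ denotes an average. **Sobolev space.** Let $\omega(x,t)=\log^\lambda(4/t)$ for $0<t\le 1$ and $\omega(x,t)=\log^\lambda 4$ for $t>1$, and let $\mu_0^\lambda(E)=\frac{1}{\log^\lambda 4}\int_E\omega\,dm_{d+1}$ for $E\subset\mathbb R^{d+1}_+$. The space $W^{1,1}(\mathbb R^{d+1}_+,\mu_0^\lambda)$ consists of all $f\in L^1_{\rm loc}(\mathbb R^{d+1}_+)$ whose distributional gradient $\nabla f$ belongs to $L^1_{\rm loc}(\mathbb R^{d+1}_+)$ and for which $\|f\|_{L^1(\mu_0^\lambda)}+\|\nabla f\|_{L^1(\mu_0^\lambda)}<\infty$. **Dyadic cubes.** For $k\in\mathbb Z$ let $\mathscr Q_{d,k}$ be the set of all cubes $2^{-k}((0,1]^d+m)$, $m\in\mathbb Z^d$; their edge length is $\ell(Q)=2^{-k}$. For an integer $j\ge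 0$ and $Q\in\mathscr Q_{d,2^j}$ write $Q'\asymp Q$ if $Q'\in\mathscr Q_{d,2^j}\cup\mathscr Q_{d,2^{j-1}}$ and $\overline Q\cap\overline{Q'}\neq\emptyset$, where $\mathscr Q_{d,2^{-1}}$ is read as $\mathscr Q_{d,1}$. **Besov-type space.** $\mathcal B^\lambda_1(\mathbb R^d)$ consists of all $g\in L^1_{\rm loc}(\mathbb R^d)$ with $$\|g\|_{L^1(\mathbb R^d)}+\sum_{j=0}^\infty(2^j+2)^\lambda\sum_{Q\in\mathscr Q_{d,2^j}}m_d(Q)\sum_{Q'\asymp Q}|g_Q-g_{Q'}|<\infty .$$ **Traces.** For $Q\in\mathscr Q_{d,k}$ let $\mathscr W(Q)=Q\times(2^{-k},2^{-k+1}]$ and $\mathscr N(Q)=\{y\in\mathbb R^{d+1}_+:\operatorname{dist}(y,\mathscr W(Q))<\frac14\ell(Q)\}$. For $f\in L^1_{\rm loc}(\mathbb R^{d+1}_+)$ and $k\in\{0,1,2,\dots\}$ let $\mathscr T_kf=\sum_{Q\in\mathscr Q_{d,k}}f_{\mathscr N(Q)}\,\chi_Q$ on $\mathbb R^d$. A function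 $g$ on $\mathbb R^d$ is the trace of $f$ if $\mathscr T_kf\to g$ as $k\to\infty$ almost everywhere in $\mathbb R^d$; the trace is unique up to null sets. **Corollary 1.5.** The space $\mathcal B^\lambda_1(\mathbb R^d)$ is the trace space of $W^{1,1}(\mathbb R^{d+1}_+,\mu_0^\lambda)$. That is, every $f\in W^{1,1}(\mathbb R^{d+1}_+,\mu_0^\lambda)$ has a trace, and this trace belongs to $\mathcal B^\lambda_1(\mathbb R^d)$; and every $g\in\mathcal B^\lambda_1(\mathbb R^d)$ is the trace of some $f\in W^{1,1}(\mathbb R^{d+1}_+,\mu_0^\lambda)$. -/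

import Mathlib

open MeasureTheory Filter Topology
open scoped ContDiff

noncomputable section

namespace TraceBesov

/-- The space `ℝ^n` with its Euclidean norm and Lebesgue measure. -/
abbrev Euc (n : ℕ) : Type := EuclideanSpace ℝ (Fin n)

/-- The upper half-space `ℝ^{d+1}_+`: the points of `ℝ^{d+1}` whose last coordinate is positive. -/
def upperHalf (d : ℕ) : Set (Euc (d + 1)) := {y | 0 < y (Fin.last d)}

/-! ### The weights and the weighted measures -/

/-- The weight `ω_α^λ`, as a function of the point `y = (y_1, …, y_{d+1})` of the half-space. -/
def weight (d : ℕ) (α lam : ℝ) (y : Euc (d + 1)) : ℝ :=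
  if y (Fin.last d) ≤ 1 then
    |y (Fin.last d)| ^ α * Real.log (4 / |y (Fin.last d)|) ^ lam
  else Real.log 4 ^ lam

/-- The measure `μ_α^λ(E) = (log 4)^{-λ} ∫_E ω_α^λ dm_{d+1}` on the half-space (extended by zero to
the rest of `ℝ^{d+1}`). -/
def weightedMeasure (d : ℕ) (α lam : ℝ) : Measure (Euc (d + 1)) :=
  ENNReal.ofReal (1 / Real.log 4 ^ lam) •
    (volume.restrict (upperHalf d)).withDensity (fun y => ENNReal.ofReal (weight d α lam y))

/-! ### The weighted Sobolev space -/

/-- `G` is the distributional gradient of `f` in the half-space: both are locally integrable there,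
and `∫ f ∂_i φ = - ∫ G_i φ` for every smooth `φ` with compact support in the half-space. -/
def IsWeakGradient (d : ℕ) (f : Euc (d + 1) → ℝ) (G : Euc (d + 1) → Euc (d + 1)) : Prop :=
  LocallyIntegrableOn f (upperHalf d) volume ∧
  LocallyIntegrableOn G (upperHalf d) volume ∧
  ∀ φ : Euc (d + 1) → ℝ, ContDiff ℝ ∞ φ → HasCompactSupport φ → tsupport φ ⊆ upperHalf d →
    ∀ i : Fin (d + 1),
      ∫ y in upperHalf d, f y * fderiv ℝ φ y (EuclideanSpace.single i 1) =
        - ∫ y in upperHalf d, G y i * φ y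

/-- The weighted Sobolev space `W^{1,p}(ℝ^{d+1}_+, μ_α^λ)`. The functions are defined on `ℝ^{d+1}`,
but only their restrictions to the half-space matter. -/
def sobolevSpace (d : ℕ) (p α lam : ℝ) : Set (Euc (d + 1) → ℝ) :=
  {f | ∃ G : Euc (d + 1) → Euc (d + 1), IsWeakGradient d f G ∧
    eLpNorm f (ENNReal.ofReal p) (weightedMeasure d α lam) +
      eLpNorm G (ENNReal.ofReal p) (weightedMeasure d α lam) < ⊤}

/-! ### Dyadic cubes -/

/-- A dyadic semi-open cube `2^{-k}((0,1]^d + m)` of `ℝ^d`, given by its level `k ∈ ℤ` and its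
position `m ∈ ℤ^d`. For `d ≥ 1` distinct pairs `(k, m)` give distinct cubes. -/
structure DyadicCube (d : ℕ) where
  level : ℤ
  pos : Fin d → ℤ

namespace DyadicCube

variable {d : ℕ}

/-- The edge length `ℓ(Q) = 2^{-k}`. -/
def edge (Q : DyadicCube d) : ℝ := (2 : ℝ) ^ (-Q.level)

/-- The cube as a set of points: `x ∈ 2^{-k}((0,1]^d + m)`. -/
def toSet (Q : DyadicCube d) : Set (Euc d) :=
  {x | ∀ i, x i ∈ Set.Ioc (Q.edge * Q.pos i) (Q.edge * (Q.pos i + 1))}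

/-- The Whitney box `W(Q) = Q × (2^{-k}, 2^{-k+1}]` above the cube `Q` of level `k`. -/
def whitney (Q : DyadicCube d) : Set (Euc (d + 1)) :=
  {y | WithLp.toLp 2 (fun i : Fin d => y i.castSucc) ∈ Q.toSet ∧
    y (Fin.last d) ∈ Set.Ioc ((2 : ℝ) ^ (-Q.level)) ((2 : ℝ) ^ (-Q.level + 1))}

/-- The enlarged box `N(Q)`: the points of the half-space at distance less than `ℓ(Q)/4` from
`W(Q)`. -/
def enlarged (Q : DyadicCube d) : Set (Euc (d + 1)) :=
  {y | y ∈ upperHalf d ∧ Metric.infDist y Q.whitney < Q.edge / 4}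

/-- The layer of all dyadic cubes of level `k`, that is, of edge length `2^{-k}`. -/
def layer (d : ℕ) (k : ℤ) : Set (DyadicCube d) := {Q | Q.level = k}

/-- The level `2^{j-1}` of the previous selected layer, where `2^{-1}` is read as `1` for `j = 0`. -/
def previousLevel (j : ℕ) : ℤ := if j = 0 then 1 else 2 ^ (j - 1)

/-- The selected neighbors `Q' ≍ Q` of a cube `Q` of level `2^j`: the cubes of level `2^j` or
`2^{j-1}` whose closure meets the closure of `Q`. -/
def selectedNeighbors (j : ℕ) (Q : DyadicCube d) : Set (DyadicCube d) :=
  {Q' | Q' ∈ layer d (2 ^ j) ∪ layer d (previousLevel j) ∧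
    (closure Q.toSet ∩ closure Q'.toSet).Nonempty}

end DyadicCube

open DyadicCube

/-! ### The Besov-type space -/

/-- The `p`-th power of the homogeneous Besov-type seminorm: the sum over `j ≥ 0` of
`(2^j+2)^λ ∑_{Q ∈ Q_{d,2^j}} m_d(Q) ∑_{Q' ≍ Q} |f_Q - f_{Q'}|^p`, where `f_Q` is the average of `f`
over `Q`. The sum is taken in `[0, ∞]`. -/
def besovEnergy (d : ℕ) (p lam : ℝ) (f : Euc d → ℝ) : ENNReal :=
  ∑' j : ℕ, ENNReal.ofReal (((2 : ℝ) ^ j + 2) ^ lam) *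
    ∑' Q : layer d (2 ^ j), volume Q.1.toSet *
      ∑' Q' : selectedNeighbors j Q.1,
        ENNReal.ofReal (|(⨍ x in Q.1.toSet, f x) - ⨍ x in Q'.1.toSet, f x| ^ p)

/-- The Besov-type norm, with values in `[0, ∞]`. -/
def besovNorm (d : ℕ) (p lam : ℝ) (f : Euc d → ℝ) : ENNReal :=
  eLpNorm f (ENNReal.ofReal p) volume + besovEnergy d p lam f ^ (1 / p)

/-- The Besov-type space `B^λ_p(ℝ^d)`. -/
def besovSpace (d : ℕ) (p lam : ℝ) : Set (Euc d → ℝ) :=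
  {f | LocallyIntegrable f volume ∧ besovNorm d p lam f < ⊤}

/-! ### Traces -/

/-- The function `T_k f = ∑_{Q ∈ Q_{d,k}} (average of f over N(Q)) χ_Q` on `ℝ^d`. At each point
exactly one term of the sum has a nonzero characteristic function. -/
def traceApprox (d : ℕ) (k : ℕ) (f : Euc (d + 1) → ℝ) (x : Euc d) : ℝ :=
  ∑' Q : layer d (k : ℤ), Set.indicator Q.1.toSet (fun _ => ⨍ y in Q.1.enlarged, f y) x

/-- `g` is the trace of `f`: `T_k f → g` almost everywhere in `ℝ^d`. -/
def IsTrace (d : ℕ) (f : Euc (d + 1) → ℝ) (g : Euc d → ℝ) : Prop :=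
  ∀ᵐ x ∂(volume : Measure (Euc d)), Tendsto (fun k : ℕ => traceApprox d k f x) atTop (𝓝 (g x))

/-- `X` is the trace space of `Y`: every function in `Y` has a trace, which lies in `X`, and every
function in `X` is the trace of a function in `Y`. -/
def IsTraceSpace (d : ℕ) (X : Set (Euc d → ℝ)) (Y : Set (Euc (d + 1) → ℝ)) : Prop :=
  (∀ f ∈ Y, ∃ g ∈ X, IsTrace d f g) ∧ (∀ g ∈ X, ∃ f ∈ Y, IsTrace d f g)

end TraceBesov

end

noncomputable section

namespace TraceBesov

open DyadicCube

variable {d : ℕ}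

/-! ### Dyadic cubes as the fibres of a map into the cubes -/

/-! Both directions compare the energy with the weighted integral over horizontal strips. On the
strip of heights comparable to `2^{-k}` the weight is at least a multiple of `(k+2)^λ`, and the
energy only samples the levels `k = 2^j`, with weight `(2^j+2)^λ`.

Trace. `traceApprox d k f` is constant on the cubes of level `k`. A Poincaré inequality on boxes of
size `2^{-k}` (`IsWeakGradient.enorm_average_sub_le`) bounds in `L^1` both its increment from level
`k` to `k + 1` and its differences between neighboring cubes by `c ν_k`, where `ν_k` is the integral
of the gradient over strip `k` (`exists_lintegral_boxAvg_le`). Since the strips overlap boundedly,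
`∑ (k+2)^λ ν_k` is finite. Hence the approximations converge almost everywhere to some `g`, at `L^1`
distance at most `c ∑_{n ≥ k} ν_n` from level `k`. Averaging over cubes is an `L^1` contraction, so
the energy of `g` at level `2^j` is bounded by the tails starting at the two levels involved
(`lintegral_neighborSum_le`). Exchanging sums, `ν_n` receives the weight `∑_{2^j ≤ n} (2^j+2)^λ`;
because `λ > 0` this is essentially geometric and comparable to `(n+2)^λ`
(`tsum_weight_mul_tail_le`).

Extension. Let `u_j` be the dyadic average of `g` at level `2^j`, mollified at its own scale. The
extension is the telescoping series of the increments `u_j - u_{j-1}`, each cut off at height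
`2^{-2^j}`. In `L^1`, an increment costs the energy of two consecutive selected levels and its
gradient costs `2^{2^j}` times that (the first term also involves `‖g‖_1`). The weight integrated
over heights below `2^{-2^j}` is at most a multiple of `2^{-2^j}(2^j+2)^λ`
(`exists_lintegral_heightWeight_le`). The powers of two cancel and the Besov energy remains. Near
the boundary the series is a convex combination of two consecutive `u_j`, so it tends to `g`
nontangentially at Lebesgue points (`exists_abs_extension_sub_le`), and the boxes over a point lie
in a fixed cone. -/

/-- The position of the dyadic cube of level `k` that contains `x`. -/
def posAt (k : ℤ) (x : Euc d) : Fin d → ℤ := fun i => ⌈(2 : ℝ) ^ k * x i⌉ - 1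

/-- The dyadic cube of level `k` that contains `x`. -/
def cubeAt (k : ℤ) (x : Euc d) : DyadicCube d := ⟨k, posAt k x⟩

theorem two_zpow_pos (k : ℤ) : (0 : ℝ) < 2 ^ k := by positivity

theorem edge_pos (Q : DyadicCube d) : 0 < Q.edge := two_zpow_pos _

/-- Left-open intervals match the ceiling function; this makes the cubes of a layer the fibres of
`posAt`, from which partition and measurability follow. -/
theorem mem_Ioc_edge_iff (k m : ℤ) (s : ℝ) :
    s ∈ Set.Ioc ((2 : ℝ) ^ (-k) * m) ((2 : ℝ) ^ (-k) * (m + 1)) ↔ m = ⌈(2 : ℝ) ^ k * s⌉ - 1 := by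
  have h := two_zpow_pos k
  have h1 : (2 : ℝ) ^ (-k) * m < s ↔ (m : ℝ) < 2 ^ k * s := by
    rw [zpow_neg, inv_mul_lt_iff₀ h]
  have h2 : s ≤ (2 : ℝ) ^ (-k) * (m + 1) ↔ 2 ^ k * s ≤ m + 1 := by
    rw [zpow_neg, le_inv_mul_iff₀ h]
  rw [Set.mem_Ioc, h1, h2, eq_sub_iff_add_eq, eq_comm, Int.ceil_eq_iff]
  push_cast
  simp

theorem mem_toSet_iff (Q : DyadicCube d) (x : Euc d) : x ∈ Q.toSet ↔ cubeAt Q.level x = Q := by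
  obtain ⟨k, m⟩ := Q
  simp only [toSet, edge, Set.mem_ofPred_eq, cubeAt, DyadicCube.mk.injEq, true_and, mem_Ioc_edge_iff,
    funext_iff, posAt]
  exact forall_congr' fun i => eq_comm

theorem mem_cubeAt (k : ℤ) (x : Euc d) : x ∈ (cubeAt k x).toSet := by
  rw [mem_toSet_iff]; rfl

/-- The cubes of a layer are indexed by their positions. -/
def layerEquiv (d : ℕ) (k : ℤ) : (Fin d → ℤ) ≃ layer d k where
  toFun m := ⟨⟨k, m⟩, rfl⟩
  invFun Q := Q.1.pos
  left_inv _ := rfl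
  right_inv := by rintro ⟨⟨l, m⟩, h⟩; cases h; rfl

instance countable_layer (k : ℤ) : Countable (layer d k) := (layerEquiv d k).symm.injective.countable

theorem measurable_posAt (k : ℤ) : Measurable (posAt k : Euc d → Fin d → ℤ) := by
  refine measurable_pi_lambda _ fun i => ?_
  have h : Measurable fun x : Euc d => (2 : ℝ) ^ k * x i := by fun_prop
  exact (measurable_of_countable (fun n : ℤ => n - 1)).comp (Int.measurable_ceil.comp h)

theorem measurable_comp_cubeAt {β : Type*} [MeasurableSpace β] (k : ℤ) (F : DyadicCube d → β) :
    Measurable fun x : Euc d => F (cubeAt k x) :=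
  (measurable_of_countable fun m => F ⟨k, m⟩).comp (measurable_posAt k)

theorem measurableSet_toSet (Q : DyadicCube d) : MeasurableSet Q.toSet := by
  have : Q.toSet = posAt Q.level ⁻¹' {Q.pos} := by
    ext x
    rw [mem_toSet_iff]
    obtain ⟨k, m⟩ := Q
    simp [cubeAt]
  rw [this]
  exact measurable_posAt _ (measurableSet_singleton _)

/-- The standard identification of `Euc n` with a product of lines, as a homeomorphism. -/
def eucHomeo (n : ℕ) : Euc n ≃ₜ (Fin n → ℝ) := PiLp.homeomorph 2 _

theorem toSet_eq_preimage (Q : DyadicCube d) :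
    Q.toSet = eucHomeo d ⁻¹'
      Set.pi Set.univ fun i => Set.Ioc (Q.edge * Q.pos i) (Q.edge * (Q.pos i + 1)) := by
  ext x
  simp only [toSet, eucHomeo, Set.mem_ofPred_eq, Set.mem_preimage, Set.mem_pi, Set.mem_univ,
    true_implies]
  rfl

theorem volume_preimage_pi (n : ℕ) (s : Fin n → Set ℝ) (hs : ∀ i, MeasurableSet (s i)) :
    volume {y : Euc n | ∀ i, y i ∈ s i} = ∏ i, volume (s i) := by
  have h := (PiLp.volume_preserving_ofLp (Fin n)).measure_preimage
    (MeasurableSet.univ_pi hs).nullMeasurableSet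
  rw [volume_pi_pi] at h
  rw [← h]
  congr 1
  ext y
  simp [Set.mem_pi]

theorem volume_toSet (Q : DyadicCube d) : volume Q.toSet = ENNReal.ofReal Q.edge ^ d := by
  have h := volume_preimage_pi d
    (fun i => Set.Ioc (Q.edge * Q.pos i) (Q.edge * (Q.pos i + 1))) fun i => measurableSet_Ioc
  rw [toSet, h]
  simp [mul_add]

theorem volume_toSet_ne_zero (Q : DyadicCube d) : volume Q.toSet ≠ 0 := by
  rw [volume_toSet]
  exact pow_ne_zero _ (by simpa using edge_pos Q)

theorem volume_toSet_ne_top (Q : DyadicCube d) : volume Q.toSet ≠ ⊤ := by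
  rw [volume_toSet]
  exact ENNReal.pow_ne_top ENNReal.ofReal_ne_top

theorem closure_toSet (Q : DyadicCube d) :
    closure Q.toSet = {x | ∀ i, x i ∈ Set.Icc (Q.edge * Q.pos i) (Q.edge * (Q.pos i + 1))} := by
  rw [toSet_eq_preimage, ← Homeomorph.preimage_closure, closure_pi_set]
  ext x
  simp only [Set.mem_preimage, Set.mem_pi, Set.mem_univ, true_implies, Set.mem_ofPred_eq]
  refine forall_congr' fun i => ?_
  rw [closure_Ioc (by have := edge_pos Q; intro h; nlinarith)]
  rfl

theorem iUnion_layer (k : ℤ) : (⋃ Q : layer d k, Q.1.toSet) = Set.univ :=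
  Set.eq_univ_of_forall fun x => Set.mem_iUnion.2 ⟨⟨cubeAt k x, rfl⟩, mem_cubeAt k x⟩

theorem cubeAt_eq_of_mem {k : ℤ} (Q : layer d k) {x : Euc d} (hx : x ∈ Q.1.toSet) :
    cubeAt k x = Q.1 := by
  have h := (mem_toSet_iff _ _).1 hx
  rwa [show Q.1.level = k from Q.2] at h

theorem pairwise_disjoint_layer (k : ℤ) :
    Pairwise (Function.onFun Disjoint fun Q : layer d k => Q.1.toSet) := by
  intro Q Q' hne
  refine Set.disjoint_left.2 fun x hx hx' => hne (Subtype.ext ?_)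
  rw [← cubeAt_eq_of_mem Q hx, ← cubeAt_eq_of_mem Q' hx']

theorem lintegral_eq_tsum_layer (k : ℤ) (F : Euc d → ENNReal) :
    ∫⁻ x, F x = ∑' Q : layer d k, ∫⁻ x in Q.1.toSet, F x := by
  rw [← lintegral_iUnion (fun Q => measurableSet_toSet _) (pairwise_disjoint_layer k), iUnion_layer,
    Measure.restrict_univ]

/-- Turns volume-weighted sums over a layer into integrals, where the triangle inequality and
translation invariance are available. -/
theorem lintegral_comp_cubeAt (k : ℤ) (F : DyadicCube d → ENNReal) :
    ∫⁻ x, F (cubeAt k x) = ∑' Q : layer d k, volume Q.1.toSet * F Q.1 := by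
  rw [lintegral_eq_tsum_layer k]
  refine tsum_congr fun Q => ?_
  rw [setLIntegral_congr_fun (g := fun _ => F Q.1) (measurableSet_toSet _)
    fun x hx => by simp only [cubeAt_eq_of_mem Q hx], setLIntegral_const, mul_comm]

/-! ### Translations by lattice vectors and neighbors -/

/-- The vector `2^{-k} e` for `e ∈ ℤ^d`. -/
def latticeVec (k : ℤ) (e : Fin d → ℤ) : Euc d := WithLp.toLp 2 fun i => (2 : ℝ) ^ (-k) * e i

theorem latticeVec_apply (k : ℤ) (e : Fin d → ℤ) (i : Fin d) :
    latticeVec k e i = (2 : ℝ) ^ (-k) * e i := rfl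

theorem cubeAt_add_latticeVec (k : ℤ) (x : Euc d) (e : Fin d → ℤ) :
    cubeAt k (x + latticeVec k e) = ⟨k, posAt k x + e⟩ := by
  simp only [cubeAt, DyadicCube.mk.injEq, true_and]
  funext i
  have h : (2 : ℝ) ^ k * (x i + (2 : ℝ) ^ (-k) * e i) = 2 ^ k * x i + e i := by
    rw [mul_add, ← mul_assoc, ← zpow_add₀ two_ne_zero]; simp
  simp only [posAt, PiLp.add_apply, latticeVec_apply, h, Pi.add_apply, Int.ceil_add_intCast]
  ring

/-- The offsets of the neighbors of a cube in its layer. -/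
def offsets (d : ℕ) : Finset (Fin d → ℤ) := Fintype.piFinset fun _ => Finset.Icc (-1) 1

theorem mem_offsets {e : Fin d → ℤ} : e ∈ offsets d ↔ ∀ i, |e i| ≤ 1 := by
  simp [offsets, abs_le]

theorem closure_inter_nonempty_iff (k : ℤ) (m m' : Fin d → ℤ) :
    (closure (⟨k, m⟩ : DyadicCube d).toSet ∩ closure (⟨k, m'⟩ : DyadicCube d).toSet).Nonempty ↔
      m' - m ∈ offsets d := by
  have hk := two_zpow_pos (-k)
  rw [mem_offsets, closure_toSet, closure_toSet]
  constructor
  · rintro ⟨x, hx, hx'⟩ i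
    have h1 := hx i
    have h2 := hx' i
    simp only [edge, Set.mem_Icc] at h1 h2
    have h3 : (m i : ℝ) ≤ m' i + 1 := le_of_mul_le_mul_left (h1.1.trans h2.2) hk
    have h4 : (m' i : ℝ) ≤ m i + 1 := le_of_mul_le_mul_left (h2.1.trans h1.2) hk
    norm_cast at h3 h4
    rw [Pi.sub_apply, abs_le]
    omega
  · intro h
    -- When two integers differ by at most one, the larger lies in both closed unit intervals
    -- starting at them.
    refine ⟨WithLp.toLp 2 fun i => (2 : ℝ) ^ (-k) * (max (m i) (m' i) : ℤ), ?_, ?_⟩ <;> intro i <;>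
    · have h1 := abs_le.1 (h i)
      rw [Pi.sub_apply] at h1
      simp only [edge, Set.mem_Icc]
      refine ⟨mul_le_mul_of_nonneg_left ?_ hk.le, mul_le_mul_of_nonneg_left ?_ hk.le⟩
      · norm_cast
        omega
      · norm_cast
        omega

/-- Dyadic nesting: the coarse ceiling is at most `c` exactly when the fine one is at most `2^n c`,
so the fine ceiling determines the coarse one. -/
theorem cubeAt_eq_of_cubeAt_eq {k l : ℤ} (hkl : k ≤ l) {x y : Euc d}
    (h : cubeAt l x = cubeAt l y) : cubeAt k x = cubeAt k y := by
  obtain ⟨n, rfl⟩ := Int.le.dest hkl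
  simp only [cubeAt, DyadicCube.mk.injEq, true_and, funext_iff, posAt, sub_left_inj] at h ⊢
  intro i
  refine eq_of_forall_ge_iff fun c => ?_
  have key : ∀ s : ℝ, ⌈(2 : ℝ) ^ k * s⌉ ≤ c ↔ ⌈(2 : ℝ) ^ (k + n) * s⌉ ≤ 2 ^ n * c := by
    intro s
    rw [Int.ceil_le, Int.ceil_le, zpow_add₀ two_ne_zero, zpow_natCast]
    push_cast
    rw [mul_comm ((2 : ℝ) ^ k) (2 ^ n), mul_assoc, mul_le_mul_iff_right₀ (by positivity)]
  rw [key, key, h i]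

theorem toSet_cubeAt_subset {k l : ℤ} (hkl : k ≤ l) (x : Euc d) :
    (cubeAt l x).toSet ⊆ (cubeAt k x).toSet := by
  intro y hy
  rw [mem_toSet_iff] at hy ⊢
  exact cubeAt_eq_of_cubeAt_eq hkl hy

/-- A cube of a coarser layer that touches the cube at `x` is a neighbor of the coarse cube
at `x`. -/
theorem exists_offset_of_closure_inter {k l : ℤ} (hkl : k ≤ l) (x : Euc d) {Q : DyadicCube d}
    (hQ : Q.level = k) (h : (closure (cubeAt l x).toSet ∩ closure Q.toSet).Nonempty) :
    ∃ e ∈ offsets d, Q = cubeAt k (x + latticeVec k e) := by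
  obtain ⟨k', m⟩ := Q
  obtain rfl : k' = k := hQ
  have h' := h.mono (Set.inter_subset_inter_left _ (closure_mono (toSet_cubeAt_subset hkl x)))
  refine ⟨m - posAt k' x, (closure_inter_nonempty_iff k' _ _).1 h', ?_⟩
  rw [cubeAt_add_latticeVec]
  simp

theorem closure_inter_cubeAt_nonempty (k : ℤ) (x : Euc d) {e : Fin d → ℤ} (he : e ∈ offsets d) :
    (closure (cubeAt k x).toSet ∩ closure (cubeAt k (x + latticeVec k e)).toSet).Nonempty := by
  rw [cubeAt_add_latticeVec]
  refine (closure_inter_nonempty_iff k _ _).2 ?_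
  simpa using he

/-! ### Averages over dyadic cubes -/

/-- The conditional expectation of `g` with respect to the cubes of level `k`. -/
def cubeAvg (k : ℤ) (g : Euc d → ℝ) (x : Euc d) : ℝ := ⨍ y in (cubeAt k x).toSet, g y

theorem measurable_cubeAvg (k : ℤ) (g : Euc d → ℝ) : Measurable (cubeAvg k g) :=
  measurable_comp_cubeAt k fun Q => ⨍ y in Q.toSet, g y

theorem integrableOn_toSet {g : Euc d → ℝ} (hg : LocallyIntegrable g volume) (Q : DyadicCube d) :
    IntegrableOn g Q.toSet volume := by
  refine (hg.integrableOn_isCompact (k := closure Q.toSet) ?_).mono_set subset_closure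
  rw [toSet_eq_preimage, ← Homeomorph.preimage_closure, closure_pi_set]
  refine (eucHomeo d).isCompact_preimage.2 (isCompact_univ_pi fun i => ?_)
  exact (isCompact_Icc.closure_of_subset Set.Ioc_subset_Icc_self)

theorem measure_mul_enorm_setAverage_le {α : Type*} [MeasurableSpace α] {μ : Measure α} (s : Set α)
    (hs : μ s ≠ ⊤) (g : α → ℝ) : μ s * ‖⨍ y in s, g y ∂μ‖ₑ ≤ ∫⁻ y in s, ‖g y‖ₑ ∂μ := by
  rcases eq_or_ne (μ s) 0 with h0 | h0
  · simp [h0]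
  rw [setAverage_eq, enorm_smul, ← mul_assoc]
  have : μ s * ‖(μ.real s)⁻¹‖ₑ = 1 := by
    have hpos : 0 < μ.real s := ENNReal.toReal_pos h0 hs
    rw [Real.enorm_eq_ofReal (by positivity), ENNReal.ofReal_inv_of_pos hpos, measureReal_def,
      ENNReal.ofReal_toReal hs, ENNReal.mul_inv_cancel h0 hs]
  rw [this, one_mul]
  exact enorm_integral_le_lintegral_enorm _

theorem lintegral_enorm_cubeAvg_le (k : ℤ) (g : Euc d → ℝ) :
    ∫⁻ x, ‖cubeAvg k g x‖ₑ ≤ ∫⁻ x, ‖g x‖ₑ := by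
  rw [lintegral_eq_tsum_layer k fun x => ‖g x‖ₑ]
  refine (lintegral_comp_cubeAt k fun Q => ‖⨍ y in Q.toSet, g y‖ₑ).trans_le ?_
  exact ENNReal.tsum_le_tsum fun Q =>
    measure_mul_enorm_setAverage_le _ (volume_toSet_ne_top _) _

theorem cubeAvg_sub (k : ℤ) {g h : Euc d → ℝ} (hg : LocallyIntegrable g volume)
    (hh : LocallyIntegrable h volume) (x : Euc d) :
    cubeAvg k (g - h) x = cubeAvg k g x - cubeAvg k h x := by
  simp only [cubeAvg, setAverage_eq, Pi.sub_apply]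
  rw [integral_sub (integrableOn_toSet hg _) (integrableOn_toSet hh _), smul_sub]

theorem cubeAvg_comp_cubeAt (k : ℤ) (F : DyadicCube d → ℝ) (x : Euc d) :
    cubeAvg k (fun y => F (cubeAt k y)) x = F (cubeAt k x) := by
  rw [cubeAvg, setAverage_congr_fun (g := fun _ => F (cubeAt k x)) (measurableSet_toSet _)
    (ae_of_all _ fun y hy => by
      have := (mem_toSet_iff _ _).1 hy
      simp only [show cubeAt k y = cubeAt k x from this]),
    setAverage_const (volume_toSet_ne_zero _) (volume_toSet_ne_top _)]

/-! ### The Besov energy as a sum of integrals of differences -/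

/-- The inner sum of the energy for the exponent `p = 1`. -/
def neighborSum (j : ℕ) (g : Euc d → ℝ) (Q : DyadicCube d) : ENNReal :=
  ∑' Q' : selectedNeighbors j Q, ‖(⨍ x in Q.toSet, g x) - ⨍ x in Q'.1.toSet, g x‖ₑ

theorem besovEnergy_one (lam : ℝ) (g : Euc d → ℝ) :
    besovEnergy d 1 lam g = ∑' j : ℕ, ENNReal.ofReal (((2 : ℝ) ^ j + 2) ^ lam) *
      ∫⁻ x : Euc d, neighborSum j g (cubeAt (2 ^ j) x) := by
  refine tsum_congr fun j => ?_
  congr 1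
  rw [lintegral_comp_cubeAt]
  simp only [neighborSum, Real.rpow_one, Real.enorm_eq_ofReal_abs]

theorem previousLevel_le (j : ℕ) : previousLevel j ≤ 2 ^ j := by
  unfold previousLevel
  split_ifs with h
  · simp [h]
  · exact pow_le_pow_right₀ (by norm_num) (Nat.sub_le _ _)

/-- The two families may overlap, and for `j = 0` they coincide because both levels are `1`. Double
counting is harmless in an upper bound. -/
theorem tsum_subtype_le_of_subset_union {α ι : Type*} (S : Set α) (h : α → ENNReal) (s : Finset ι)
    (A B : ι → α) (hS : ∀ a ∈ S, (∃ i ∈ s, a = A i) ∨ ∃ i ∈ s, a = B i) :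
    ∑' a : S, h a ≤ ∑ i ∈ s, h (A i) + ∑ i ∈ s, h (B i) := by
  classical
  have hsub : S ⊆ ((s.image A ∪ s.image B : Finset α) : Set α) := by
    intro a ha
    rcases hS a ha with ⟨i, hi, rfl⟩ | ⟨i, hi, rfl⟩
    · simp only [Finset.coe_union, Finset.coe_image]
      exact Or.inl ⟨i, hi, rfl⟩
    · simp only [Finset.coe_union, Finset.coe_image]
      exact Or.inr ⟨i, hi, rfl⟩
  calc ∑' a : S, h a ≤ ∑' a : ((s.image A ∪ s.image B : Finset α) : Set α), h a :=
        ENNReal.tsum_mono_subtype h hsub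
    _ = ∑ a ∈ s.image A ∪ s.image B, h a := Finset.tsum_subtype' _ h
    _ ≤ ∑ a ∈ s.image A, h a + ∑ a ∈ s.image B, h a := by
        rw [← Finset.sum_union_inter]
        exact le_self_add
    _ ≤ _ := add_le_add (Finset.sum_image_le_of_nonneg fun _ _ => zero_le)
        (Finset.sum_image_le_of_nonneg fun _ _ => zero_le)

theorem neighborSum_le (j : ℕ) (g : Euc d → ℝ) (x : Euc d) :
    neighborSum j g (cubeAt (2 ^ j) x) ≤
      ∑ e ∈ offsets d, ‖cubeAvg (2 ^ j) g x - cubeAvg (2 ^ j) g (x + latticeVec (2 ^ j) e)‖ₑ +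
      ∑ e ∈ offsets d, ‖cubeAvg (2 ^ j) g x -
        cubeAvg (previousLevel j) g (x + latticeVec (previousLevel j) e)‖ₑ := by
  refine tsum_subtype_le_of_subset_union (selectedNeighbors j (cubeAt (2 ^ j) x))
    (fun Q' => ‖(⨍ y in (cubeAt (2 ^ j) x).toSet, g y) - ⨍ y in Q'.toSet, g y‖ₑ) (offsets d)
    (fun e => cubeAt (2 ^ j) (x + latticeVec (2 ^ j) e))
    (fun e => cubeAt (previousLevel j) (x + latticeVec (previousLevel j) e)) ?_
  rintro Q' ⟨h | h, hne⟩
  · exact Or.inl (exists_offset_of_closure_inter le_rfl x h hne)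
  · exact Or.inr (exists_offset_of_closure_inter (previousLevel_le j) x h hne)

theorem enorm_sub_le_neighborSum (j : ℕ) (g : Euc d → ℝ) (x : Euc d) {e : Fin d → ℤ}
    (he : e ∈ offsets d) :
    ‖cubeAvg (2 ^ j) g x - cubeAvg (2 ^ j) g (x + latticeVec (2 ^ j) e)‖ₑ ≤
      neighborSum j g (cubeAt (2 ^ j) x) :=
  ENNReal.le_tsum (f := fun Q' : selectedNeighbors j (cubeAt (2 ^ j) x) =>
      ‖(⨍ y in (cubeAt (2 ^ j) x).toSet, g y) - ⨍ y in Q'.1.toSet, g y‖ₑ)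
    ⟨cubeAt (2 ^ j) (x + latticeVec (2 ^ j) e), Or.inl rfl, closure_inter_cubeAt_nonempty _ x he⟩

theorem enorm_sub_previousLevel_le_neighborSum (j : ℕ) (g : Euc d → ℝ) (x : Euc d) :
    ‖cubeAvg (2 ^ j) g x - cubeAvg (previousLevel j) g x‖ₑ ≤
      neighborSum j g (cubeAt (2 ^ j) x) :=
  ENNReal.le_tsum (f := fun Q' : selectedNeighbors j (cubeAt (2 ^ j) x) =>
      ‖(⨍ y in (cubeAt (2 ^ j) x).toSet, g y) - ⨍ y in Q'.1.toSet, g y‖ₑ)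
    ⟨cubeAt (previousLevel j) x, Or.inr rfl,
      ⟨x, subset_closure (mem_cubeAt _ x), subset_closure (mem_cubeAt _ x)⟩⟩

/-- Pass from `h x` through `T x` and `T (x + v)` to `S (x + v)`; translation invariance removes the
shift from the last difference. -/
theorem lintegral_enorm_sub_translate_le (h : Euc d → ℝ) (hh : Measurable h) {S T : Euc d → ℝ}
    (hT : Measurable T) (v : Euc d) :
    ∫⁻ x, ‖h x - S (x + v)‖ₑ ≤
      (∫⁻ x, ‖h x - T x‖ₑ) + (∫⁻ x, ‖T x - T (x + v)‖ₑ) + ∫⁻ x, ‖T x - S x‖ₑ := by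
  have h1 : ∫⁻ x, ‖T x - S x‖ₑ = ∫⁻ x, ‖T (x + v) - S (x + v)‖ₑ :=
    (lintegral_add_right_eq_self (fun x => ‖T x - S x‖ₑ) v).symm
  rw [h1, ← lintegral_add_left (by fun_prop), ← lintegral_add_left (by fun_prop)]
  refine lintegral_mono fun x => ?_
  calc ‖h x - S (x + v)‖ₑ = ‖(h x - T x) + (T x - T (x + v)) + (T (x + v) - S (x + v))‖ₑ := by
        congr 1; ring
    _ ≤ _ := (enorm_add_le _ _).trans (add_le_add_left (enorm_add_le _ _) _)

/-- The distance of `g` to its averages is controlled by the distance to any function that is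
constant on the cubes. -/
theorem lintegral_enorm_cubeAvg_sub_le (k : ℤ) {g : Euc d → ℝ} (hg : LocallyIntegrable g volume)
    (F : DyadicCube d → ℝ) (hF : LocallyIntegrable (fun x => F (cubeAt k x)) volume) :
    ∫⁻ x, ‖cubeAvg k g x - F (cubeAt k x)‖ₑ ≤ ∫⁻ x, ‖g x - F (cubeAt k x)‖ₑ := by
  refine le_trans (le_of_eq ?_) (lintegral_enorm_cubeAvg_le k (g - fun x => F (cubeAt k x)))
  refine lintegral_congr fun x => ?_
  rw [cubeAvg_sub k hg hF, cubeAvg_comp_cubeAt]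

/-- One level of the energy, estimated through functions that are constant on cubes. -/
theorem lintegral_neighborSum_le (j : ℕ) {g : Euc d → ℝ} (hgm : Measurable g)
    (hg : LocallyIntegrable g volume) (F : DyadicCube d → ℝ)
    (hF : ∀ k, LocallyIntegrable (fun x => F (cubeAt k x)) volume) (δ : ℤ → ENNReal)
    (hδ : ∀ k, ∫⁻ x : Euc d, ‖g x - F (cubeAt k x)‖ₑ ≤ δ k)
    (hδ' : ∀ k, ∀ e ∈ offsets d,
      ∫⁻ x : Euc d, ‖F (cubeAt k x) - F (cubeAt k (x + latticeVec k e))‖ₑ ≤ δ k) :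
    ∫⁻ x : Euc d, neighborSum j g (cubeAt (2 ^ j) x) ≤
      (offsets d).card * (5 * δ (2 ^ j) + 3 * δ (previousLevel j)) := by
  have hFm : ∀ k, Measurable fun x : Euc d => F (cubeAt k x) := fun k => measurable_comp_cubeAt k F
  have hAm : ∀ k, Measurable (cubeAvg k g) := fun k => measurable_cubeAvg k g
  have hA : ∀ k, ∫⁻ x, ‖cubeAvg k g x - F (cubeAt k x)‖ₑ ≤ δ k := fun k =>
    (lintegral_enorm_cubeAvg_sub_le k hg F (hF k)).trans (hδ k)
  have hA' : ∀ k, ∫⁻ x, ‖F (cubeAt k x) - cubeAvg k g x‖ₑ ≤ δ k := fun k => by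
    simpa only [enorm_sub_rev] using hA k
  have hm1 : ∀ (k l : ℤ) (v : Euc d),
      Measurable fun x => ‖cubeAvg k g x - cubeAvg l g (x + v)‖ₑ := by
    intro k l v
    have := hAm k
    have := hAm l
    fun_prop
  have hsame : ∀ e ∈ offsets d, ∫⁻ x, ‖cubeAvg (2 ^ j) g x -
      cubeAvg (2 ^ j) g (x + latticeVec (2 ^ j) e)‖ₑ ≤ 3 * δ (2 ^ j) := by
    intro e he
    refine (lintegral_enorm_sub_translate_le _ (hAm _) (hFm (2 ^ j)) _).trans ?_
    refine (add_le_add (add_le_add (hA _) (hδ' _ e he)) (hA' _)).trans (le_of_eq ?_)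
    ring
  have hprev : ∀ e ∈ offsets d, ∫⁻ x, ‖cubeAvg (2 ^ j) g x - cubeAvg (previousLevel j) g
      (x + latticeVec (previousLevel j) e)‖ₑ ≤ 2 * δ (2 ^ j) + 3 * δ (previousLevel j) := by
    intro e he
    refine (lintegral_enorm_sub_translate_le _ (hAm _) (hFm (previousLevel j)) _).trans ?_
    -- The two levels are linked through `g` itself: fine average, fine step function, `g`, coarse
    -- step function.
    have h1 : ∫⁻ x, ‖cubeAvg (2 ^ j) g x - F (cubeAt (previousLevel j) x)‖ₑ ≤
        2 * δ (2 ^ j) + δ (previousLevel j) := by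
      calc ∫⁻ x, ‖cubeAvg (2 ^ j) g x - F (cubeAt (previousLevel j) x)‖ₑ
          ≤ ∫⁻ x, (‖cubeAvg (2 ^ j) g x - F (cubeAt (2 ^ j) x)‖ₑ + ‖g x - F (cubeAt (2 ^ j) x)‖ₑ +
            ‖g x - F (cubeAt (previousLevel j) x)‖ₑ) := by
            refine lintegral_mono fun x => ?_
            rw [← enorm_sub_rev (F (cubeAt (2 ^ j) x)) (g x)]
            calc _ = ‖(cubeAvg (2 ^ j) g x - F (cubeAt (2 ^ j) x)) + (F (cubeAt (2 ^ j) x) - g x) +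
                    (g x - F (cubeAt (previousLevel j) x))‖ₑ := by congr 1; ring
              _ ≤ _ := (enorm_add_le _ _).trans (add_le_add_left (enorm_add_le _ _) _)
        _ ≤ δ (2 ^ j) + δ (2 ^ j) + δ (previousLevel j) := by
            have h1 : Measurable fun x => ‖cubeAvg (2 ^ j) g x - F (cubeAt (2 ^ j) x)‖ₑ :=
              ((hAm _).sub (hFm _)).enorm
            have h2 : Measurable fun x => ‖g x - F (cubeAt (2 ^ j) x)‖ₑ :=
              (hgm.sub (hFm _)).enorm
            have h12 : Measurable fun x => ‖cubeAvg (2 ^ j) g x - F (cubeAt (2 ^ j) x)‖ₑ +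
              ‖g x - F (cubeAt (2 ^ j) x)‖ₑ := h1.add h2
            rw [lintegral_add_left h12, lintegral_add_left h1]
            exact add_le_add (add_le_add (hA _) (hδ _)) (hδ _)
        _ = _ := by ring
    refine (add_le_add (add_le_add h1 (hδ' _ e he)) (hA' _)).trans (le_of_eq ?_)
    ring
  refine (lintegral_mono fun x => neighborSum_le j g x).trans ?_
  rw [lintegral_add_left (Finset.measurable_sum _ fun e _ => hm1 _ _ _),
    lintegral_finsetSum _ fun e _ => hm1 _ _ _, lintegral_finsetSum _ fun e _ => hm1 _ _ _]
  refine (add_le_add (Finset.sum_le_card_nsmul _ _ _ hsame)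
    (Finset.sum_le_card_nsmul _ _ _ hprev)).trans (le_of_eq ?_)
  simp only [nsmul_eq_mul]
  ring

/-! ### A Poincaré inequality for weak gradients -/

theorem isOpen_upperHalf (d : ℕ) : IsOpen (upperHalf d) :=
  isOpen_lt continuous_const (by fun_prop)

theorem integrable_mul_of_tsupport_subset {n : ℕ} {U : Set (Euc n)} {h ψ : Euc n → ℝ}
    (hh : LocallyIntegrableOn h U volume) (hψ : Continuous ψ) (hc : HasCompactSupport ψ)
    (hs : tsupport ψ ⊆ U) : Integrable (fun y => h y * ψ y) volume := by
  have h1 : IntegrableOn h (tsupport ψ) volume := hh.integrableOn_compact_subset hs hc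
  refine (h1.mul_continuousOn hψ.continuousOn hc).integrable_of_forall_notMem_eq_zero fun y hy => ?_
  rw [image_eq_zero_of_notMem_tsupport hy, mul_zero]

/-- Linearity passes from the coordinate directions to an arbitrary `v`, as needed when a test
function is moved along a segment. -/
theorem IsWeakGradient.integral_mul_fderiv {f : Euc (d + 1) → ℝ} {G : Euc (d + 1) → Euc (d + 1)}
    (h : IsWeakGradient d f G) {ψ : Euc (d + 1) → ℝ} (hψ : ContDiff ℝ ∞ ψ)
    (hc : HasCompactSupport ψ) (hs : tsupport ψ ⊆ upperHalf d) (v : Euc (d + 1)) :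
    ∫ y in upperHalf d, f y * fderiv ℝ ψ y v = - ∫ y in upperHalf d, inner ℝ v (G y) * ψ y := by
  have hv : v = ∑ i, v i • EuclideanSpace.single i (1 : ℝ) := by
    ext i
    simp [Pi.single_apply]
  have hcoord : ∀ i, LocallyIntegrableOn (fun y => G y i) (upperHalf d) volume := by
    intro i y hy
    obtain ⟨s, hs, hG⟩ := h.2.1 y hy
    refine ⟨s, hs, ?_⟩
    exact (ContinuousLinearMap.integrable_comp
      (EuclideanSpace.proj i : Euc (d + 1) →L[ℝ] ℝ) hG)
  have hder : ∀ i, Integrable (fun y => f y * fderiv ℝ ψ y (EuclideanSpace.single i 1)) volume := by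
    intro i
    refine integrable_mul_of_tsupport_subset (U := upperHalf d) h.1 ?_ ?_ ?_
    · exact (hψ.continuous_fderiv (by simp)).clm_apply continuous_const
    · exact hc.fderiv_apply ℝ _
    · exact (tsupport_fderiv_apply_subset ℝ _).trans hs
  have e1 : ∀ y, f y * fderiv ℝ ψ y v =
      ∑ i, v i * (f y * fderiv ℝ ψ y (EuclideanSpace.single i 1)) := by
    intro y
    conv_lhs => rw [hv, map_sum, Finset.mul_sum]
    refine Finset.sum_congr rfl fun i _ => ?_
    rw [map_smul, smul_eq_mul]
    ring
  have e2 : ∀ y, inner ℝ v (G y) * ψ y = ∑ i, v i * (G y i * ψ y) := by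
    intro y
    rw [PiLp.inner_apply, Finset.sum_mul]
    refine Finset.sum_congr rfl fun i _ => ?_
    simp only [RCLike.inner_apply, conj_trivial]
    ring
  simp only [e1, e2]
  rw [integral_finsetSum _ fun i _ => (hder i).integrableOn.const_mul _,
    integral_finsetSum _ fun i _ => ((integrable_mul_of_tsupport_subset (hcoord i) hψ.continuous hc
      hs).integrableOn.const_mul _), ← Finset.sum_neg_distrib]
  refine Finset.sum_congr rfl fun i _ => ?_
  rw [integral_const_mul, integral_const_mul, h.2.2 ψ hψ hc hs i, mul_neg]

/-- The translation estimate for a test function. -/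
theorem IsWeakGradient.abs_integral_translate_sub_le {f : Euc (d + 1) → ℝ}
    {G : Euc (d + 1) → Euc (d + 1)} (h : IsWeakGradient d f G) {C K : Set (Euc (d + 1))}
    (hC : IsCompact C) (hCU : C ⊆ upperHalf d) (hKC : K ⊆ C)
    {φ : Euc (d + 1) → ℝ} (hφ : ContDiff ℝ ∞ φ) (hc : HasCompactSupport φ)
    (hφ1 : ∀ y, |φ y| ≤ 1) (v : Euc (d + 1))
    (hv : ∀ s ∈ Set.Icc (0 : ℝ) 1, ∀ y ∈ tsupport φ, y + s • v ∈ K) :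
    |(∫ z in C, f z * φ (z - v)) - ∫ z in C, f z * φ z| ≤ ‖v‖ * ∫ z in K, ‖G z‖ := by
  have hfC : IntegrableOn f C volume := h.1.integrableOn_compact_subset hCU hC
  have hGC : IntegrableOn G C volume := h.2.1.integrableOn_compact_subset hCU hC
  have hGK : IntegrableOn (fun z => ‖v‖ * ‖G z‖) K volume :=
    (hGC.mono_set hKC).norm.const_mul _
  have hcont : Continuous (fderiv ℝ φ) := hφ.continuous_fderiv (by simp)
  obtain ⟨M, hM⟩ := (hc.fderiv ℝ).exists_bound_of_continuous hcont
  have hdiff : Differentiable ℝ φ := hφ.differentiable (by simp)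
  -- The derivative falls on the smooth factor, so differentiating in `s` under the integral needs
  -- only integrability of `f`. The weak gradient then bounds this derivative uniformly on `[0, 1]`.
  have hline : ∀ (z : Euc (d + 1)) (s : ℝ), HasDerivAt (fun s : ℝ => f z * φ (z - s • v))
      (f z * -(fderiv ℝ φ (z - s • v) v)) s := by
    intro z s
    have h1 : HasDerivAt (fun s : ℝ => z - s • v) (-v) s := by
      simpa using ((hasDerivAt_id s).smul_const v).const_sub z
    have h2 := (hdiff (z - s • v)).hasFDerivAt.comp_hasDerivAt s h1
    simpa using h2.const_mul (f z)
  have hder : ∀ s : ℝ, HasDerivAt (fun s : ℝ => ∫ z in C, f z * φ (z - s • v))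
      (∫ z in C, f z * -(fderiv ℝ φ (z - s • v) v)) s := by
    intro s
    refine (hasDerivAt_integral_of_dominated_loc_of_deriv_le (s := Set.univ) (μ := volume.restrict C)
      (F := fun (s : ℝ) z => f z * φ (z - s • v))
      (F' := fun (s : ℝ) z => f z * -(fderiv ℝ φ (z - s • v) v))
      (bound := fun z => ‖f z‖ * (M * ‖v‖)) univ_mem ?_ ?_ ?_ ?_ ?_ ?_).2
    · refine Eventually.of_forall fun s => hfC.aestronglyMeasurable.mul ?_
      exact (hφ.continuous.comp (by fun_prop)).aestronglyMeasurable
    · refine hfC.mul_bdd (c := 1)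
        (hφ.continuous.comp (by fun_prop)).aestronglyMeasurable (ae_of_all _ fun z => hφ1 _)
    · refine hfC.aestronglyMeasurable.mul ?_
      exact (((hcont.comp (by fun_prop)).clm_apply continuous_const).neg).aestronglyMeasurable
    · refine ae_of_all _ fun z t _ => ?_
      rw [norm_mul, norm_neg]
      gcongr
      exact ((fderiv ℝ φ _).le_opNorm v).trans (by gcongr; exact hM _)
    · exact hfC.norm.mul_const _
    · exact ae_of_all _ fun z t _ => hline z t
  have hbound : ∀ s ∈ Set.Icc (0 : ℝ) 1,
      ‖∫ z in C, f z * -(fderiv ℝ φ (z - s • v) v)‖ ≤ ∫ z in K, ‖v‖ * ‖G z‖ := by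
    intro s hs
    set ψ : Euc (d + 1) → ℝ := fun z => φ (z - s • v) with hψdef
    have hψ : ContDiff ℝ ∞ ψ := hφ.comp (contDiff_id.sub contDiff_const)
    have hψf : ∀ z, fderiv ℝ ψ z = fderiv ℝ φ (z - s • v) := fun z => fderiv_comp_sub _
    -- Each translate stays supported in `K`, so it is an admissible test function and only the
    -- gradient on `K` is seen.
    have hψs : tsupport ψ ⊆ K := by
      have : tsupport ψ = (Homeomorph.subRight (s • v)) ⁻¹' tsupport φ := by
        rw [tsupport, tsupport, Homeomorph.preimage_closure]
        rfl
      rw [this]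
      intro z hz
      have := hv s hs _ hz
      simpa using this
    have hψc : HasCompactSupport ψ :=
      hC.of_isClosed_subset (isClosed_tsupport _) (hψs.trans hKC)
    have key := h.integral_mul_fderiv hψ hψc (hψs.trans (hKC.trans hCU)) v
    have e1 : ∫ z in C, f z * -(fderiv ℝ φ (z - s • v) v) =
        -∫ z in upperHalf d, f z * fderiv ℝ ψ z v := by
      rw [← integral_neg]
      simp only [← hψf, ← mul_neg]
      refine (setIntegral_eq_of_subset_of_forall_sdiff_eq_zero
        (isOpen_upperHalf d).measurableSet hCU fun z hz => ?_).symm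
      have : z ∉ tsupport (fderiv ℝ ψ) := fun hz' =>
        hz.2 (hKC (hψs (tsupport_fderiv_subset ℝ hz')))
      rw [image_eq_zero_of_notMem_tsupport this]
      simp
    have e2 : ∫ y in upperHalf d, inner ℝ v (G y) * ψ y = ∫ y in K, inner ℝ v (G y) * ψ y := by
      refine setIntegral_eq_of_subset_of_forall_sdiff_eq_zero
        (isOpen_upperHalf d).measurableSet (hKC.trans hCU) fun z hz => ?_
      rw [image_eq_zero_of_notMem_tsupport fun hz' => hz.2 (hψs hz'), mul_zero]
    rw [e1, key, neg_neg, e2]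
    refine norm_integral_le_of_norm_le hGK (ae_of_all _ fun z => ?_)
    rw [norm_mul]
    calc _ ≤ (‖v‖ * ‖G z‖) * 1 :=
          mul_le_mul (norm_inner_le_norm _ _) (hφ1 _) (abs_nonneg _) (by positivity)
      _ = _ := mul_one _
  have := norm_image_sub_le_of_norm_deriv_le_segment_01' (fun s _ => (hder s).hasDerivWithinAt)
    (fun s hs => hbound s (Set.Ico_subset_Icc_self hs))
  simpa [integral_const_mul] using this

/-- Test functions that increase to the indicator of a bounded open set. -/
theorem exists_test_tendsto_indicator {n : ℕ} {E : Set (Euc n)} (hE : IsOpen E)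
    (hb : Bornology.IsBounded E) : ∃ φ : ℕ → Euc n → ℝ, (∀ j, ContDiff ℝ ∞ (φ j)) ∧
      (∀ j, HasCompactSupport (φ j)) ∧ (∀ j, tsupport (φ j) ⊆ E) ∧ (∀ j y, |φ j y| ≤ 1) ∧
      ∀ y, Tendsto (fun j => φ j y) atTop (𝓝 (E.indicator 1 y)) := by
  obtain ⟨g, hgs, hg, hgr⟩ := hE.exists_contDiff_support_eq (n := ⊤)
  have hg0 : ∀ y, 0 ≤ g y := fun y => (hgr ⟨y, rfl⟩).1
  -- The shift by `1` confines the support to the closed set `j g ≥ 1`, which avoids the zeros of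
  -- `g` and hence lies in `E`.
  have hts : ∀ j : ℕ, tsupport (fun y => Real.smoothTransition (j * g y - 1)) ⊆ E := by
    intro j y hy
    have hcl : IsClosed {y | 1 ≤ (j : ℝ) * g y} :=
      isClosed_le continuous_const (continuous_const.mul hg.continuous)
    have hsub : Function.support (fun y => Real.smoothTransition (j * g y - 1)) ⊆
        {y | 1 ≤ (j : ℝ) * g y} := by
      intro z hz
      by_contra hcon
      simp only [Set.mem_ofPred_eq, not_le] at hcon
      exact hz (Real.smoothTransition.zero_of_nonpos (by linarith))
    have h1 : 1 ≤ (j : ℝ) * g y := closure_minimal hsub hcl hy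
    rw [← hgs, Function.mem_support]
    intro h0
    rw [h0] at h1
    norm_num at h1
  refine ⟨fun j y => Real.smoothTransition (j * g y - 1), fun j => ?_, fun j => ?_, hts,
    fun j y => ?_, fun y => ?_⟩
  · exact Real.smoothTransition.contDiff.comp ((contDiff_const.mul hg).sub contDiff_const)
  · exact Metric.isCompact_of_isClosed_isBounded (isClosed_tsupport _) (hb.subset (hts j))
  · rw [abs_of_nonneg (Real.smoothTransition.nonneg _)]
    exact Real.smoothTransition.le_one _
  · by_cases hy : y ∈ E
    · rw [Set.indicator_of_mem hy, Pi.one_apply]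
      have hpos : 0 < g y := lt_of_le_of_ne (hg0 y) (Ne.symm (by rwa [← hgs] at hy))
      refine tendsto_const_nhds.congr' ?_
      filter_upwards [eventually_ge_atTop ⌈2 / g y⌉₊] with j hj
      rw [Real.smoothTransition.one_of_one_le]
      have := Nat.ceil_le.1 hj
      rw [div_le_iff₀ hpos] at this
      linarith
    · rw [Set.indicator_of_notMem hy]
      have h0 : g y = 0 := by
        by_contra h
        exact hy (hgs ▸ h)
      simp [h0, Real.smoothTransition.zero_of_nonpos]

/-- Dominated convergence carries the estimate from test functions to the indicator of an open set,
with `|f|` on `C` as majorant. -/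
theorem IsWeakGradient.abs_integral_indicator_translate_sub_le {f : Euc (d + 1) → ℝ}
    {G : Euc (d + 1) → Euc (d + 1)} (h : IsWeakGradient d f G) {C K : Set (Euc (d + 1))}
    (hC : IsCompact C) (hCU : C ⊆ upperHalf d) (hKC : K ⊆ C)
    {E : Set (Euc (d + 1))} (hE : IsOpen E) (v : Euc (d + 1))
    (hv : ∀ s ∈ Set.Icc (0 : ℝ) 1, ∀ y ∈ E, y + s • v ∈ K) :
    |(∫ z in C, f z * E.indicator 1 (z - v)) - ∫ z in C, f z * E.indicator 1 z| ≤
      ‖v‖ * ∫ z in K, ‖G z‖ := by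
  have hfC : IntegrableOn f C volume := h.1.integrableOn_compact_subset hCU hC
  have hEK : E ⊆ K := fun y hy => by simpa using hv 0 (by simp) y hy
  obtain ⟨φ, h1, h2, h3, h4, h5⟩ :=
    exists_test_tendsto_indicator hE (hC.isBounded.subset (hEK.trans hKC))
  have hlim : ∀ w : Euc (d + 1), Tendsto (fun j => ∫ z in C, f z * φ j (z - w)) atTop
      (𝓝 (∫ z in C, f z * E.indicator 1 (z - w))) := by
    intro w
    refine tendsto_integral_of_dominated_convergence (fun z => ‖f z‖) (fun j => ?_) hfC.norm
      (fun j => ae_of_all _ fun z => ?_) (ae_of_all _ fun z => ?_)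
    · exact hfC.aestronglyMeasurable.mul
        (((h1 j).continuous.comp (by fun_prop)).aestronglyMeasurable)
    · rw [norm_mul]
      exact mul_le_of_le_one_right (norm_nonneg _) (h4 _ _)
    · exact (h5 _).const_mul _
  have h0 := hlim 0
  simp only [sub_zero] at h0
  refine le_of_tendsto ((hlim v).sub h0).abs (Eventually.of_forall fun j => ?_)
  exact h.abs_integral_translate_sub_le hC hCU hKC (h1 j) (h2 j) (h4 j) v
    fun s hs y hy => hv s hs y (h3 j hy)

/-- The left side is the double integral of `f y - f x` over `A × B`. After substituting `y = x +
v`, the inner integral for fixed `v` compares `f` on `E = A ∩ (B - v)` with `f` on `E + v`. By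
convexity the segments between them stay in `K`, which gives the bound `‖v‖ ∫_K ‖G‖`; only `‖v‖ ≤ D`
contributes. -/
theorem IsWeakGradient.abs_integral_sub_le {f : Euc (d + 1) → ℝ}
    {G : Euc (d + 1) → Euc (d + 1)} (h : IsWeakGradient d f G) {C K A B : Set (Euc (d + 1))}
    (hC : IsCompact C) (hCU : C ⊆ upperHalf d) (hKC : K ⊆ C) (hK : Convex ℝ K)
    (hA : IsOpen A) (hB : IsOpen B) (hAK : A ⊆ K) (hBK : B ⊆ K) {D : ℝ}
    (hD : ∀ x ∈ A, ∀ y ∈ B, ‖y - x‖ ≤ D) :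
    |volume.real A * (∫ y in B, f y) - (∫ x in A, f x) * volume.real B| ≤
      volume.real (Metric.closedBall (0 : Euc (d + 1)) D) * (D * ∫ z in K, ‖G z‖) := by
  have hfC : IntegrableOn f C volume := h.1.integrableOn_compact_subset hCU hC
  have hAm := hA.measurableSet
  have hBm := hB.measurableSet
  have hfin : ∀ S ⊆ K, volume S ≠ ⊤ := fun S hS =>
    ((measure_mono (hS.trans hKC)).trans_lt hC.measure_lt_top).ne
  -- Extending by zero makes the function integrable on the whole space, so Fubini and translations
  -- apply freely; on `K` nothing changes.
  set F : Euc (d + 1) → ℝ := C.indicator f with hFdef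
  have hF : Integrable F volume := hfC.integrable_indicator hC.measurableSet
  have hFa : ∀ S ⊆ K, MeasurableSet S → ∫ x, F x * S.indicator 1 x = ∫ x in S, f x := by
    intro S hS hSm
    rw [← integral_indicator hSm]
    refine integral_congr_ae (ae_of_all _ fun x => ?_)
    by_cases hx : x ∈ S
    · simp [hx, hFdef, hKC (hS hx)]
    · simp [hx]
  have h1 : ∀ S ⊆ K, MeasurableSet S → Integrable (S.indicator (1 : Euc (d + 1) → ℝ)) volume :=
    fun S hS hSm => (integrable_indicator_iff hSm).2 (integrableOn_const (hfin S hS))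
  have hFi : ∀ S : Set (Euc (d + 1)), MeasurableSet S → ∀ F' : Euc (d + 1) → ℝ,
      Integrable F' volume → Integrable (fun x => F' x * S.indicator 1 x) volume := by
    intro S hSm F' hF'
    refine hF'.mul_bdd (c := 1) ((measurable_one.indicator hSm).aestronglyMeasurable)
      (ae_of_all _ fun x => ?_)
    by_cases hx : x ∈ S <;> simp [hx]
  set H : Euc (d + 1) × Euc (d + 1) → ℝ := fun p =>
    A.indicator 1 p.1 * (F p.2 * B.indicator 1 p.2) -
      (F p.1 * A.indicator 1 p.1) * B.indicator 1 p.2 with hHdef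
  have hH1 : Integrable (fun p : Euc (d + 1) × Euc (d + 1) =>
      A.indicator 1 p.1 * (F p.2 * B.indicator 1 p.2)) (volume.prod volume) :=
    (h1 A hAK hAm).mul_prod (hFi B hBm F hF)
  have hH2 : Integrable (fun p : Euc (d + 1) × Euc (d + 1) =>
      (F p.1 * A.indicator 1 p.1) * B.indicator (1 : Euc (d + 1) → ℝ) p.2) (volume.prod volume) :=
    (hFi A hAm F hF).mul_prod (h1 B hBK hBm)
  have hH : Integrable H (volume.prod volume) := hH1.sub hH2
  have hHint : ∫ p, H p ∂(volume.prod volume) =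
      volume.real A * (∫ y in B, f y) - (∫ x in A, f x) * volume.real B := by
    have p1 := integral_prod_mul (μ := (volume : Measure (Euc (d + 1))))
      (ν := (volume : Measure (Euc (d + 1)))) (A.indicator (1 : Euc (d + 1) → ℝ))
      (fun y => F y * B.indicator 1 y)
    have p2 := integral_prod_mul (μ := (volume : Measure (Euc (d + 1))))
      (ν := (volume : Measure (Euc (d + 1)))) (fun x => F x * A.indicator 1 x)
      (B.indicator (1 : Euc (d + 1) → ℝ))
    rw [hHdef, integral_sub hH1 hH2, p1, p2, hFa A hAK hAm,
      hFa B hBK hBm, integral_indicator_one hAm, integral_indicator_one hBm]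
  have hT := measurePreserving_prod_add (volume : Measure (Euc (d + 1)))
    (volume : Measure (Euc (d + 1)))
  have hTe : MeasurableEmbedding fun z : Euc (d + 1) × Euc (d + 1) => (z.1, z.1 + z.2) :=
    (MeasurableEquiv.shearAddRight (Euc (d + 1))).measurableEmbedding
  have hHT : Integrable (fun z : Euc (d + 1) × Euc (d + 1) => H (z.1, z.1 + z.2))
      (volume.prod volume) := (hT.integrable_comp_emb hTe).2 hH
  rw [← hHint, ← hT.integral_comp hTe, integral_prod_symm _ hHT]
  have hball : volume (Metric.closedBall (0 : Euc (d + 1)) D) ≠ ⊤ :=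
    (isCompact_closedBall _ _).measure_lt_top.ne
  have hν : 0 ≤ ∫ z in K, ‖G z‖ := integral_nonneg fun _ => norm_nonneg _
  rw [show volume.real (Metric.closedBall (0 : Euc (d + 1)) D) * (D * ∫ z in K, ‖G z‖) =
    ∫ v, (Metric.closedBall (0 : Euc (d + 1)) D).indicator (fun _ => D * ∫ z in K, ‖G z‖) v by
      rw [integral_indicator_const _ Metric.isClosed_closedBall.measurableSet, smul_eq_mul]]
  have hind : Integrable (fun v => (Metric.closedBall (0 : Euc (d + 1)) D).indicator
      (fun _ => D * ∫ z in K, ‖G z‖) v) volume :=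
    (integrable_indicator_iff Metric.isClosed_closedBall.measurableSet).2 (integrableOn_const hball)
  rw [← Real.norm_eq_abs]
  refine norm_integral_le_of_norm_le hind (ae_of_all _ fun v => ?_)
  set E : Set (Euc (d + 1)) := A ∩ (fun x => x + v) ⁻¹' B with hEdef
  have hE : IsOpen E := hA.inter (hB.preimage (by fun_prop))
  have hEm := hE.measurableSet
  have hEK : E ⊆ K := fun x hx => hAK hx.1
  have hseg : ∀ s ∈ Set.Icc (0 : ℝ) 1, ∀ y ∈ E, y + s • v ∈ K := by
    intro s hs y hy
    have := hK.add_smul_sub_mem (hAK hy.1) (hBK hy.2) hs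
    simpa using this
  have hIv : ∫ x, H (x, x + v) =
      (∫ z in C, f z * E.indicator 1 (z - v)) - ∫ z in C, f z * E.indicator 1 z := by
    have e1 : ∫ z in C, f z * E.indicator 1 (z - v) = ∫ x, F (x + v) * E.indicator 1 x := by
      rw [← integral_indicator hC.measurableSet,
        ← integral_add_right_eq_self (fun z => C.indicator (fun z => f z * E.indicator 1 (z - v)) z) v]
      refine integral_congr_ae (ae_of_all _ fun x => ?_)
      by_cases hx : x + v ∈ C <;> simp [hx, hFdef]
    have e2 : ∫ z in C, f z * E.indicator 1 z = ∫ x, F x * E.indicator 1 x := by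
      rw [← integral_indicator hC.measurableSet]
      refine integral_congr_ae (ae_of_all _ fun x => ?_)
      by_cases hx : x ∈ C <;> simp [hx, hFdef]
    rw [e1, e2, ← integral_sub (hFi E hEm _ (hF.comp_add_right v)) (hFi E hEm F hF)]
    refine integral_congr_ae (ae_of_all _ fun x => ?_)
    by_cases hx : x ∈ A <;> by_cases hx' : x + v ∈ B <;>
      simp [hHdef, hEdef, Set.indicator, hx, hx']
  simp only [hIv]
  -- The sign of `D` is not assumed: for empty `E`, membership of `v` in the ball forces `D ≥ 0`.
  rcases Set.eq_empty_or_nonempty E with hE0 | ⟨x, hx⟩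
  · rw [hE0]
    simp only [Set.indicator_empty, mul_zero, integral_zero, sub_zero, norm_zero]
    refine Set.indicator_apply_nonneg fun hv => ?_
    have : 0 ≤ D := (norm_nonneg v).trans (by simpa using hv)
    positivity
  · have hvD : ‖v‖ ≤ D := by simpa using hD x hx.1 (x + v) hx.2
    rw [Set.indicator_of_mem (by simpa using hvD)]
    refine (h.abs_integral_indicator_translate_sub_le hC hCU hKC hE v hseg).trans ?_
    gcongr

/-- The Poincaré inequality: averages of `f` over two open sets in a convex set differ by at most
a multiple of the integral of the weak gradient over that set. -/
theorem IsWeakGradient.enorm_average_sub_le {f : Euc (d + 1) → ℝ}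
    {G : Euc (d + 1) → Euc (d + 1)} (h : IsWeakGradient d f G) {C K A B : Set (Euc (d + 1))}
    (hC : IsCompact C) (hCU : C ⊆ upperHalf d) (hKC : K ⊆ C) (hK : Convex ℝ K)
    (hA : IsOpen A) (hB : IsOpen B) (hAK : A ⊆ K) (hBK : B ⊆ K) {D : ℝ} (hD0 : 0 ≤ D)
    (hD : ∀ x ∈ A, ∀ y ∈ B, ‖y - x‖ ≤ D) (hA0 : A.Nonempty) (hB0 : B.Nonempty) :
    volume A * volume B * ‖(⨍ x in A, f x) - ⨍ x in B, f x‖ₑ ≤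
      volume (Metric.closedBall (0 : Euc (d + 1)) D) * (ENNReal.ofReal D * ∫⁻ z in K, ‖G z‖ₑ) := by
  have hfin : ∀ S ⊆ K, volume S ≠ ⊤ := fun S hS =>
    ((measure_mono (hS.trans hKC)).trans_lt hC.measure_lt_top).ne
  have hAf := hfin A hAK
  have hBf := hfin B hBK
  have hApos : 0 < volume.real A := ENNReal.toReal_pos (hA.measure_pos _ hA0).ne' hAf
  have hBpos : 0 < volume.real B := ENNReal.toReal_pos (hB.measure_pos _ hB0).ne' hBf
  have hball : volume (Metric.closedBall (0 : Euc (d + 1)) D) ≠ ⊤ :=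
    (isCompact_closedBall _ _).measure_lt_top.ne
  have hGK : IntegrableOn G K volume := (h.2.1.integrableOn_compact_subset hCU hC).mono_set hKC
  have key := h.abs_integral_sub_le hC hCU hKC hK hA hB hAK hBK hD
  have e : volume.real A * volume.real B * |(⨍ x in A, f x) - ⨍ x in B, f x| =
      |volume.real A * (∫ y in B, f y) - (∫ x in A, f x) * volume.real B| := by
    have e1 : ∀ X : ℝ, volume.real A * volume.real B * |X| = |volume.real A * volume.real B * X| :=
      fun X => by rw [abs_mul, abs_of_pos (mul_pos hApos hBpos)]
    rw [abs_sub_comm, e1, setAverage_eq, setAverage_eq, smul_eq_mul, smul_eq_mul]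
    congr 1
    field_simp
  rw [← e] at key
  have := ENNReal.ofReal_le_ofReal key
  rw [ENNReal.ofReal_mul (by positivity), ENNReal.ofReal_mul (by positivity),
    ENNReal.ofReal_mul (by positivity), ENNReal.ofReal_mul hD0,
    ofReal_integral_norm_eq_lintegral_enorm hGK] at this
  simpa only [ofReal_measureReal hAf, ofReal_measureReal hBf, ofReal_measureReal hball,
    ← Real.enorm_eq_ofReal_abs] using this

/-! ### Whitney boxes and their hulls -/

/-- The projection of `ℝ^{d+1}` onto the first `d` coordinates. -/
def baseProj (d : ℕ) : Euc (d + 1) →L[ℝ] Euc d :=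
  LinearMap.mkContinuous
    { toFun := fun y => WithLp.toLp 2 fun i : Fin d => y i.castSucc
      map_add' := fun _ _ => rfl
      map_smul' := fun _ _ => rfl } 1 fun y => by
    rw [one_mul, EuclideanSpace.norm_eq, EuclideanSpace.norm_eq, Fin.sum_univ_castSucc]
    exact Real.sqrt_le_sqrt (le_add_of_nonneg_right (by positivity))

theorem baseProj_apply (y : Euc (d + 1)) (i : Fin d) : baseProj d y i = y i.castSucc := rfl

theorem norm_baseProj_le (d : ℕ) : ‖baseProj d‖ ≤ 1 := LinearMap.mkContinuous_norm_le _ zero_le_one _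

theorem abs_apply_le_norm {n : ℕ} (y : Euc n) (i : Fin n) : |y i| ≤ ‖y‖ :=
  PiLp.norm_apply_le y i

theorem norm_le_of_abs_apply_le {n : ℕ} (y : Euc n) {c : ℝ} (hc : 0 ≤ c) (h : ∀ i, |y i| ≤ c) :
    ‖y‖ ≤ n * c := by
  have h1 : ‖y‖ ^ 2 ≤ n * c ^ 2 := by
    rw [EuclideanSpace.norm_sq_eq]
    refine (Finset.sum_le_card_nsmul _ _ (c ^ 2) fun i _ => ?_).trans (by simp)
    exact pow_le_pow_left₀ (norm_nonneg _) (h i) 2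
  have h2 : ‖y‖ ^ 2 ≤ (n * c) ^ 2 := by
    rcases Nat.eq_zero_or_pos n with rfl | hn
    · simpa using h1
    · have : (1 : ℝ) ≤ n := by exact_mod_cast hn
      nlinarith [sq_nonneg c, mul_nonneg (sub_nonneg.2 this) (sq_nonneg c)]
  exact le_of_sq_le_sq h2 (by positivity)

/-- The horizontal strip `2^{-k}/4 < t < 4·2^{-k}`. -/
def strip (d : ℕ) (k : ℤ) : Set (Euc (d + 1)) :=
  {y | y (Fin.last d) ∈ Set.Ioo ((2 : ℝ) ^ (-k) / 4) (4 * 2 ^ (-k))}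

/-- A convex open box that contains the enlarged Whitney boxes of `P`, of its neighbors and of its
children. -/
def hull (P : DyadicCube d) : Set (Euc (d + 1)) :=
  {y | (∀ i : Fin d, y i.castSucc ∈
      Set.Ioo (P.edge * P.pos i - 3 * P.edge) (P.edge * P.pos i + 3 * P.edge)) ∧
    y (Fin.last d) ∈ Set.Ioo (P.edge / 4) (4 * P.edge)}

/-- The closed box with the same faces as `hull P`. -/
def closedHull (P : DyadicCube d) : Set (Euc (d + 1)) :=
  {y | (∀ i : Fin d, y i.castSucc ∈
      Set.Icc (P.edge * P.pos i - 3 * P.edge) (P.edge * P.pos i + 3 * P.edge)) ∧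
    y (Fin.last d) ∈ Set.Icc (P.edge / 4) (4 * P.edge)}

theorem hull_subset_closedHull (P : DyadicCube d) : hull P ⊆ closedHull P :=
  fun _ hy => ⟨fun i => Set.Ioo_subset_Icc_self (hy.1 i), Set.Ioo_subset_Icc_self hy.2⟩

theorem closedHull_subset (P : DyadicCube d) : closedHull P ⊆ upperHalf d := fun y hy =>
  lt_of_lt_of_le (by have := edge_pos P; positivity) hy.2.1

theorem isCompact_closedHull (P : DyadicCube d) : IsCompact (closedHull P) := by
  have : closedHull P = eucHomeo (d + 1) ⁻¹' Set.pi Set.univ (Fin.snoc (α := fun _ => Set ℝ)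
      (fun i : Fin d => Set.Icc (P.edge * P.pos i - 3 * P.edge) (P.edge * P.pos i + 3 * P.edge))
      (Set.Icc (P.edge / 4) (4 * P.edge))) := by
    ext y
    simp only [closedHull, Set.mem_ofPred_eq, Set.mem_preimage, Set.mem_pi, Set.mem_univ,
      true_implies, Fin.forall_fin_succ', Fin.snoc_castSucc, Fin.snoc_last]
    rfl
  rw [this]
  refine (eucHomeo (d + 1)).isCompact_preimage.2 (isCompact_univ_pi fun i => ?_)
  refine Fin.lastCases ?_ (fun i => ?_) i
  · rw [Fin.snoc_last]; exact isCompact_Icc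
  · rw [Fin.snoc_castSucc]; exact isCompact_Icc

theorem convex_hull_of_cube (P : DyadicCube d) : Convex ℝ (hull P) := by
  intro y hy z hz a b ha hb hab
  refine ⟨fun i => ?_, ?_⟩
  · simpa using convex_Ioo (𝕜 := ℝ) _ _ (hy.1 i) (hz.1 i) ha hb hab
  · simpa using convex_Ioo (𝕜 := ℝ) _ _ hy.2 hz.2 ha hb hab

theorem hull_subset_strip (P : DyadicCube d) : hull P ⊆ strip d P.level := fun _ hy => hy.2

theorem measurableSet_strip (k : ℤ) : MeasurableSet (strip d k) :=
  measurableSet_Ioo.preimage (by fun_prop : Measurable fun y : Euc (d + 1) => y (Fin.last d))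

/-! ### Bounded overlap of the hulls -/

/-- Cut the strip into columns over the cubes of level `k`. A hull reaches three edges to either
side of its corner, so it only meets columns whose offsets lie between `-3` and `3` in each
coordinate. -/
theorem tsum_lintegral_hull_le (k : ℤ) (h : Euc (d + 1) → ENNReal) :
    ∑' P : layer d k, ∫⁻ y in hull P.1, h y ≤ (7 ^ d : ℕ) * ∫⁻ y in strip d k, h y := by
  classical
  set U : Finset (Fin d → ℤ) := Fintype.piFinset fun _ => Finset.Icc (-3) 3 with hU
  have hcard : U.card = 7 ^ d := by simp [hU]
  set slab : (Fin d → ℤ) → Set (Euc (d + 1)) := fun m =>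
    strip d k ∩ (fun y => posAt k (baseProj d y)) ⁻¹' {m} with hslab
  have hm : ∀ m, MeasurableSet (slab m) := fun m => (measurableSet_strip k).inter
    (((measurable_posAt k).comp (baseProj d).continuous.measurable) (measurableSet_singleton m))
  have hdisj : Pairwise (Function.onFun Disjoint slab) := by
    intro m m' hne
    refine Set.disjoint_left.2 fun y hy hy' => hne ?_
    exact hy.2.symm.trans hy'.2
  have hUn : (⋃ m, slab m) = strip d k := by
    ext y
    simp [hslab]
  have hcover : ∀ m : Fin d → ℤ, hull (⟨k, m⟩ : DyadicCube d) ⊆ ⋃ u ∈ U, slab (m + u) := by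
    intro m y hy
    refine Set.mem_iUnion₂.2 ⟨posAt k (baseProj d y) - m, ?_, hull_subset_strip _ hy, by simp⟩
    rw [hU, Fintype.mem_piFinset]
    intro i
    have h1 := hy.1 i
    have hk := two_zpow_pos k
    simp only [edge, Set.mem_Ioo] at h1
    have e : (2 : ℝ) ^ (-k) * 2 ^ k = 1 := by rw [← zpow_add₀ two_ne_zero]; simp
    have h2 : (m i : ℝ) - 3 < 2 ^ k * y i.castSucc := by
      have := mul_lt_mul_of_pos_right h1.1 hk
      rw [show ((2 : ℝ) ^ (-k) * m i - 3 * 2 ^ (-k)) * 2 ^ k =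
        (m i - 3) * (2 ^ (-k) * 2 ^ k) by ring, e] at this
      linarith
    have h3 : 2 ^ k * y i.castSucc < (m i : ℝ) + 3 := by
      have := mul_lt_mul_of_pos_right h1.2 hk
      rw [show ((2 : ℝ) ^ (-k) * m i + 3 * 2 ^ (-k)) * 2 ^ k =
        (m i + 3) * (2 ^ (-k) * 2 ^ k) by ring, e] at this
      linarith
    have h4 : ⌈(2 : ℝ) ^ k * y i.castSucc⌉ ≤ m i + 3 := Int.ceil_le.2 (by push_cast; exact h3.le)
    have h5 : m i - 3 < ⌈(2 : ℝ) ^ k * y i.castSucc⌉ := Int.lt_ceil.2 (by push_cast; exact h2)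
    rw [Finset.mem_Icc, Pi.sub_apply, posAt, baseProj_apply]
    omega
  calc ∑' P : layer d k, ∫⁻ y in hull P.1, h y
      = ∑' m : Fin d → ℤ, ∫⁻ y in hull (⟨k, m⟩ : DyadicCube d), h y :=
        ((layerEquiv d k).tsum_eq fun P : layer d k => ∫⁻ y in hull P.1, h y).symm
    _ ≤ ∑' m : Fin d → ℤ, ∑ u ∈ U, ∫⁻ y in slab (m + u), h y := by
        refine ENNReal.tsum_le_tsum fun m => (lintegral_mono_set (hcover m)).trans ?_
        exact (lintegral_biUnion_finset (s := U) (t := fun u => slab (m + u))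
          (fun u _ u' _ hne => hdisj (by simpa using hne)) (fun u _ => hm _) h).le
    _ = ∑ u ∈ U, ∑' m : Fin d → ℤ, ∫⁻ y in slab (m + u), h y :=
        Summable.tsum_finsetSum fun _ _ => ENNReal.summable
    _ = ∑ u ∈ U, ∫⁻ y in strip d k, h y := by
        refine Finset.sum_congr rfl fun u _ => ?_
        rw [← hUn, lintegral_iUnion hm hdisj]
        exact (Equiv.addRight u).tsum_eq fun m => ∫⁻ y in slab m, h y
    _ = _ := by rw [Finset.sum_const, hcard, nsmul_eq_mul]

/-! ### Enlarged boxes -/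

theorem whitney_subset_upperHalf (Q : DyadicCube d) : Q.whitney ⊆ upperHalf d := fun _ hy =>
  (two_zpow_pos _).trans hy.2.1

theorem whitney_subset_enlarged (Q : DyadicCube d) : Q.whitney ⊆ Q.enlarged := fun y hy =>
  ⟨whitney_subset_upperHalf Q hy, by
    rw [Metric.infDist_zero_of_mem hy]; have := edge_pos Q; positivity⟩

theorem volume_whitney (Q : DyadicCube d) : volume Q.whitney = ENNReal.ofReal Q.edge ^ (d + 1) := by
  have h := volume_preimage_pi (d + 1) (Fin.snoc (α := fun _ => Set ℝ)
      (fun i : Fin d => Set.Ioc (Q.edge * Q.pos i) (Q.edge * (Q.pos i + 1)))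
      (Set.Ioc ((2 : ℝ) ^ (-Q.level)) ((2 : ℝ) ^ (-Q.level + 1)))) (fun i => by
    refine Fin.lastCases ?_ (fun i => ?_) i
    · rw [Fin.snoc_last]; exact measurableSet_Ioc
    · rw [Fin.snoc_castSucc]; exact measurableSet_Ioc)
  simp only [Fin.forall_fin_succ', Fin.snoc_castSucc, Fin.snoc_last, Fin.prod_univ_castSucc,
    Real.volume_Ioc] at h
  rw [whitney, toSet]
  simp only [Set.mem_ofPred_eq]
  rw [h, pow_succ]
  congr 1
  · simp [mul_add]
  · rw [edge, zpow_add₀ two_ne_zero, zpow_one]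
    congr 1
    ring

theorem nonempty_whitney (Q : DyadicCube d) : Q.whitney.Nonempty := by
  refine nonempty_of_measure_ne_zero (μ := volume) ?_
  rw [volume_whitney]
  exact pow_ne_zero _ (by simpa using edge_pos Q)

theorem isOpen_enlarged (Q : DyadicCube d) : IsOpen Q.enlarged :=
  (isOpen_upperHalf d).inter (isOpen_lt (Metric.continuous_infDist_pt _) continuous_const)

theorem nonempty_enlarged (Q : DyadicCube d) : Q.enlarged.Nonempty :=
  (nonempty_whitney Q).mono (whitney_subset_enlarged Q)

theorem le_volume_enlarged (Q : DyadicCube d) :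
    ENNReal.ofReal Q.edge ^ (d + 1) ≤ volume Q.enlarged :=
  (volume_whitney Q).symm.trans_le (measure_mono (whitney_subset_enlarged Q))

/-- A point closer than `ℓ/4` to the Whitney box differs from one of its points by less than `ℓ/4`
in every coordinate. -/
theorem enlarged_bounds {Q : DyadicCube d} {y : Euc (d + 1)} (hy : y ∈ Q.enlarged) :
    (∀ i : Fin d, y i.castSucc ∈ Set.Ioo (Q.edge * Q.pos i - Q.edge / 4)
      (Q.edge * (Q.pos i + 1) + Q.edge / 4)) ∧
    y (Fin.last d) ∈ Set.Ioo (3 / 4 * Q.edge) (9 / 4 * Q.edge) := by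
  obtain ⟨w, hw, hyw⟩ := (Metric.infDist_lt_iff (nonempty_whitney Q)).1 hy.2
  rw [dist_eq_norm] at hyw
  have hi : ∀ i, |y i - w i| < Q.edge / 4 := fun i =>
    (abs_apply_le_norm (y - w) i).trans_lt hyw
  refine ⟨fun i => ?_, ?_⟩
  · have h1 := hw.1 i
    have h2 := abs_lt.1 (hi i.castSucc)
    simp only [Set.mem_Ioc] at h1
    constructor <;> linarith
  · have h1 := hw.2
    have h2 := abs_lt.1 (hi (Fin.last d))
    rw [zpow_add₀ two_ne_zero, zpow_one, Set.mem_Ioc] at h1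
    rw [edge] at h2 ⊢
    constructor <;> linarith

theorem enlarged_subset_hull_of_neighbor (k : ℤ) (m m' : Fin d → ℤ) (h : m' - m ∈ offsets d) :
    (⟨k, m'⟩ : DyadicCube d).enlarged ⊆ hull ⟨k, m⟩ := by
  intro y hy
  obtain ⟨h1, h2⟩ := enlarged_bounds hy
  have hk := two_zpow_pos (-k)
  rw [mem_offsets] at h
  simp only [hull, edge, Set.mem_ofPred_eq, Set.mem_Ioo] at h1 h2 ⊢
  refine ⟨fun i => ?_, by linarith, by linarith⟩
  have h3 := abs_le.1 (h i)
  rw [Pi.sub_apply] at h3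
  have h4 : (m i : ℝ) - 1 ≤ m' i := by have := h3.1; norm_cast; omega
  have h5 : (m' i : ℝ) ≤ m i + 1 := by have := h3.2; norm_cast; omega
  have h6 := mul_le_mul_of_nonneg_left h4 hk.le
  have h7 := mul_le_mul_of_nonneg_left h5 hk.le
  have h8 := h1 i
  constructor <;> nlinarith

theorem enlarged_subset_hull_of_child (k : ℤ) (x : Euc d) :
    (cubeAt (k + 1) x).enlarged ⊆ hull (cubeAt k x) := by
  intro y hy
  obtain ⟨h1, h2⟩ := enlarged_bounds hy
  have hk := two_zpow_pos (-k)
  have e : (2 : ℝ) ^ (-(k + 1)) = 2 ^ (-k) / 2 := by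
    rw [neg_add, zpow_add₀ two_ne_zero, zpow_neg_one]; ring
  have hx1 := mem_cubeAt k x
  have hx2 := mem_cubeAt (k + 1) x
  simp only [hull, toSet, cubeAt, edge, Set.mem_ofPred_eq, Set.mem_Ioo, Set.mem_Ioc, e]
    at h1 h2 hx1 hx2 ⊢
  refine ⟨fun i => ?_, by linarith, by linarith⟩
  have h3 := h1 i
  have h4 := hx1 i
  have h5 := hx2 i
  constructor <;> nlinarith

/-! ### Averages over enlarged boxes -/

theorem norm_sub_le_of_mem_hull {P : DyadicCube d} {x y : Euc (d + 1)} (hx : x ∈ hull P)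
    (hy : y ∈ hull P) : ‖y - x‖ ≤ (d + 1 : ℕ) * (6 * P.edge) := by
  have hP := edge_pos P
  refine norm_le_of_abs_apply_le _ (by positivity) fun i => ?_
  rw [PiLp.sub_apply, abs_le]
  refine Fin.lastCases ?_ (fun i => ?_) i
  · have h1 := hx.2
    have h2 := hy.2
    constructor <;> linarith [h1.1, h1.2, h2.1, h2.2]
  · have h1 := hx.1 i
    have h2 := hy.1 i
    constructor <;> linarith [h1.1, h1.2, h2.1, h2.2]

/-- The average of `f` over the enlarged Whitney box of a cube. -/
def boxAvg (f : Euc (d + 1) → ℝ) (Q : DyadicCube d) : ℝ := ⨍ y in Q.enlarged, f y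

/-- This is the scale-invariant form of the Poincaré inequality: two box volumes of order `ℓ^{d+1}`
stand against a ball volume times a diameter, of order `ℓ^{d+2}`. The surplus `ℓ^d` is the volume of
the base cube. -/
theorem exists_boxAvg_sub_le (d : ℕ) : ∃ c : ENNReal, c ≠ ⊤ ∧ ∀ (f : Euc (d + 1) → ℝ)
    (G : Euc (d + 1) → Euc (d + 1)), IsWeakGradient d f G → ∀ P Q Q' : DyadicCube d,
    Q.enlarged ⊆ hull P → Q'.enlarged ⊆ hull P → P.edge / 2 ≤ Q.edge → P.edge / 2 ≤ Q'.edge →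
      volume P.toSet * ‖boxAvg f Q - boxAvg f Q'‖ₑ ≤ c * ∫⁻ y in hull P, ‖G y‖ₑ := by
  set b : ENNReal := volume (Metric.ball (0 : Euc (d + 1)) 1) with hb
  set N : ℝ := ((d + 1 : ℕ) : ℝ) * 6 with hN
  have hN0 : 0 ≤ N := by positivity
  refine ⟨ENNReal.ofReal (4 ^ (d + 1) * N ^ (d + 2)) * b,
    ENNReal.mul_ne_top ENNReal.ofReal_ne_top measure_ball_lt_top.ne, ?_⟩
  intro f G h P Q Q' hQ hQ' hs hs'
  have hP := edge_pos P
  have key := h.enorm_average_sub_le (isCompact_closedHull P) (closedHull_subset P)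
    (hull_subset_closedHull P) (convex_hull_of_cube P) (isOpen_enlarged Q) (isOpen_enlarged Q') hQ hQ'
    (D := N * P.edge) (by positivity)
    (fun x hx y hy => (norm_sub_le_of_mem_hull (hQ hx) (hQ' hy)).trans (by rw [hN]; linarith))
    (nonempty_enlarged Q) (nonempty_enlarged Q')
  rw [Measure.addHaar_closedBall _ _ (by positivity), finrank_euclideanSpace_fin, ← hb] at key
  set ν := ∫⁻ y in hull P, ‖G y‖ₑ
  set a := ‖boxAvg f Q - boxAvg f Q'‖ₑ with ha
  have hvol : ∀ R : DyadicCube d, P.edge / 2 ≤ R.edge →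
      ENNReal.ofReal ((P.edge / 2) ^ (d + 1)) ≤ volume R.enlarged := by
    intro R hR
    refine le_trans ?_ (le_volume_enlarged R)
    rw [ENNReal.ofReal_pow (by positivity)]
    gcongr
  have h2 : ENNReal.ofReal ((P.edge / 2) ^ (d + 1)) * ENNReal.ofReal ((P.edge / 2) ^ (d + 1)) * a ≤
      ENNReal.ofReal ((N * P.edge) ^ (d + 1)) * b * (ENNReal.ofReal (N * P.edge) * ν) := by
    refine le_trans ?_ key
    gcongr
    · exact hvol Q hs
    · exact hvol Q' hs'
    · exact le_rfl
  -- The factor turns `(ℓ/2)^{2(d+1)}` on the left into `ℓ^d` and clears `ℓ` on the right.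
  have h3 := mul_le_mul_right h2 (ENNReal.ofReal (4 ^ (d + 1) * (P.edge ^ (d + 2))⁻¹))
  have e1 : ENNReal.ofReal (4 ^ (d + 1) * (P.edge ^ (d + 2))⁻¹) *
      (ENNReal.ofReal ((P.edge / 2) ^ (d + 1)) * ENNReal.ofReal ((P.edge / 2) ^ (d + 1)) * a) =
      volume P.toSet * a := by
    rw [volume_toSet, ← mul_assoc, ← ENNReal.ofReal_mul (by positivity),
      ← ENNReal.ofReal_mul (by positivity), ← ENNReal.ofReal_pow hP.le]
    congr 2
    rw [div_pow, show (4 : ℝ) = 2 * 2 by norm_num, mul_pow]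
    field_simp
    ring
  have e2 : ENNReal.ofReal (4 ^ (d + 1) * (P.edge ^ (d + 2))⁻¹) *
      (ENNReal.ofReal ((N * P.edge) ^ (d + 1)) * b * (ENNReal.ofReal (N * P.edge) * ν)) =
      ENNReal.ofReal (4 ^ (d + 1) * N ^ (d + 2)) * b * ν := by
    have : (4 : ℝ) ^ (d + 1) * N ^ (d + 2) =
        4 ^ (d + 1) * (P.edge ^ (d + 2))⁻¹ * (N * P.edge) ^ (d + 1) * (N * P.edge) := by
      clear_value N
      rw [mul_pow]
      field_simp
      ring
    have h4 : ENNReal.ofReal (4 ^ (d + 1) * N ^ (d + 2)) =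
        ENNReal.ofReal (4 ^ (d + 1) * (P.edge ^ (d + 2))⁻¹) *
          ENNReal.ofReal ((N * P.edge) ^ (d + 1)) * ENNReal.ofReal (N * P.edge) := by
      rw [this, ENNReal.ofReal_mul (by positivity), ENNReal.ofReal_mul (by positivity)]
    rw [h4]
    ring
  rwa [e1, e2] at h3

theorem lintegral_le_of_volume_mul_le {k : ℤ} {F : DyadicCube d → ENNReal} {c : ENNReal}
    {h : Euc (d + 1) → ENNReal}
    (hF : ∀ P : layer d k, volume P.1.toSet * F P.1 ≤ c * ∫⁻ y in hull P.1, h y) :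
    ∫⁻ x : Euc d, F (cubeAt k x) ≤ c * (7 ^ d : ℕ) * ∫⁻ y in strip d k, h y := by
  rw [lintegral_comp_cubeAt, mul_assoc]
  refine (ENNReal.tsum_le_tsum hF).trans ?_
  rw [ENNReal.tsum_mul_left]
  gcongr
  exact tsum_lintegral_hull_le k h

theorem edge_cubeAt (k : ℤ) (x : Euc d) : (cubeAt k x).edge = 2 ^ (-k) := rfl

/-- The `L^1` estimates for the approximations of the trace. -/
theorem exists_lintegral_boxAvg_le (d : ℕ) : ∃ c : ENNReal, c ≠ ⊤ ∧ ∀ (f : Euc (d + 1) → ℝ)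
    (G : Euc (d + 1) → Euc (d + 1)), IsWeakGradient d f G → ∀ k : ℤ,
    (∫⁻ x : Euc d, ‖boxAvg f (cubeAt k x) - boxAvg f (cubeAt (k + 1) x)‖ₑ ≤
      c * ∫⁻ y in strip d k, ‖G y‖ₑ) ∧
    ∀ e ∈ offsets d,
      ∫⁻ x : Euc d, ‖boxAvg f (cubeAt k x) - boxAvg f (cubeAt k (x + latticeVec k e))‖ₑ ≤
        c * ∫⁻ y in strip d k, ‖G y‖ₑ := by
  obtain ⟨c, hc, H⟩ := exists_boxAvg_sub_le d
  refine ⟨c * (7 ^ d : ℕ), ENNReal.mul_ne_top hc (ENNReal.natCast_ne_top _), ?_⟩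
  intro f G h k
  have hself : ∀ x : Euc d, (cubeAt k x).enlarged ⊆ hull (cubeAt k x) := fun x =>
    enlarged_subset_hull_of_neighbor k _ _ (by simp [mem_offsets])
  have hV0 : ∀ P : DyadicCube d, volume P.toSet ≠ 0 := volume_toSet_ne_zero
  have hVt : ∀ P : DyadicCube d, volume P.toSet ≠ ⊤ := volume_toSet_ne_top
  have hpt : ∀ (x : Euc d) (Q : DyadicCube d), Q.enlarged ⊆ hull (cubeAt k x) →
      (cubeAt k x).edge / 2 ≤ Q.edge → ‖boxAvg f (cubeAt k x) - boxAvg f Q‖ₑ ≤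
        (volume (cubeAt k x).toSet)⁻¹ * (c * ∫⁻ y in hull (cubeAt k x), ‖G y‖ₑ) := by
    intro x Q hQ hs
    have := H f G h (cubeAt k x) (cubeAt k x) Q (hself x) hQ (by linarith [edge_pos (cubeAt k x)]) hs
    rw [mul_comm] at this
    rw [mul_comm _ (c * _)]
    exact (ENNReal.le_div_iff_mul_le (Or.inl (hV0 _)) (Or.inl (hVt _))).2 this
  have hint : ∫⁻ x : Euc d, (volume (cubeAt k x).toSet)⁻¹ *
      (c * ∫⁻ y in hull (cubeAt k x), ‖G y‖ₑ) ≤ c * (7 ^ d : ℕ) * ∫⁻ y in strip d k, ‖G y‖ₑ := by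
    refine lintegral_le_of_volume_mul_le
      (F := fun P => (volume P.toSet)⁻¹ * (c * ∫⁻ y in hull P, ‖G y‖ₑ)) fun P => ?_
    rw [← mul_assoc, ENNReal.mul_inv_cancel (hV0 _) (hVt _), one_mul]
  have h2 : (0 : ℝ) < 2 ^ (-k) := two_zpow_pos _
  refine ⟨(lintegral_mono fun x => hpt x _ (enlarged_subset_hull_of_child k x) ?_).trans hint,
    fun e he => (lintegral_mono fun x => hpt x _ ?_ ?_).trans hint⟩
  · rw [edge_cubeAt, edge_cubeAt, neg_add, zpow_add₀ two_ne_zero, zpow_neg_one]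
    linarith
  · rw [cubeAt_add_latticeVec]
    exact enlarged_subset_hull_of_neighbor k _ _ (by simpa using he)
  · rw [edge_cubeAt, edge_cubeAt]
    linarith

/-- The factor `2^k` is the quotient of the base volume by the box volume. Its growth does no harm,
since only finiteness at each level is needed. -/
theorem lintegral_boxAvg_le (f : Euc (d + 1) → ℝ) (k : ℤ) :
    ∫⁻ x : Euc d, ‖boxAvg f (cubeAt k x)‖ₑ ≤
      (ENNReal.ofReal (2 ^ (-k)))⁻¹ * (7 ^ d : ℕ) * ∫⁻ y in strip d k, ‖f y‖ₑ := by
  refine lintegral_le_of_volume_mul_le (F := fun P => ‖boxAvg f P‖ₑ) fun P => ?_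
  obtain ⟨⟨l, m⟩, rfl⟩ := P
  have hsub : (⟨l, m⟩ : DyadicCube d).enlarged ⊆ hull ⟨l, m⟩ :=
    enlarged_subset_hull_of_neighbor l _ _ (by simp [mem_offsets])
  have hfin : volume (⟨l, m⟩ : DyadicCube d).enlarged ≠ ⊤ :=
    ((measure_mono (hsub.trans (hull_subset_closedHull _))).trans_lt
      (isCompact_closedHull _).measure_lt_top).ne
  have h1 := measure_mul_enorm_setAverage_le _ hfin f
  have h2 := (mul_le_mul_left (le_volume_enlarged (⟨l, m⟩ : DyadicCube d)) _).trans
    (h1.trans (lintegral_mono_set hsub))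
  rw [mul_comm _ (∫⁻ y in hull _, ‖f y‖ₑ)]
  refine (ENNReal.le_div_iff_mul_le (Or.inl ?_) (Or.inl ENNReal.ofReal_ne_top)).2 ?_
  · simpa using two_zpow_pos (-l)
  · refine le_trans (le_of_eq ?_) h2
    rw [volume_toSet, pow_succ]
    simp only [boxAvg, edge]
    ring

/-! ### The weight on the strips -/

theorem measurable_weight (d : ℕ) (lam : ℝ) : Measurable (weight d 0 lam) := by
  have h : Measurable fun y : Euc (d + 1) => y (Fin.last d) := by fun_prop
  refine Measurable.ite (measurableSet_le h measurable_const) ?_ measurable_const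
  fun_prop

theorem log_four_pos : 0 < Real.log 4 := Real.log_pos (by norm_num)

theorem log_four : Real.log 4 = 2 * Real.log 2 := by
  rw [show (4 : ℝ) = 2 ^ 2 by norm_num, Real.log_pow]; norm_num

theorem log_four_rpow_le_weight {lam : ℝ} (hlam : 0 < lam) {y : Euc (d + 1)}
    (hy : y ∈ upperHalf d) : Real.log 4 ^ lam ≤ weight d 0 lam y := by
  have hy' : 0 < y (Fin.last d) := hy
  unfold weight
  split_ifs with h
  · rw [Real.rpow_zero, one_mul, abs_of_pos hy']
    refine Real.rpow_le_rpow log_four_pos.le (Real.log_le_log (by norm_num) ?_) hlam.le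
    rw [le_div_iff₀ hy']
    linarith
  · exact le_rfl

/-- On the strip `4/t > 2^k`, and the weight is the `λ`-th power of `max (log 4) (log (4/t))`. With
`log 4 = 2 log 2`, the product `(k+2) log 4` equals `2 k log 2 + 2 log 4`, at most four times this
maximum. -/
theorem rpow_le_weight_of_mem_strip {lam : ℝ} (hlam : 0 < lam) (k : ℕ) {y : Euc (d + 1)}
    (hy : y ∈ strip d k) :
    Real.log 4 ^ lam * (((k : ℝ) + 2) ^ lam) ≤ 4 ^ lam * weight d 0 lam y := by
  have hpos : 0 < y (Fin.last d) := lt_trans (by positivity) hy.1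
  have hlog2 : 0 < Real.log 2 := Real.log_pos (by norm_num)
  have hsplit : weight d 0 lam y = (max (Real.log 4) (Real.log (4 / y (Fin.last d)))) ^ lam := by
    unfold weight
    split_ifs with h
    · rw [Real.rpow_zero, one_mul, abs_of_pos hpos, max_eq_right]
      refine Real.log_le_log (by norm_num) ?_
      rw [le_div_iff₀ hpos]
      linarith
    · rw [max_eq_left]
      refine Real.log_le_log (by positivity) ?_
      rw [div_le_iff₀ hpos]
      linarith
  rw [hsplit, ← Real.mul_rpow log_four_pos.le (by positivity),
    ← Real.mul_rpow (by norm_num) (log_four_pos.le.trans (le_max_left _ _))]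
  refine Real.rpow_le_rpow (by have := log_four_pos; positivity) ?_ hlam.le
  have hk : (k : ℝ) * Real.log 2 ≤ Real.log (4 / y (Fin.last d)) := by
    rw [← Real.log_pow]
    refine Real.log_le_log (by positivity) ?_
    have h2 := hy.2
    rw [zpow_neg, zpow_natCast, ← div_eq_mul_inv, lt_div_iff₀ (by positivity)] at h2
    rw [le_div_iff₀ hpos]
    linarith
  have h1 := le_max_left (Real.log 4) (Real.log (4 / y (Fin.last d)))
  have h2 := le_max_right (Real.log 4) (Real.log (4 / y (Fin.last d)))
  rw [log_four] at *
  nlinarith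

/-- Stated for measures so that it transfers to lower integrals of arbitrary functions, without
measurability of the integrand. -/
theorem smul_restrict_le_weightedMeasure {lam c : ℝ} {S : Set (Euc (d + 1))} (hS : MeasurableSet S)
    (hSU : S ⊆ upperHalf d)
    (h : ∀ y ∈ S, Real.log 4 ^ lam * c ≤ weight d 0 lam y) :
    ENNReal.ofReal c • volume.restrict S ≤ (weightedMeasure d 0 lam).restrict S := by
  refine Measure.le_iff.2 fun E hE => ?_
  have hL : (0 : ℝ) < Real.log 4 ^ lam := Real.rpow_pos_of_pos log_four_pos _
  have hES := hE.inter hS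
  rw [Measure.smul_apply, Measure.restrict_apply hE, Measure.restrict_apply hE, weightedMeasure,
    Measure.smul_apply, withDensity_apply _ hES, Measure.restrict_restrict hES,
    Set.inter_eq_left.2 (Set.inter_subset_right.trans hSU), smul_eq_mul, smul_eq_mul]
  calc ENNReal.ofReal c * volume (E ∩ S)
      = ENNReal.ofReal (1 / Real.log 4 ^ lam) *
        ∫⁻ _ in E ∩ S, ENNReal.ofReal (Real.log 4 ^ lam * c) := by
        rw [setLIntegral_const, ← mul_assoc, ← ENNReal.ofReal_mul (by positivity)]
        congr 2
        field_simp
    _ ≤ _ := by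
        exact mul_le_mul' le_rfl
          (setLIntegral_mono' hES fun y hy => ENNReal.ofReal_le_ofReal (h y hy.2))

theorem restrict_le_weightedMeasure {lam : ℝ} (hlam : 0 < lam) {S : Set (Euc (d + 1))}
    (hS : MeasurableSet S) (hSU : S ⊆ upperHalf d) :
    volume.restrict S ≤ (weightedMeasure d 0 lam).restrict S := by
  have := smul_restrict_le_weightedMeasure (lam := lam) (c := 1) hS hSU
    fun y hy => by rw [mul_one]; exact log_four_rpow_le_weight hlam (hSU hy)
  simpa using this

theorem strip_subset_upperHalf (k : ℤ) : strip d k ⊆ upperHalf d := fun _ hy =>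
  lt_trans (by have := two_zpow_pos (-k); positivity) hy.1

theorem lintegral_strip_le_weighted {lam : ℝ} (hlam : 0 < lam) (k : ℕ)
    (h : Euc (d + 1) → ENNReal) :
    ENNReal.ofReal (((k : ℝ) + 2) ^ lam) * ∫⁻ y in strip d k, h y ≤
      ENNReal.ofReal (4 ^ lam) * ∫⁻ y in strip d k, h y ∂weightedMeasure d 0 lam := by
  have h4 : (0 : ℝ) < 4 ^ lam := by positivity
  have := smul_restrict_le_weightedMeasure (lam := lam) (c := ((k : ℝ) + 2) ^ lam / 4 ^ lam)
    (measurableSet_strip (d := d) k) (strip_subset_upperHalf _) fun y hy => by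
      rw [← mul_div_assoc, div_le_iff₀ h4, mul_comm (weight d 0 lam y)]
      exact rpow_le_weight_of_mem_strip hlam k hy
  have h2 := lintegral_mono' this (le_refl h)
  rw [lintegral_smul_measure, smul_eq_mul] at h2
  refine le_trans (le_of_eq ?_) (mul_le_mul_right h2 _)
  rw [← mul_assoc, ← ENNReal.ofReal_mul h4.le]
  congr 2
  field_simp

/-- The heights in a strip span a factor of `16 = 2^4`, so strips whose indices agree modulo `4` are
disjoint. -/
theorem tsum_lintegral_strip_le (μ : Measure (Euc (d + 1))) (h : Euc (d + 1) → ENNReal) :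
    ∑' k : ℕ, ∫⁻ y in strip d k, h y ∂μ ≤ 4 * ∫⁻ y, h y ∂μ := by
  rw [← (Nat.divModEquiv 4).symm.tsum_eq, ENNReal.tsum_prod', ENNReal.tsum_comm, tsum_fintype]
  have hr : ∀ r : Fin 4, ∑' q : ℕ, ∫⁻ y in strip d ((Nat.divModEquiv 4).symm (q, r) : ℕ), h y ∂μ ≤
      ∫⁻ y, h y ∂μ := by
    intro r
    rw [← lintegral_iUnion (fun q => measurableSet_strip _)]
    · exact setLIntegral_le_lintegral _ _
    · refine (pairwise_disjoint_on _).2 fun a b hab => Set.disjoint_left.2 fun y hy hy' => ?_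
      have h1 := hy.1
      have h2 := hy'.2
      simp only [Nat.divModEquiv_symm_apply] at h1 h2
      have h3 : (2 : ℝ) ^ (-((b * 4 + r : ℕ) : ℤ)) ≤ 2 ^ (-((a * 4 + r : ℕ) : ℤ) - 4) := by
        refine zpow_le_zpow_right₀ (by norm_num) ?_
        push_cast
        omega
      rw [zpow_sub₀ two_ne_zero, zpow_ofNat] at h3
      norm_num at h1 h2 h3
      linarith
  refine (Finset.sum_le_card_nsmul _ _ _ fun r _ => hr r).trans ?_
  simp

/-! ### Existence of the trace -/

theorem traceApprox_eq (k : ℕ) (f : Euc (d + 1) → ℝ) (x : Euc d) :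
    traceApprox d k f x = boxAvg f (cubeAt k x) := by
  unfold traceApprox
  rw [tsum_eq_single (⟨cubeAt k x, rfl⟩ : layer d (k : ℤ))]
  · exact Set.indicator_of_mem (mem_cubeAt _ x) _
  · intro Q hQ
    refine Set.indicator_of_notMem (fun hx => hQ ?_) _
    exact Subtype.ext (cubeAt_eq_of_mem Q hx).symm

/-- A sequence of functions with summable `L^1` increments converges almost everywhere. -/
theorem exists_ae_tendsto_of_tsum_lintegral {α : Type*} [MeasurableSpace α] {μ : Measure α}
    {T : ℕ → α → ℝ} (hT : ∀ k, Measurable (T k))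
    (h : ∑' k, ∫⁻ x, ‖T k x - T (k + 1) x‖ₑ ∂μ ≠ ⊤) :
    ∃ g : α → ℝ, Measurable g ∧ ∀ᵐ x ∂μ, Tendsto (fun k => T k x) atTop (𝓝 (g x)) := by
  have hm : ∀ k, AEMeasurable (fun x => ‖T k x - T (k + 1) x‖ₑ) μ := fun k =>
    ((hT k).sub (hT (k + 1))).enorm.aemeasurable
  rw [← lintegral_tsum hm] at h
  refine measurable_limit_of_tendsto_metrizable_ae (fun k => (hT k).aemeasurable) ?_
  filter_upwards [ae_lt_top' (AEMeasurable.tsum hm) h] with x hx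
  refine cauchySeq_tendsto_of_complete
    (cauchySeq_of_edist_le_of_tsum_ne_top _ (fun k => ?_) hx.ne)
  rw [edist_eq_enorm_sub]

theorem lintegral_sub_limit_le {α : Type*} [MeasurableSpace α] {μ : Measure α}
    {T : ℕ → α → ℝ} (hT : ∀ k, Measurable (T k)) {g : α → ℝ}
    (hg : ∀ᵐ x ∂μ, Tendsto (fun k => T k x) atTop (𝓝 (g x))) :
    ∫⁻ x, ‖g x - T 0 x‖ₑ ∂μ ≤ ∑' k, ∫⁻ x, ‖T k x - T (k + 1) x‖ₑ ∂μ := by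
  have hm : ∀ k, AEMeasurable (fun x => ‖T k x - T (k + 1) x‖ₑ) μ := fun k =>
    ((hT k).sub (hT (k + 1))).enorm.aemeasurable
  rw [← lintegral_tsum hm]
  refine lintegral_mono_ae ?_
  filter_upwards [hg] with x hx
  have := edist_le_tsum_of_edist_le_of_tendsto₀ (f := fun k => T k x)
    (fun k => ‖T k x - T (k + 1) x‖ₑ) (fun k => by rw [edist_eq_enorm_sub]) hx
  rwa [edist_comm, edist_eq_enorm_sub] at this

/-! ### Summation of the tails -/

/-- Since `2^j + 2 ≤ 3 · 2^j`, the terms are dominated by a geometric sequence of ratio `2^λ > 1`,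
whose sum is controlled by its last term. Positivity of `λ` is essential: at `λ = 0` the sum would
grow like `log n`. -/
theorem sum_rpow_le {lam : ℝ} (hlam : 0 < lam) : ∃ c : ℝ, 0 ≤ c ∧ ∀ n : ℕ,
    ∑ j ∈ Finset.range (Nat.log 2 n + 1), ((2 : ℝ) ^ j + 2) ^ lam ≤ c * ((n : ℝ) + 2) ^ lam := by
  set q : ℝ := 2 ^ lam with hq
  have hq1 : 1 < q := Real.one_lt_rpow (by norm_num) hlam
  refine ⟨3 ^ lam * (q / (q - 1)), by have := sub_pos.2 hq1; positivity, fun n => ?_⟩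
  have hqj : ∀ j : ℕ, q ^ j = ((2 : ℝ) ^ j) ^ lam := by
    intro j
    rw [hq, ← Real.rpow_natCast, ← Real.rpow_mul (by norm_num), mul_comm lam, Real.rpow_mul
      (by norm_num), Real.rpow_natCast]
  have hterm : ∀ j : ℕ, ((2 : ℝ) ^ j + 2) ^ lam ≤ 3 ^ lam * q ^ j := by
    intro j
    rw [hqj, ← Real.mul_rpow (by norm_num) (by positivity)]
    refine Real.rpow_le_rpow (by positivity) ?_ hlam.le
    have : (1 : ℝ) ≤ 2 ^ j := one_le_pow₀ (by norm_num)
    linarith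
  have hlog : q ^ Nat.log 2 n ≤ ((n : ℝ) + 2) ^ lam := by
    rw [hqj]
    refine Real.rpow_le_rpow (by positivity) ?_ hlam.le
    rcases Nat.eq_zero_or_pos n with rfl | hn
    · norm_num
    · have : ((2 ^ Nat.log 2 n : ℕ) : ℝ) ≤ n := by exact_mod_cast Nat.pow_log_le_self 2 hn.ne'
      push_cast at this
      linarith
  calc ∑ j ∈ Finset.range (Nat.log 2 n + 1), ((2 : ℝ) ^ j + 2) ^ lam
      ≤ ∑ j ∈ Finset.range (Nat.log 2 n + 1), 3 ^ lam * q ^ j := Finset.sum_le_sum fun j _ => hterm j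
    _ = 3 ^ lam * ((q ^ (Nat.log 2 n + 1) - 1) / (q - 1)) := by
        rw [← Finset.mul_sum, geom_sum_eq hq1.ne']
    _ ≤ 3 ^ lam * (q / (q - 1) * ((n : ℝ) + 2) ^ lam) := by
        have := sub_pos.2 hq1
        gcongr
        rw [div_mul_eq_mul_div]
        gcongr
        rw [pow_succ]
        nlinarith
    _ = _ := by ring

/-- After the sums are exchanged, `ν n` collects the weights of the `j` with `2^j ≤ n`, that is `j ≤
log₂ n`. -/
theorem tsum_weight_mul_tail_le {lam : ℝ} (hlam : 0 < lam) : ∃ c : ENNReal, c ≠ ⊤ ∧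
    ∀ ν : ℤ → ENNReal, ∑' j : ℕ, ENNReal.ofReal (((2 : ℝ) ^ j + 2) ^ lam) *
      ∑' l : ℕ, ν (2 ^ j + l) ≤ c * ∑' n : ℕ, ENNReal.ofReal (((n : ℝ) + 2) ^ lam) * ν n := by
  obtain ⟨c, hc, H⟩ := sum_rpow_le hlam
  refine ⟨ENNReal.ofReal c, ENNReal.ofReal_ne_top, fun ν => ?_⟩
  set w : ℕ → ENNReal := fun j => ENNReal.ofReal (((2 : ℝ) ^ j + 2) ^ lam) with hw
  have h1 : ∀ j : ℕ, ∑' l : ℕ, ν (2 ^ j + l) ≤ ∑' n : ℕ, if 2 ^ j ≤ n then ν n else 0 := by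
    intro j
    refine le_trans (le_of_eq (tsum_congr fun l => ?_)) (ENNReal.tsum_comp_le_tsum_of_injective
      (f := fun l : ℕ => 2 ^ j + l) (add_right_injective _) fun n : ℕ => if 2 ^ j ≤ n then ν n else 0)
    simp
  calc ∑' j : ℕ, w j * ∑' l : ℕ, ν (2 ^ j + l)
      ≤ ∑' j : ℕ, ∑' n : ℕ, if 2 ^ j ≤ n then w j * ν n else 0 := by
        refine ENNReal.tsum_le_tsum fun j => (mul_le_mul_right (h1 j) _).trans (le_of_eq ?_)
        rw [← ENNReal.tsum_mul_left]
        simp only [mul_ite, mul_zero]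
    _ = ∑' n : ℕ, ∑' j : ℕ, if 2 ^ j ≤ n then w j * ν n else 0 := ENNReal.tsum_comm
    _ ≤ ∑' n : ℕ, ENNReal.ofReal c * (ENNReal.ofReal (((n : ℝ) + 2) ^ lam) * ν n) := by
        refine ENNReal.tsum_le_tsum fun n => ?_
        rw [tsum_eq_sum (s := Finset.range (Nat.log 2 n + 1))]
        · calc ∑ j ∈ Finset.range (Nat.log 2 n + 1), (if 2 ^ j ≤ n then w j * ν n else 0)
              ≤ ∑ j ∈ Finset.range (Nat.log 2 n + 1), w j * ν n :=
                Finset.sum_le_sum fun j _ => by split_ifs <;> simp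
            _ = ENNReal.ofReal (∑ j ∈ Finset.range (Nat.log 2 n + 1), ((2 : ℝ) ^ j + 2) ^ lam) *
                ν n := by
                rw [← Finset.sum_mul, ENNReal.ofReal_sum_of_nonneg fun j _ => by positivity]
            _ ≤ ENNReal.ofReal (c * ((n : ℝ) + 2) ^ lam) * ν n := by gcongr; exact H n
            _ = _ := by rw [ENNReal.ofReal_mul hc, mul_assoc]
        · intro j hj
          rw [if_neg]
          intro hle
          rw [Finset.mem_range, not_lt, Nat.succ_le_iff] at hj
          have hn : n ≠ 0 := by rintro rfl; simp at hle
          exact absurd ((Nat.le_log_iff_pow_le (by norm_num) hn).2 hle) (not_le.2 hj)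
    _ = _ := ENNReal.tsum_mul_left

theorem previousLevel_succ (j : ℕ) : previousLevel (j + 1) = 2 ^ j := by simp [previousLevel]

theorem weight_succ_le {lam : ℝ} (hlam : 0 < lam) (j : ℕ) :
    ENNReal.ofReal (((2 : ℝ) ^ (j + 1) + 2) ^ lam) ≤
      ENNReal.ofReal (2 ^ lam) * ENNReal.ofReal (((2 : ℝ) ^ j + 2) ^ lam) := by
  rw [← ENNReal.ofReal_mul (by positivity), ← Real.mul_rpow (by norm_num) (by positivity)]
  refine ENNReal.ofReal_le_ofReal (Real.rpow_le_rpow (by positivity) ?_ hlam.le)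
  rw [pow_succ]
  linarith

/-- For `j = 0` the previous level is `1 = 2^0` and the term is unchanged; for the others, shifting
the index costs a factor `2^λ`. -/
theorem tsum_weight_mul_previousLevel_le {lam : ℝ} (hlam : 0 < lam) (δ : ℤ → ENNReal) :
    ∑' j : ℕ, ENNReal.ofReal (((2 : ℝ) ^ j + 2) ^ lam) * δ (previousLevel j) ≤
      (1 + ENNReal.ofReal (2 ^ lam)) *
        ∑' j : ℕ, ENNReal.ofReal (((2 : ℝ) ^ j + 2) ^ lam) * δ (2 ^ j) := by
  rw [tsum_eq_zero_add' ENNReal.summable, add_mul, one_mul]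
  refine add_le_add ?_ ?_
  · exact ENNReal.le_tsum (f := fun j : ℕ => ENNReal.ofReal (((2 : ℝ) ^ j + 2) ^ lam) * δ (2 ^ j)) 0
  · rw [← ENNReal.tsum_mul_left]
    refine ENNReal.tsum_le_tsum fun j => ?_
    rw [previousLevel_succ, ← mul_assoc]
    gcongr
    exact weight_succ_le hlam j

/-- Every function of the weighted Sobolev space has a trace in the Besov-type space. -/
theorem exists_trace_of_mem_sobolevSpace {lam : ℝ} (hlam : 0 < lam) {f : Euc (d + 1) → ℝ}
    (hf : f ∈ sobolevSpace d 1 0 lam) : ∃ g ∈ besovSpace d 1 lam, IsTrace d f g := by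
  obtain ⟨G, hG, hfin⟩ := hf
  rw [ENNReal.ofReal_one, eLpNorm_one_eq_lintegral_enorm, eLpNorm_one_eq_lintegral_enorm,
    ENNReal.add_lt_top] at hfin
  obtain ⟨hf1, hG1⟩ := hfin
  obtain ⟨c, hc, hcT⟩ := exists_lintegral_boxAvg_le d
  set T : ℤ → Euc d → ℝ := fun k x => boxAvg f (cubeAt k x) with hTdef
  have hTm : ∀ k, Measurable (T k) := fun k => measurable_comp_cubeAt k (boxAvg f)
  set ν : ℤ → ENNReal := fun k => ∫⁻ y in strip d k, ‖G y‖ₑ with hν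
  -- the weighted sum over the strips
  have hsum : ∑' n : ℕ, ENNReal.ofReal (((n : ℝ) + 2) ^ lam) * ν n ≠ ⊤ := by
    refine ne_top_of_le_ne_top ?_
      (ENNReal.tsum_le_tsum fun n => lintegral_strip_le_weighted hlam n fun y => ‖G y‖ₑ)
    rw [ENNReal.tsum_mul_left]
    refine ENNReal.mul_ne_top ENNReal.ofReal_ne_top
      (ne_top_of_le_ne_top ?_ (tsum_lintegral_strip_le _ _))
    exact ENNReal.mul_ne_top (by norm_num) hG1.ne
  have hsum0 : ∑' n : ℕ, ν n ≠ ⊤ := by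
    refine ne_top_of_le_ne_top hsum (ENNReal.tsum_le_tsum fun n => ?_)
    refine le_mul_of_one_le_left' ?_
    rw [← ENNReal.ofReal_one]
    refine ENNReal.ofReal_le_ofReal (Real.one_le_rpow ?_ hlam.le)
    have : (0 : ℝ) ≤ n := Nat.cast_nonneg n
    linarith
  -- the limit
  obtain ⟨g, hgm, hg⟩ := exists_ae_tendsto_of_tsum_lintegral (μ := volume)
    (T := fun (k : ℕ) => T k) (fun k => hTm k) (by
      refine ne_top_of_le_ne_top ?_ (ENNReal.tsum_le_tsum fun n : ℕ => (hcT f G hG n).1)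
      rw [ENNReal.tsum_mul_left]
      exact ENNReal.mul_ne_top hc hsum0)
  have hgZ : ∀ᵐ x : Euc d, Tendsto (fun k : ℤ => T k x) atTop (𝓝 (g x)) := by
    filter_upwards [hg] with x hx
    rwa [← Nat.map_cast_int_atTop, tendsto_map'_iff]
  -- The tail includes `l = 0`, so `δ k` controls both the distance of `g` to level `k` and the
  -- neighbor differences on that level.
  set δ : ℤ → ENNReal := fun k => c * ∑' l : ℕ, ν (k + l) with hδdef
  have hδ : ∀ k : ℤ, ∫⁻ x, ‖g x - T k x‖ₑ ≤ δ k := by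
    intro k
    have hshift : Tendsto (fun n : ℕ => k + (n : ℤ)) atTop atTop :=
      tendsto_atTop_add_const_left _ _ tendsto_natCast_atTop_atTop
    have h1 := lintegral_sub_limit_le (μ := volume) (T := fun n : ℕ => T (k + n))
      (fun n => hTm _) (g := g) (by
        filter_upwards [hgZ] with x hx
        exact hx.comp hshift)
    simp only [Nat.cast_zero, add_zero] at h1
    refine h1.trans ?_
    rw [hδdef]
    simp only
    rw [← ENNReal.tsum_mul_left]
    refine ENNReal.tsum_le_tsum fun n => ?_
    have := (hcT f G hG (k + n)).1
    simpa only [hTdef, Nat.cast_add, Nat.cast_one, ← add_assoc] using this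
  have hδ' : ∀ k : ℤ, ∀ e ∈ offsets d,
      ∫⁻ x : Euc d, ‖boxAvg f (cubeAt k x) - boxAvg f (cubeAt k (x + latticeVec k e))‖ₑ ≤ δ k := by
    intro k e he
    refine ((hcT f G hG k).2 e he).trans (mul_le_mul_right ?_ c)
    have := ENNReal.le_tsum (f := fun l : ℕ => ν (k + l)) 0
    simpa using this
  -- integrability
  have hTint : ∀ k, ∫⁻ x, ‖T k x‖ₑ < ⊤ := by
    intro k
    refine (lintegral_boxAvg_le f k).trans_lt ?_
    refine ENNReal.mul_lt_top (ENNReal.mul_lt_top ?_ (ENNReal.natCast_lt_top _)) ?_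
    · rw [ENNReal.inv_lt_top]
      simpa using two_zpow_pos (-k)
    · refine lt_of_le_of_lt ?_ hf1
      refine (lintegral_mono' (restrict_le_weightedMeasure hlam (measurableSet_strip k)
        (strip_subset_upperHalf k)) le_rfl).trans (setLIntegral_le_lintegral _ _)
  have hTloc : ∀ k, LocallyIntegrable (T k) volume := fun k =>
    Integrable.locallyIntegrable ⟨(hTm k).aestronglyMeasurable, hTint k⟩
  have hgint : ∫⁻ x, ‖g x‖ₑ < ⊤ := by
    have h1 : ∫⁻ x, ‖g x‖ₑ ≤ ∫⁻ x, ‖g x - T 0 x‖ₑ + ‖T 0 x‖ₑ := lintegral_mono fun x => by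
      simpa using enorm_add_le (g x - T 0 x) (T 0 x)
    rw [lintegral_add_right _ (hTm 0).enorm] at h1
    refine h1.trans_lt (ENNReal.add_lt_top.2 ⟨(hδ 0).trans_lt ?_, hTint 0⟩)
    rw [hδdef]
    simp only [zero_add]
    exact ENNReal.mul_lt_top hc.lt_top hsum0.lt_top
  have hgloc : LocallyIntegrable g volume :=
    Integrable.locallyIntegrable ⟨hgm.aestronglyMeasurable, hgint⟩
  -- the energy
  have hS : ∑' j : ℕ, ENNReal.ofReal (((2 : ℝ) ^ j + 2) ^ lam) * δ (2 ^ j) ≠ ⊤ := by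
    obtain ⟨C, hC, H⟩ := tsum_weight_mul_tail_le hlam
    have e : ∀ j : ℕ, ENNReal.ofReal (((2 : ℝ) ^ j + 2) ^ lam) * δ (2 ^ j) =
        c * (ENNReal.ofReal (((2 : ℝ) ^ j + 2) ^ lam) * ∑' l : ℕ, ν (2 ^ j + l)) := fun j => by
      rw [hδdef]; ring
    simp only [e]
    rw [ENNReal.tsum_mul_left]
    exact ENNReal.mul_ne_top hc (ne_top_of_le_ne_top (ENNReal.mul_ne_top hC hsum) (H ν))
  have henergy : besovEnergy d 1 lam g ≠ ⊤ := by
    rw [besovEnergy_one]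
    refine ne_top_of_le_ne_top ?_ (ENNReal.tsum_le_tsum fun j => mul_le_mul_right
      (lintegral_neighborSum_le j hgm hgloc (boxAvg f) hTloc δ hδ hδ') _)
    have e : ∀ j : ℕ, ENNReal.ofReal (((2 : ℝ) ^ j + 2) ^ lam) *
        ((offsets d).card * (5 * δ (2 ^ j) + 3 * δ (previousLevel j))) =
        (offsets d).card * 5 * (ENNReal.ofReal (((2 : ℝ) ^ j + 2) ^ lam) * δ (2 ^ j)) +
        (offsets d).card * 3 *
          (ENNReal.ofReal (((2 : ℝ) ^ j + 2) ^ lam) * δ (previousLevel j)) := fun j => by ring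
    simp only [e]
    rw [ENNReal.tsum_add, ENNReal.tsum_mul_left, ENNReal.tsum_mul_left]
    have hcard : ((offsets d).card : ENNReal) ≠ ⊤ := ENNReal.natCast_ne_top _
    refine ENNReal.add_ne_top.2 ⟨ENNReal.mul_ne_top (ENNReal.mul_ne_top hcard (by norm_num)) hS,
      ENNReal.mul_ne_top (ENNReal.mul_ne_top hcard (by norm_num))
        (ne_top_of_le_ne_top ?_ (tsum_weight_mul_previousLevel_le hlam δ))⟩
    exact ENNReal.mul_ne_top (ENNReal.add_ne_top.2 ⟨by norm_num, ENNReal.ofReal_ne_top⟩) hS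
  refine ⟨g, ⟨hgloc, ?_⟩, ?_⟩
  · rw [besovNorm, ENNReal.ofReal_one, eLpNorm_one_eq_lintegral_enorm, div_one, ENNReal.rpow_one]
    exact ENNReal.add_lt_top.2 ⟨hgint, henergy.lt_top⟩
  · filter_upwards [hg] with x hx
    simpa only [traceApprox_eq] using hx

/-! ### Mollification at unit scale -/

/-- A smooth bump on the unit ball. -/
def unitBump (d : ℕ) : ContDiffBump (0 : Euc d) := ⟨1 / 2, 1, by norm_num, by norm_num⟩

/-- A smooth probability density supported in the unit ball. -/
def kernel (d : ℕ) : Euc d → ℝ := (unitBump d).normed volume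

theorem contDiff_kernel (d : ℕ) : ContDiff ℝ ∞ (kernel d) := (unitBump d).contDiff_normed

theorem hasCompactSupport_kernel (d : ℕ) : HasCompactSupport (kernel d) :=
  (unitBump d).hasCompactSupport_normed

theorem support_kernel (d : ℕ) : Function.support (kernel d) = Metric.ball 0 1 :=
  (unitBump d).support_normed_eq

theorem integral_kernel (d : ℕ) : ∫ x, kernel d x = 1 := (unitBump d).integral_normed

theorem integrable_kernel (d : ℕ) : Integrable (kernel d) volume :=
  (contDiff_kernel d).continuous.integrable_of_hasCompactSupport (hasCompactSupport_kernel d)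

theorem continuous_fderiv_kernel (d : ℕ) : Continuous (fderiv ℝ (kernel d)) :=
  (contDiff_kernel d).continuous_fderiv (by simp)

/-- The `L^1` norm of the gradient of the kernel. -/
def kernelGradNorm (d : ℕ) : ℝ := ∫ x, ‖fderiv ℝ (kernel d) x‖

theorem integrable_fderiv_kernel (d : ℕ) : Integrable (fderiv ℝ (kernel d)) volume :=
  (continuous_fderiv_kernel d).integrable_of_hasCompactSupport
    ((hasCompactSupport_kernel d).fderiv ℝ)

theorem kernelGradNorm_nonneg (d : ℕ) : 0 ≤ kernelGradNorm d :=
  integral_nonneg fun _ => norm_nonneg _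

/-- The mollification of `H` at unit scale. -/
def mollify (H : Euc d → ℝ) : Euc d → ℝ :=
  convolution (kernel d) H (ContinuousLinearMap.lsmul ℝ ℝ) volume

theorem contDiff_mollify {H : Euc d → ℝ} (hH : LocallyIntegrable H volume) :
    ContDiff ℝ ∞ (mollify H) :=
  (hasCompactSupport_kernel d).contDiff_convolution_left _ (contDiff_kernel d) hH

theorem abs_mollify_sub_le {H : Euc d → ℝ} (hH : LocallyIntegrable H volume) {w : Euc d} {c S : ℝ}
    (hS : 0 ≤ S) (h : ∀ w' ∈ Metric.closedBall w 1, |H w' - c| ≤ S) : |mollify H w - c| ≤ S := by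
  have := dist_convolution_le (μ := volume) (f := kernel d) (g := H) (x₀ := w) (z₀ := c) (R := 1) hS
    (support_kernel d).le (fun x => (unitBump d).nonneg_normed x) (integral_kernel d)
    hH.aestronglyMeasurable (fun x hx => by rw [Real.dist_eq]; exact h x (Metric.ball_subset_closedBall hx))
  rwa [Real.dist_eq] at this

theorem mollify_sub_const {H : Euc d → ℝ} (hH : LocallyIntegrable H volume) (c : ℝ) (w : Euc d) :
    mollify (fun x => H x - c) w = mollify H w - c := by
  have h1 : ConvolutionExistsAt (kernel d) H w (ContinuousLinearMap.lsmul ℝ ℝ) volume :=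
    (hasCompactSupport_kernel d).convolutionExists_left _ (contDiff_kernel d).continuous hH w
  have h2 : Integrable (fun t => kernel d t * c) volume := (integrable_kernel d).mul_const c
  have e : ∀ t, (ContinuousLinearMap.lsmul ℝ ℝ) (kernel d t) (H (w - t) - c) =
      (ContinuousLinearMap.lsmul ℝ ℝ) (kernel d t) (H (w - t)) - kernel d t * c := by
    intro t
    simp only [ContinuousLinearMap.lsmul_apply, smul_eq_mul]
    ring
  simp only [mollify, convolution_def, e]
  rw [integral_sub h1 h2, integral_mul_const, integral_kernel, one_mul]

/-- A constant can be subtracted before differentiating. The derivative then falls on the kernel, so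
the gradient is controlled by the oscillation of `H` on a unit ball. -/
theorem norm_fderiv_mollify_le {H : Euc d → ℝ} (hH : LocallyIntegrable H volume) {w : Euc d}
    {c S : ℝ} (h : ∀ w' ∈ Metric.closedBall w 1, |H w' - c| ≤ S) :
    ‖fderiv ℝ (mollify H) w‖ ≤ kernelGradNorm d * S := by
  have hHc : LocallyIntegrable (fun x => H x - c) volume := hH.sub (locallyIntegrable_const c)
  have e : mollify H = fun w => mollify (fun x => H x - c) w + c := by
    funext w
    rw [mollify_sub_const hH]
    ring
  rw [e, fderiv_add_const]
  have hder := (hasCompactSupport_kernel d).hasFDerivAt_convolution_left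
    (ContinuousLinearMap.lsmul ℝ ℝ) (μ := volume) ((contDiff_kernel d).of_le (by simp)) hHc w
  rw [show mollify (fun x => H x - c) = convolution (kernel d) (fun x => H x - c)
    (ContinuousLinearMap.lsmul ℝ ℝ) volume from rfl, hder.fderiv, convolution_def, kernelGradNorm,
    ← integral_mul_const]
  refine norm_integral_le_of_norm_le ((integrable_fderiv_kernel d).norm.mul_const S)
    (ae_of_all _ fun t => ?_)
  by_cases ht : fderiv ℝ (kernel d) t = 0
  · simp [ht]
  have htb : t ∈ Metric.closedBall (0 : Euc d) 1 := by
    have : t ∈ tsupport (kernel d) := support_fderiv_subset ℝ ht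
    rw [tsupport, support_kernel] at this
    exact Metric.closure_ball_subset_closedBall this
  have hpre : ∀ (u : Euc d →L[ℝ] ℝ) (s : ℝ), (ContinuousLinearMap.precompL (Euc d)
      (ContinuousLinearMap.lsmul ℝ ℝ : ℝ →L[ℝ] ℝ →L[ℝ] ℝ)) u s = s • u := by
    intro u s
    ext v
    rw [ContinuousLinearMap.precompL_apply]
    simp [mul_comm]
  rw [hpre, norm_smul, mul_comm]
  refine mul_le_mul_of_nonneg_left (h _ ?_) (norm_nonneg _)
  rw [Metric.mem_closedBall, dist_eq_norm]
  simpa using htb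

/-! ### Smoothed dyadic averages -/

/-- The sum of the differences of the average of `g` over the cube at `x` and those over its
neighbors. -/
def offsetSum (k : ℤ) (g : Euc d → ℝ) (x : Euc d) : ℝ :=
  ∑ e ∈ offsets d, |cubeAvg k g x - cubeAvg k g (x + latticeVec k e)|

theorem offsetSum_nonneg (k : ℤ) (g : Euc d → ℝ) (x : Euc d) : 0 ≤ offsetSum k g x :=
  Finset.sum_nonneg fun _ _ => abs_nonneg _

theorem measurable_offsetSum (k : ℤ) (g : Euc d → ℝ) : Measurable (offsetSum k g) := by
  have := measurable_cubeAvg k g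
  unfold offsetSum
  refine Finset.measurable_sum _ fun e _ => ?_
  exact (this.sub (this.comp (measurable_add_const _))).abs

theorem posAt_sub_mem_offsets {k : ℤ} {x x' : Euc d}
    (h : ∀ i, |2 ^ k * x' i - 2 ^ k * x i| ≤ 1) : posAt k x' - posAt k x ∈ offsets d := by
  rw [mem_offsets]
  intro i
  obtain ⟨h1, h2⟩ := abs_le.1 (h i)
  have h3 : ⌈(2 : ℝ) ^ k * x' i⌉ ≤ ⌈(2 : ℝ) ^ k * x i⌉ + 1 := by
    rw [← Int.ceil_add_one]
    exact Int.ceil_le_ceil (by linarith)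
  have h4 : ⌈(2 : ℝ) ^ k * x i⌉ ≤ ⌈(2 : ℝ) ^ k * x' i⌉ + 1 := by
    rw [← Int.ceil_add_one]
    exact Int.ceil_le_ceil (by linarith)
  simp only [Pi.sub_apply, posAt]
  rw [abs_le]
  omega

/-- A smooth approximation of `g` at scale `2^{-k}`. -/
def smoothAvg (k : ℤ) (g : Euc d → ℝ) (x : Euc d) : ℝ :=
  mollify (fun w => cubeAvg k g ((2 : ℝ) ^ (-k) • w)) ((2 : ℝ) ^ k • x)

theorem integrable_cubeAvg (k : ℤ) {g : Euc d → ℝ} (hg : ∫⁻ x, ‖g x‖ₑ < ⊤) :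
    Integrable (cubeAvg k g) volume :=
  ⟨(measurable_cubeAvg k g).aestronglyMeasurable, (lintegral_enorm_cubeAvg_le k g).trans_lt hg⟩

theorem locallyIntegrable_cubeAvg_smul (k : ℤ) {g : Euc d → ℝ} (hg : ∫⁻ x, ‖g x‖ₑ < ⊤) :
    LocallyIntegrable (fun w : Euc d => cubeAvg k g ((2 : ℝ) ^ (-k) • w)) volume :=
  ((integrable_cubeAvg k hg).comp_smul (two_zpow_pos (-k)).ne').locallyIntegrable

theorem contDiff_smoothAvg (k : ℤ) {g : Euc d → ℝ} (hg : ∫⁻ x, ‖g x‖ₑ < ⊤) :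
    ContDiff ℝ ∞ (smoothAvg k g) :=
  (contDiff_mollify (locallyIntegrable_cubeAvg_smul k hg)).comp (contDiff_const_smul _)

/-- The points that enter the mollification at `x`. -/
theorem abs_coord_sub_le_of_mem_closedBall {k : ℤ} {x w : Euc d}
    (hw : w ∈ Metric.closedBall ((2 : ℝ) ^ k • x) 1) (i : Fin d) :
    |2 ^ k * ((2 : ℝ) ^ (-k) • w) i - 2 ^ k * x i| ≤ 1 := by
  rw [Metric.mem_closedBall, dist_eq_norm] at hw
  have h := (abs_apply_le_norm (w - (2 : ℝ) ^ k • x) i).trans hw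
  have e : (2 : ℝ) ^ k * ((2 : ℝ) ^ (-k) * w i) = w i := by
    rw [← mul_assoc, ← zpow_add₀ two_ne_zero]; simp
  rw [PiLp.smul_apply, smul_eq_mul, e]
  simpa using h

/-- The mollification at `x` only sees points within one edge length, which lie in neighboring
cubes; the difference is then one term of the sum. -/
theorem abs_cubeAvg_sub_le_offsetSum (k : ℤ) (g : Euc d → ℝ) {x w : Euc d}
    (hw : w ∈ Metric.closedBall ((2 : ℝ) ^ k • x) 1) :
    |cubeAvg k g ((2 : ℝ) ^ (-k) • w) - cubeAvg k g x| ≤ offsetSum k g x := by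
  set x' : Euc d := (2 : ℝ) ^ (-k) • w with hx'
  have hmem := posAt_sub_mem_offsets (abs_coord_sub_le_of_mem_closedBall hw)
  have e : cubeAvg k g x' = cubeAvg k g (x + latticeVec k (posAt k x' - posAt k x)) := by
    unfold cubeAvg
    rw [cubeAt_add_latticeVec, add_sub_cancel]
    rfl
  rw [e, abs_sub_comm]
  exact Finset.single_le_sum
    (f := fun e => |cubeAvg k g x - cubeAvg k g (x + latticeVec k e)|)
    (fun _ _ => abs_nonneg _) hmem

theorem abs_smoothAvg_sub_cubeAvg_le (k : ℤ) {g : Euc d → ℝ} (hg : ∫⁻ x, ‖g x‖ₑ < ⊤) (x : Euc d) :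
    |smoothAvg k g x - cubeAvg k g x| ≤ offsetSum k g x :=
  abs_mollify_sub_le (locallyIntegrable_cubeAvg_smul k hg) (offsetSum_nonneg k g x)
    fun _ hw => abs_cubeAvg_sub_le_offsetSum k g hw

theorem norm_fderiv_smoothAvg_le (k : ℤ) {g : Euc d → ℝ} (hg : ∫⁻ x, ‖g x‖ₑ < ⊤) (x : Euc d) :
    ‖fderiv ℝ (smoothAvg k g) x‖ ≤ 2 ^ k * (kernelGradNorm d * offsetSum k g x) := by
  have h := norm_fderiv_mollify_le (locallyIntegrable_cubeAvg_smul k hg)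
    fun _ hw => abs_cubeAvg_sub_le_offsetSum k g (x := x) hw
  unfold smoothAvg
  rw [fderiv_comp_smul, norm_smul, Real.norm_of_nonneg (two_zpow_pos k).le]
  gcongr

theorem lintegral_offsetSum_le (j : ℕ) (g : Euc d → ℝ) :
    ∫⁻ x, ENNReal.ofReal (offsetSum (2 ^ j) g x) ≤
      (offsets d).card * ∫⁻ x : Euc d, neighborSum j g (cubeAt (2 ^ j) x) := by
  have hm : Measurable fun x : Euc d => neighborSum j g (cubeAt (2 ^ j) x) :=
    measurable_comp_cubeAt _ _
  rw [← lintegral_const_mul _ hm]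
  refine lintegral_mono fun x => ?_
  rw [offsetSum, ENNReal.ofReal_sum_of_nonneg fun _ _ => abs_nonneg _]
  refine (Finset.sum_le_card_nsmul _ _ _ fun e he => ?_).trans (le_of_eq (nsmul_eq_mul _ _))
  rw [← Real.enorm_eq_ofReal_abs]
  exact enorm_sub_le_neighborSum j g x he

/-! ### The increments of the smoothed averages along the selected layers -/

/-- The differences of smoothed averages at consecutive selected levels. -/
def increment (g : Euc d → ℝ) : ℕ → Euc d → ℝ
  | 0 => smoothAvg (2 ^ 0) g
  | j + 1 => fun x => smoothAvg (2 ^ (j + 1)) g x - smoothAvg (2 ^ j) g x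

theorem sum_increment (g : Euc d → ℝ) (j : ℕ) (x : Euc d) :
    ∑ i ∈ Finset.range (j + 1), increment g i x = smoothAvg (2 ^ j) g x := by
  induction j with
  | zero => simp [increment]
  | succ j ih =>
    rw [Finset.sum_range_succ, ih, increment]
    ring

/-- The unweighted energy of one selected level. -/
def levelEnergy (g : Euc d → ℝ) (j : ℕ) : ENNReal :=
  ∫⁻ x : Euc d, neighborSum j g (cubeAt (2 ^ j) x)

/-- The quantity that controls the increment with index `j`. -/
def incrementBound (g : Euc d → ℝ) : ℕ → ENNReal
  | 0 => levelEnergy g 0 + ∫⁻ x, ‖g x‖ₑ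
  | j + 1 => levelEnergy g (j + 1) + levelEnergy g j

/-- The reciprocal `2^{2^j}` of the edge length of the cubes of the selected layer `j`. -/
def scale (j : ℕ) : ℝ := 2 ^ ((2 : ℤ) ^ j)

theorem scale_pos (j : ℕ) : 0 < scale j := two_zpow_pos _

theorem scale_le_scale_succ (j : ℕ) : scale j ≤ scale (j + 1) :=
  zpow_le_zpow_right₀ (by norm_num) (pow_le_pow_right₀ (by norm_num) j.le_succ)

theorem contDiff_increment {g : Euc d → ℝ} (hg : ∫⁻ x, ‖g x‖ₑ < ⊤) (j : ℕ) :
    ContDiff ℝ ∞ (increment g j) := by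
  cases j with
  | zero => exact contDiff_smoothAvg _ hg
  | succ j => exact (contDiff_smoothAvg _ hg).sub (contDiff_smoothAvg _ hg)

/-- Each smoothed average is compared with the plain one on its level. The two plain averages differ
by a term of the energy, since the coarse cube containing `x` is a selected neighbor of the fine
one. The initial term is not a difference and costs the norm of `g`. -/
theorem lintegral_increment_le {g : Euc d → ℝ} (hg : ∫⁻ x, ‖g x‖ₑ < ⊤) (j : ℕ) :
    ∫⁻ x, ‖increment g j x‖ₑ ≤ ((offsets d).card + 1) * incrementBound g j := by
  have hS : ∀ k : ℤ, Measurable fun x => ENNReal.ofReal (offsetSum k g x) := fun k =>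
    (measurable_offsetSum k g).ennreal_ofReal
  have hpt : ∀ (k : ℤ) (x : Euc d),
      ‖smoothAvg k g x - cubeAvg k g x‖ₑ ≤ ENNReal.ofReal (offsetSum k g x) := fun k x => by
    rw [Real.enorm_eq_ofReal_abs]
    exact ENNReal.ofReal_le_ofReal (abs_smoothAvg_sub_cubeAvg_le k hg x)
  cases j with
  | zero =>
    calc ∫⁻ x, ‖increment g 0 x‖ₑ
        ≤ ∫⁻ x, (ENNReal.ofReal (offsetSum (2 ^ 0) g x) + ‖cubeAvg (2 ^ 0) g x‖ₑ) := by
          refine lintegral_mono fun x => ?_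
          calc ‖increment g 0 x‖ₑ
              = ‖(smoothAvg (2 ^ 0) g x - cubeAvg (2 ^ 0) g x) + cubeAvg (2 ^ 0) g x‖ₑ := by
                rw [increment]; congr 1; ring
            _ ≤ _ := (enorm_add_le _ _).trans (add_le_add_left (hpt _ x) _)
      _ ≤ (offsets d).card * levelEnergy g 0 + ∫⁻ x, ‖g x‖ₑ := by
          rw [lintegral_add_left (hS _)]
          exact add_le_add (lintegral_offsetSum_le 0 g) (lintegral_enorm_cubeAvg_le _ g)
      -- Surplus terms are added so that the common factor `card + 1` can be taken out.
      _ ≤ (offsets d).card * levelEnergy g 0 + (∫⁻ x, ‖g x‖ₑ) +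
          (levelEnergy g 0 + (offsets d).card * ∫⁻ x, ‖g x‖ₑ) := le_self_add
      _ = _ := by rw [incrementBound]; ring
  | succ j =>
    have hm : Measurable fun x : Euc d => neighborSum (j + 1) g (cubeAt (2 ^ (j + 1)) x) :=
      measurable_comp_cubeAt _ _
    calc ∫⁻ x, ‖increment g (j + 1) x‖ₑ
        ≤ ∫⁻ x, (ENNReal.ofReal (offsetSum (2 ^ (j + 1)) g x) +
          neighborSum (j + 1) g (cubeAt (2 ^ (j + 1)) x) +
          ENNReal.ofReal (offsetSum (2 ^ j) g x)) := by
          refine lintegral_mono fun x => ?_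
          have h2 := enorm_sub_previousLevel_le_neighborSum (j + 1) g x
          rw [previousLevel_succ] at h2
          have h3 := hpt (2 ^ j) x
          rw [enorm_sub_rev] at h3
          calc ‖increment g (j + 1) x‖ₑ
              = ‖(smoothAvg (2 ^ (j + 1)) g x - cubeAvg (2 ^ (j + 1)) g x) +
                (cubeAvg (2 ^ (j + 1)) g x - cubeAvg (2 ^ j) g x) +
                (cubeAvg (2 ^ j) g x - smoothAvg (2 ^ j) g x)‖ₑ := by
                rw [increment]; congr 1; ring
            _ ≤ _ := (enorm_add_le _ _).trans (add_le_add ((enorm_add_le _ _).trans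
                (add_le_add (hpt _ x) h2)) h3)
      _ ≤ (offsets d).card * levelEnergy g (j + 1) + levelEnergy g (j + 1) +
          (offsets d).card * levelEnergy g j := by
          rw [lintegral_add_right _ (hS _), lintegral_add_right _ hm]
          exact add_le_add (add_le_add (lintegral_offsetSum_le _ g) le_rfl)
            (lintegral_offsetSum_le j g)
      _ ≤ (offsets d).card * levelEnergy g (j + 1) + levelEnergy g (j + 1) +
          (offsets d).card * levelEnergy g j + levelEnergy g j := le_self_add
      _ = _ := by rw [incrementBound]; ring

/-- Mollification at level `2^j` costs a factor `scale j` in the gradient; the coarser of the two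
gradients is absorbed because `scale` increases. -/
theorem lintegral_fderiv_increment_le {g : Euc d → ℝ} (hg : ∫⁻ x, ‖g x‖ₑ < ⊤) (j : ℕ) :
    ∫⁻ x, ‖fderiv ℝ (increment g j) x‖ₑ ≤ ENNReal.ofReal (scale j) *
      (ENNReal.ofReal (kernelGradNorm d) * (offsets d).card * incrementBound g j) := by
  have hS : ∀ k : ℤ, Measurable fun x => ENNReal.ofReal (offsetSum k g x) := fun k =>
    (measurable_offsetSum k g).ennreal_ofReal
  have hdiff : ∀ k : ℤ, Differentiable ℝ (smoothAvg k g) := fun k =>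
    (contDiff_smoothAvg k hg).differentiable (by simp)
  have hpt : ∀ (i : ℕ) (x : Euc d), ‖fderiv ℝ (smoothAvg (2 ^ i) g) x‖ₑ ≤
      ENNReal.ofReal (scale i) * ENNReal.ofReal (kernelGradNorm d) *
        ENNReal.ofReal (offsetSum (2 ^ i) g x) := fun i x => by
    rw [← ofReal_norm, ← ENNReal.ofReal_mul (scale_pos i).le,
      ← ENNReal.ofReal_mul (mul_nonneg (scale_pos i).le (kernelGradNorm_nonneg d))]
    refine ENNReal.ofReal_le_ofReal ((norm_fderiv_smoothAvg_le _ hg x).trans (le_of_eq ?_))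
    rw [scale, mul_assoc]
  have hint : ∀ i : ℕ, ∫⁻ x, ‖fderiv ℝ (smoothAvg (2 ^ i) g) x‖ₑ ≤
      ENNReal.ofReal (scale i) * ENNReal.ofReal (kernelGradNorm d) *
        ((offsets d).card * levelEnergy g i) := fun i => by
    refine (lintegral_mono (hpt i)).trans ?_
    rw [lintegral_const_mul _ (hS _)]
    gcongr
    exact lintegral_offsetSum_le i g
  cases j with
  | zero =>
    refine (hint 0).trans ?_
    rw [incrementBound, mul_assoc, mul_assoc]
    gcongr
    exact le_self_add
  | succ j =>
    have hm : Measurable fun x => ‖fderiv ℝ (smoothAvg (2 ^ j) g) x‖ₑ :=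
      ((contDiff_smoothAvg _ hg).continuous_fderiv (by simp)).enorm.measurable
    calc ∫⁻ x, ‖fderiv ℝ (increment g (j + 1)) x‖ₑ
        ≤ ∫⁻ x, (‖fderiv ℝ (smoothAvg (2 ^ (j + 1)) g) x‖ₑ +
          ‖fderiv ℝ (smoothAvg (2 ^ j) g) x‖ₑ) := by
          refine lintegral_mono fun x => ?_
          have : fderiv ℝ (increment g (j + 1)) x = fderiv ℝ (smoothAvg (2 ^ (j + 1)) g) x -
              fderiv ℝ (smoothAvg (2 ^ j) g) x := fderiv_fun_sub (hdiff _ x) (hdiff _ x)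
          rw [this]
          exact enorm_sub_le
      _ ≤ ENNReal.ofReal (scale (j + 1)) * ENNReal.ofReal (kernelGradNorm d) *
          ((offsets d).card * levelEnergy g (j + 1)) +
          ENNReal.ofReal (scale (j + 1)) * ENNReal.ofReal (kernelGradNorm d) *
          ((offsets d).card * levelEnergy g j) := by
          rw [lintegral_add_right _ hm]
          refine add_le_add (hint _) ((hint j).trans ?_)
          gcongr
          exact scale_le_scale_succ j
      _ = _ := by rw [incrementBound]; ring

theorem tsum_weight_mul_incrementBound_ne_top {lam : ℝ} (hlam : 0 < lam) {g : Euc d → ℝ}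
    (hg : ∫⁻ x, ‖g x‖ₑ < ⊤) (hE : besovEnergy d 1 lam g ≠ ⊤) :
    ∑' j : ℕ, ENNReal.ofReal (((2 : ℝ) ^ j + 2) ^ lam) * incrementBound g j ≠ ⊤ := by
  rw [besovEnergy_one] at hE
  change ∑' j : ℕ, ENNReal.ofReal (((2 : ℝ) ^ j + 2) ^ lam) * levelEnergy g j ≠ ⊤ at hE
  have h1 : ∑' j : ℕ, ENNReal.ofReal (((2 : ℝ) ^ (j + 1) + 2) ^ lam) * levelEnergy g (j + 1) ≠ ⊤ :=
    ne_top_of_le_ne_top hE (ENNReal.tsum_comp_le_tsum_of_injective (add_left_injective 1)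
      fun j : ℕ => ENNReal.ofReal (((2 : ℝ) ^ j + 2) ^ lam) * levelEnergy g j)
  have h2 : ∑' j : ℕ, ENNReal.ofReal (((2 : ℝ) ^ (j + 1) + 2) ^ lam) * levelEnergy g j ≠ ⊤ := by
    refine ne_top_of_le_ne_top (ENNReal.mul_ne_top (ENNReal.ofReal_ne_top (r := 2 ^ lam)) hE) ?_
    rw [← ENNReal.tsum_mul_left]
    refine ENNReal.tsum_le_tsum fun j => ?_
    rw [← mul_assoc]
    gcongr
    exact weight_succ_le hlam j
  rw [tsum_eq_zero_add' ENNReal.summable]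
  simp only [incrementBound, mul_add]
  rw [ENNReal.tsum_add]
  have h0 := ne_top_of_le_ne_top hE (ENNReal.le_tsum 0)
  exact ENNReal.add_ne_top.2 ⟨ENNReal.add_ne_top.2 ⟨h0, ENNReal.mul_ne_top ENNReal.ofReal_ne_top
    hg.ne⟩, ENNReal.add_ne_top.2 ⟨h1, h2⟩⟩

/-! ### Integrals over the half-space -/

theorem measurePreserving_baseProj_last (d : ℕ) : MeasurePreserving
    (fun y : Euc (d + 1) => (baseProj d y, y (Fin.last d))) volume (volume.prod volume) := by
  have h1 := PiLp.volume_preserving_ofLp (Fin (d + 1))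
  have h2 := volume_preserving_piFinSuccAbove (fun _ : Fin (d + 1) => ℝ) (Fin.last d)
  have h3 : MeasurePreserving (Prod.swap : ℝ × (Fin d → ℝ) → (Fin d → ℝ) × ℝ) volume volume :=
    Measure.measurePreserving_swap
  have h4 : MeasurePreserving (Prod.map (WithLp.toLp 2) id : (Fin d → ℝ) × ℝ → Euc d × ℝ)
      (volume.prod volume) (volume.prod volume) :=
    (PiLp.volume_preserving_toLp (Fin d)).prod (MeasurePreserving.id volume)
  have h5 := h4.comp (h3.comp (h2.comp h1))
  have e : (fun y : Euc (d + 1) => (baseProj d y, y (Fin.last d))) =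
      Prod.map (WithLp.toLp 2) id ∘ Prod.swap ∘
        MeasurableEquiv.piFinSuccAbove (fun _ : Fin (d + 1) => ℝ) (Fin.last d) ∘ WithLp.ofLp := by
    funext y
    refine Prod.ext ?_ rfl
    ext i
    simp [baseProj_apply, MeasurableEquiv.piFinSuccAbove, Fin.insertNthEquiv, Fin.init]
  rw [e]
  exact h5

theorem lintegral_mul_last (q : Euc d → ENNReal) (hq : Measurable q) (p : ℝ → ENNReal)
    (hp : Measurable p) :
    ∫⁻ y : Euc (d + 1), q (baseProj d y) * p (y (Fin.last d)) = (∫⁻ x, q x) * ∫⁻ t, p t := by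
  rw [(measurePreserving_baseProj_last d).lintegral_comp (f := fun z => q z.1 * p z.2)
    (by fun_prop), lintegral_prod_mul hq.aemeasurable hp.aemeasurable]

/-- The weight as a function of the height. -/
def heightWeight (lam t : ℝ) : ENNReal := ENNReal.ofReal (Real.log (4 / t) ^ lam)

theorem measurable_heightWeight (lam : ℝ) : Measurable (heightWeight lam) := by
  unfold heightWeight
  fun_prop

/-- Split `log (4/t)` as `log (4a/t) - log a`. The first summand is at least `log 4 > 1`, so the sum
is at most `(m+2) log (4a/t)`. The power of the remaining logarithm is absorbed into `(4a/t)^{1/2}`,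
which is integrable at `0`. -/
theorem log_rpow_le {lam : ℝ} (hlam : 0 < lam) {a m t : ℝ} (ha : 0 < a) (hm : 0 ≤ m)
    (ham : -Real.log a ≤ m) (ht : 0 < t) (hta : t ≤ a) (ha1 : a ≤ 1) :
    Real.log (4 / t) ^ lam ≤
      (m + 2) ^ lam * ((2 * lam) ^ lam * 2 * a ^ (1 / 2 : ℝ)) * t ^ (-(1 / 2) : ℝ) := by
  have hX4 : 4 ≤ 4 * a / t := by rw [le_div_iff₀ ht]; linarith
  have hX1 : 1 ≤ Real.log (4 * a / t) := by
    have h2 : Real.log 4 ≤ Real.log (4 * a / t) := Real.log_le_log (by norm_num) hX4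
    have h3 := Real.log_two_gt_d9
    rw [log_four] at h2
    linarith
  have hL : Real.log (4 / t) = Real.log (4 * a / t) - Real.log a := by
    rw [← Real.log_div (by positivity) ha.ne']
    congr 1
    field_simp
  have hL0 : 0 ≤ Real.log (4 / t) := by
    rw [hL]
    have := Real.log_nonpos ha.le ha1
    linarith
  have h1 : Real.log (4 / t) ≤ (m + 2) * Real.log (4 * a / t) := by
    rw [hL]
    nlinarith
  have h2 : Real.log (4 * a / t) ^ lam ≤ (2 * lam) ^ lam * (4 * a / t) ^ (1 / 2 : ℝ) := by
    -- The exponent `1/(2λ)` becomes `1/2` after raising to the power `λ`.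
    have h3 := Real.log_le_rpow_div (x := 4 * a / t) (ε := 1 / (2 * lam)) (by positivity)
      (by positivity)
    calc Real.log (4 * a / t) ^ lam
        ≤ (2 * lam * (4 * a / t) ^ (1 / (2 * lam))) ^ lam := by
          refine Real.rpow_le_rpow (by linarith) (h3.trans (le_of_eq ?_)) hlam.le
          field_simp
      _ = _ := by
          rw [Real.mul_rpow (by positivity) (by positivity), ← Real.rpow_mul (by positivity)]
          congr 2
          field_simp
  have h4 : (4 * a / t) ^ (1 / 2 : ℝ) = 2 * a ^ (1 / 2 : ℝ) * t ^ (-(1 / 2) : ℝ) := by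
    rw [Real.div_rpow (by positivity) ht.le, Real.mul_rpow (by norm_num) ha.le,
      Real.rpow_neg ht.le, show (4 : ℝ) = 2 ^ (2 : ℝ) by norm_num, ← Real.rpow_mul (by norm_num)]
    norm_num
    rw [div_eq_mul_inv]
  calc Real.log (4 / t) ^ lam ≤ ((m + 2) * Real.log (4 * a / t)) ^ lam :=
        Real.rpow_le_rpow hL0 h1 hlam.le
    _ = (m + 2) ^ lam * Real.log (4 * a / t) ^ lam := Real.mul_rpow (by positivity) (by linarith)
    _ ≤ (m + 2) ^ lam * ((2 * lam) ^ lam * (4 * a / t) ^ (1 / 2 : ℝ)) := by gcongr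
    _ = _ := by rw [h4]; ring

theorem lintegral_rpow_neg_half {a : ℝ} (ha : 0 < a) :
    ∫⁻ t in Set.Ioc 0 a, ENNReal.ofReal (t ^ (-(1 / 2) : ℝ)) =
      ENNReal.ofReal (2 * a ^ (1 / 2 : ℝ)) := by
  have hi := (intervalIntegral.intervalIntegrable_rpow' (a := 0) (b := a) (r := -(1 / 2))
    (by norm_num))
  rw [intervalIntegrable_iff_integrableOn_Ioc_of_le ha.le] at hi
  rw [← ofReal_integral_eq_lintegral_ofReal hi, ← intervalIntegral.integral_of_le ha.le,
    integral_rpow (Or.inl (by norm_num))]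
  · congr 1
    norm_num
    ring
  · exact (ae_restrict_iff' measurableSet_Ioc).2 (ae_of_all _ fun t ht => Real.rpow_nonneg ht.1.le _)

/-- With `a = 2^{-2^j}` one has `-log a ≤ 2^j`. The factor `a^{1/2}` from the pointwise bound and
the one from integrating `t^{-1/2}` multiply to `a`, which cancels `scale j`. -/
theorem exists_lintegral_heightWeight_le {lam : ℝ} (hlam : 0 < lam) : ∃ c : ENNReal, c ≠ ⊤ ∧
    ∀ j : ℕ, ENNReal.ofReal (scale j) *
      ∫⁻ t in Set.Ioc 0 (scale j)⁻¹, heightWeight lam t ≤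
        c * ENNReal.ofReal (((2 : ℝ) ^ j + 2) ^ lam) := by
  refine ⟨ENNReal.ofReal ((2 * lam) ^ lam * 4), ENNReal.ofReal_ne_top, fun j => ?_⟩
  have hs := scale_pos j
  set a := (scale j)⁻¹ with ha
  have ha0 : 0 < a := inv_pos.2 hs
  have hlog : -Real.log a = (2 : ℝ) ^ j * Real.log 2 := by
    rw [ha, Real.log_inv, neg_neg, scale, Real.log_zpow]
    push_cast
    rfl
  have ha1 : a ≤ 1 := by
    rw [← Real.log_nonpos_iff ha0.le]
    have : 0 < (2 : ℝ) ^ j * Real.log 2 := mul_pos (by positivity) (Real.log_pos (by norm_num))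
    linarith
  have ham : -Real.log a ≤ 2 ^ j := by
    rw [hlog]
    have := Real.log_two_lt_d9
    exact mul_le_of_le_one_right (by positivity) (by linarith)
  calc ENNReal.ofReal (scale j) * ∫⁻ t in Set.Ioc 0 a, heightWeight lam t
      ≤ ENNReal.ofReal (scale j) * ∫⁻ t in Set.Ioc 0 a,
        ENNReal.ofReal (((2 : ℝ) ^ j + 2) ^ lam * ((2 * lam) ^ lam * 2 * a ^ (1 / 2 : ℝ))) *
          ENNReal.ofReal (t ^ (-(1 / 2) : ℝ)) := by
        refine mul_le_mul_right (setLIntegral_mono' measurableSet_Ioc fun t ht => ?_) _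
        rw [← ENNReal.ofReal_mul (by positivity)]
        exact ENNReal.ofReal_le_ofReal
          (log_rpow_le hlam ha0 (by positivity) ham ht.1 ht.2 ha1)
    _ = ENNReal.ofReal (scale j * (((2 : ℝ) ^ j + 2) ^ lam *
          ((2 * lam) ^ lam * 2 * a ^ (1 / 2 : ℝ)) * (2 * a ^ (1 / 2 : ℝ)))) := by
        rw [lintegral_const_mul _ (by fun_prop), lintegral_rpow_neg_half ha0,
          ← ENNReal.ofReal_mul (by positivity), ← ENNReal.ofReal_mul hs.le]
    _ = ENNReal.ofReal ((2 * lam) ^ lam * 4 * ((2 : ℝ) ^ j + 2) ^ lam) := by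
        congr 1
        have e : a ^ (1 / 2 : ℝ) * a ^ (1 / 2 : ℝ) = (scale j)⁻¹ := by
          rw [← Real.rpow_add ha0]
          norm_num
          exact ha
        calc _ = scale j * (a ^ (1 / 2 : ℝ) * a ^ (1 / 2 : ℝ)) * (((2 : ℝ) ^ j + 2) ^ lam *
              (2 * lam) ^ lam * 4) := by ring
          _ = _ := by rw [e, mul_inv_cancel₀ hs.ne']; ring
    _ = _ := ENNReal.ofReal_mul (by positivity)

/-- The weighted integral of a function that is supported near the boundary. -/
theorem lintegral_weightedMeasure_le {lam : ℝ} {a : ℝ} (ha1 : a ≤ 1)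
    {h : Euc (d + 1) → ENNReal} (q : Euc d → ENNReal) (hq : Measurable q)
    (hh : ∀ y ∈ upperHalf d, h y ≤ (Set.Ioc 0 a).indicator (fun _ => q (baseProj d y))
      (y (Fin.last d))) :
    ∫⁻ y, h y ∂weightedMeasure d 0 lam ≤ ENNReal.ofReal (1 / Real.log 4 ^ lam) *
      ((∫⁻ x, q x) * ∫⁻ t in Set.Ioc 0 a, heightWeight lam t) := by
  have hU := (isOpen_upperHalf d).measurableSet
  set p : ℝ → ENNReal := (Set.Ioc 0 a).indicator (heightWeight lam) with hp
  have hpm : Measurable p := (measurable_heightWeight lam).indicator measurableSet_Ioc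
  have hlast : Measurable fun y : Euc (d + 1) => y (Fin.last d) := by fun_prop
  set b : Euc (d + 1) → ENNReal := fun y => (Set.Ioc 0 a).indicator (fun _ => q (baseProj d y))
      (y (Fin.last d)) with hb
  have hbm : Measurable b := by
    have : b = ((fun y : Euc (d + 1) => y (Fin.last d)) ⁻¹' Set.Ioc 0 a).indicator
        fun y => q (baseProj d y) := by
      funext y
      simp only [hb, Set.indicator, Set.mem_preimage]
    rw [this]
    exact (hq.comp (baseProj d).continuous.measurable).indicator (hlast measurableSet_Ioc)
  have hwm : Measurable fun y => ENNReal.ofReal (weight d 0 lam y) :=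
    (measurable_weight d lam).ennreal_ofReal
  have hae : ∀ᵐ y ∂weightedMeasure d 0 lam, h y ≤ b y := by
    refine Measure.ae_smul_measure ?_ _
    refine (withDensity_absolutelyContinuous _ _).ae_le ?_
    exact (ae_restrict_iff' hU).2 (ae_of_all _ hh)
  refine (lintegral_mono_ae hae).trans ?_
  rw [weightedMeasure, lintegral_smul_measure, lintegral_withDensity_eq_lintegral_mul _ hwm hbm,
    smul_eq_mul]
  refine mul_le_mul_right ?_ _
  rw [← lintegral_indicator measurableSet_Ioc, ← hp, ← lintegral_mul_last q hq p hpm]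
  refine (setLIntegral_mono' hU fun y hy => ?_).trans (setLIntegral_le_lintegral (upperHalf d) _)
  rw [Pi.mul_apply, hp, hb]
  by_cases ht : y (Fin.last d) ∈ Set.Ioc 0 a
  · simp only [Set.indicator_of_mem ht]
    rw [mul_comm, weight, if_pos (ht.2.trans ha1), Real.rpow_zero, one_mul, abs_of_pos ht.1]
    rfl
  · simp only [Set.indicator_of_notMem ht, mul_zero, le_refl]

/-- A function that is continuously differentiable in the half-space has its gradient as weak
gradient. -/
theorem isWeakGradient_gradient {f : Euc (d + 1) → ℝ} (hf : ContDiffOn ℝ 1 f (upperHalf d)) :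
    IsWeakGradient d f (gradient f) := by
  have hU := isOpen_upperHalf d
  have hc : ContinuousOn (fderiv ℝ f) (upperHalf d) :=
    hf.continuousOn_fderiv_of_isOpen hU le_rfl
  have hgc : ContinuousOn (gradient f) (upperHalf d) :=
    (InnerProductSpace.toDual ℝ (Euc (d + 1))).symm.continuous.comp_continuousOn hc
  have hfl := hf.continuousOn.locallyIntegrableOn (μ := volume) hU.measurableSet
  refine ⟨hfl, hgc.locallyIntegrableOn hU.measurableSet, ?_⟩
  intro φ hφ hφc hφs i
  have hdφ : Differentiable ℝ φ := hφ.differentiable (by simp)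
  have hcφ : Continuous fun y => fderiv ℝ φ y (EuclideanSpace.single i 1) :=
    (hφ.continuous_fderiv (by simp)).clm_apply continuous_const
  have hsφ : tsupport (fun y => fderiv ℝ φ y (EuclideanSpace.single i 1)) ⊆ upperHalf d :=
    (tsupport_fderiv_apply_subset ℝ _).trans hφs
  have hd : ContinuousOn (fun y => fderiv ℝ f y (EuclideanSpace.single i 1)) (upperHalf d) :=
    hc.clm_apply continuousOn_const
  have key := integral_mul_fderiv_eq_neg_fderiv_mul_of_integrable (μ := volume) (f := f) (g := φ)
    (v := EuclideanSpace.single i 1)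
    (integrable_mul_of_tsupport_subset (hd.locallyIntegrableOn hU.measurableSet) hφ.continuous hφc
      hφs)
    (integrable_mul_of_tsupport_subset hfl hcφ (hφc.fderiv_apply ℝ _) hsφ)
    (integrable_mul_of_tsupport_subset hfl hφ.continuous hφc hφs)
    (fun x hx => (hf.contDiffAt (hU.mem_nhds (hφs hx))).differentiableAt (by simp))
    fun x _ => hdφ x
  have e : ∀ y, gradient f y i = fderiv ℝ f y (EuclideanSpace.single i 1) := by
    intro y
    rw [← inner_gradient_left, EuclideanSpace.inner_single_right]
    simp
  simp only [e]
  rw [setIntegral_eq_integral_of_forall_compl_eq_zero, key,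
    setIntegral_eq_integral_of_forall_compl_eq_zero]
  · intro y hy
    rw [image_eq_zero_of_notMem_tsupport fun h => hy (hφs h), mul_zero]
  · intro y hy
    have : fderiv ℝ φ y (EuclideanSpace.single i 1) = 0 :=
      image_eq_zero_of_notMem_tsupport
        (f := fun y => fderiv ℝ φ y (EuclideanSpace.single i 1)) fun h => hy (hsφ h)
    rw [this, mul_zero]

/-! ### The extension operator -/

/-- A smooth function equal to `1` for `s ≤ 1/2` and to `0` for `s ≥ 1`. -/
def cutoff (s : ℝ) : ℝ := Real.smoothTransition (2 - 2 * s)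

theorem contDiff_cutoff : ContDiff ℝ ∞ cutoff :=
  Real.smoothTransition.contDiff.comp (contDiff_const.sub (contDiff_const.mul contDiff_id))

theorem cutoff_of_le {s : ℝ} (h : s ≤ 1 / 2) : cutoff s = 1 :=
  Real.smoothTransition.one_of_one_le (by linarith)

theorem cutoff_of_ge {s : ℝ} (h : 1 ≤ s) : cutoff s = 0 :=
  Real.smoothTransition.zero_of_nonpos (by linarith)

theorem cutoff_nonneg (s : ℝ) : 0 ≤ cutoff s := Real.smoothTransition.nonneg _

theorem cutoff_le_one (s : ℝ) : cutoff s ≤ 1 := Real.smoothTransition.le_one _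

theorem exists_bound_deriv_cutoff : ∃ M : ℝ, 0 ≤ M ∧ ∀ s, |deriv cutoff s| ≤ M := by
  have hc : Continuous (deriv cutoff) := contDiff_cutoff.continuous_deriv (by simp)
  have hsupp : HasCompactSupport (deriv cutoff) := by
    refine HasCompactSupport.intro (isCompact_Icc (a := (1 / 2 : ℝ)) (b := 1)) fun s hs => ?_
    rcases lt_or_ge s (1 / 2) with h | h
    · have : cutoff =ᶠ[𝓝 s] fun _ => 1 := by
        filter_upwards [Iio_mem_nhds h] with r hr using cutoff_of_le (le_of_lt hr)
      rw [this.deriv_eq, deriv_const]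
    · have h1 : 1 < s := by
        by_contra hcon
        exact hs ⟨h, not_lt.1 hcon⟩
      have : cutoff =ᶠ[𝓝 s] fun _ => 0 := by
        filter_upwards [Ioi_mem_nhds h1] with r hr using cutoff_of_ge (le_of_lt hr)
      rw [this.deriv_eq, deriv_const]
  obtain ⟨M, hM⟩ := hsupp.exists_bound_of_continuous hc
  exact ⟨M, (norm_nonneg _).trans (hM 0), hM⟩

theorem natCast_le_scale (j : ℕ) : (j : ℝ) ≤ scale j := by
  have h1 : (j : ℝ) ≤ 2 ^ j := by exact_mod_cast j.lt_two_pow_self.le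
  have h2 : (2 : ℝ) ^ j ≤ scale j := by
    rw [scale, ← zpow_natCast]
    refine zpow_le_zpow_right₀ (by norm_num) ?_
    exact_mod_cast j.lt_two_pow_self.le
  exact h1.trans h2

theorem one_le_scale (j : ℕ) : 1 ≤ scale j := one_le_zpow₀ (by norm_num) (by positivity)

theorem scale_mono : Monotone scale := monotone_nat_of_le_succ scale_le_scale_succ

/-- The term with index `j` of the extension of `g`. -/
def extTerm (g : Euc d → ℝ) (j : ℕ) (y : Euc (d + 1)) : ℝ :=
  increment g j (baseProj d y) * cutoff (scale j * y (Fin.last d))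

/-- The extension of `g` to the half-space. -/
def extension (g : Euc d → ℝ) (y : Euc (d + 1)) : ℝ := ∑' j, extTerm g j y

theorem contDiff_extTerm {g : Euc d → ℝ} (hg : ∫⁻ x, ‖g x‖ₑ < ⊤) (j : ℕ) :
    ContDiff ℝ ∞ (extTerm g j) := by
  refine ((contDiff_increment hg j).comp (baseProj d).contDiff).mul (contDiff_cutoff.comp ?_)
  exact contDiff_const.mul (EuclideanSpace.proj (𝕜 := ℝ) (Fin.last d)).contDiff

theorem extTerm_eq_zero (g : Euc d → ℝ) {j : ℕ} {y : Euc (d + 1)}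
    (h : 1 ≤ scale j * y (Fin.last d)) : extTerm g j y = 0 := by
  rw [extTerm, cutoff_of_ge h, mul_zero]

/-- The series is locally finite in the half-space: at heights above half that of `y`, every term
with `scale j` at least twice the reciprocal height of `y` vanishes. -/
theorem exists_eventually_extension_eq (g : Euc d → ℝ) {y : Euc (d + 1)} (hy : y ∈ upperHalf d) :
    ∃ J : ℕ, extension g =ᶠ[𝓝 y] fun z => ∑ j ∈ Finset.range J, extTerm g j z := by
  have hy' : 0 < y (Fin.last d) := hy
  obtain ⟨J, hJ⟩ := exists_nat_gt (2 / y (Fin.last d))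
  have hopen : IsOpen {z : Euc (d + 1) | y (Fin.last d) / 2 < z (Fin.last d)} :=
    isOpen_lt continuous_const (by fun_prop)
  refine ⟨J, ?_⟩
  filter_upwards [hopen.mem_nhds (show y (Fin.last d) / 2 < y (Fin.last d) by linarith)] with z hz
  refine tsum_eq_sum fun j hj => extTerm_eq_zero g ?_
  have hz' : y (Fin.last d) / 2 < z (Fin.last d) := hz
  have h1 : (J : ℝ) ≤ scale j :=
    (natCast_le_scale J).trans (scale_mono (by simpa using hj))
  rw [div_lt_iff₀ hy'] at hJ
  have h2 : (J : ℝ) * z (Fin.last d) ≤ scale j * z (Fin.last d) :=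
    mul_le_mul_of_nonneg_right h1 (by linarith)
  have hJ0 : (0 : ℝ) ≤ J := Nat.cast_nonneg J
  nlinarith

theorem contDiffOn_extension {g : Euc d → ℝ} (hg : ∫⁻ x, ‖g x‖ₑ < ⊤) :
    ContDiffOn ℝ 1 (extension g) (upperHalf d) := by
  intro y hy
  obtain ⟨J, hJ⟩ := exists_eventually_extension_eq g hy
  refine ContDiffAt.contDiffWithinAt (ContDiffAt.congr_of_eventuallyEq ?_ hJ)
  exact (ContDiff.sum fun j _ => (contDiff_extTerm hg j).of_le (by simp)).contDiffAt

theorem enorm_extension_le (g : Euc d → ℝ) {y : Euc (d + 1)} (hy : y ∈ upperHalf d) :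
    ‖extension g y‖ₑ ≤ ∑' j, ‖extTerm g j y‖ₑ := by
  obtain ⟨J, hJ⟩ := exists_eventually_extension_eq g hy
  rw [hJ.eq_of_nhds]
  exact (enorm_sum_le _ _).trans (ENNReal.sum_le_tsum _)

theorem enorm_gradient_extension_le {g : Euc d → ℝ} (hg : ∫⁻ x, ‖g x‖ₑ < ⊤) {y : Euc (d + 1)}
    (hy : y ∈ upperHalf d) :
    ‖gradient (extension g) y‖ₑ ≤ ∑' j, ‖fderiv ℝ (extTerm g j) y‖ₑ := by
  obtain ⟨J, hJ⟩ := exists_eventually_extension_eq g hy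
  have h1 : ‖gradient (extension g) y‖ₑ = ‖fderiv ℝ (extension g) y‖ₑ := by
    rw [gradient, LinearIsometryEquiv.enorm_map]
  rw [h1, hJ.fderiv_eq,
    fderiv_fun_sum fun j _ => (contDiff_extTerm hg j).differentiable (by simp) y]
  exact (enorm_sum_le (ε := Euc (d + 1) →L[ℝ] ℝ) _ _).trans (ENNReal.sum_le_tsum _)

theorem enorm_extTerm_le (g : Euc d → ℝ) (j : ℕ) {y : Euc (d + 1)} (hy : y ∈ upperHalf d) :
    ‖extTerm g j y‖ₑ ≤ (Set.Ioc 0 (scale j)⁻¹).indicator (fun _ => ‖increment g j (baseProj d y)‖ₑ)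
      (y (Fin.last d)) := by
  have hy' : 0 < y (Fin.last d) := hy
  by_cases ht : y (Fin.last d) ≤ (scale j)⁻¹
  · rw [Set.indicator_of_mem (show y (Fin.last d) ∈ Set.Ioc 0 (scale j)⁻¹ from ⟨hy', ht⟩), extTerm, enorm_mul]
    refine mul_le_of_le_one_right' ?_
    rw [Real.enorm_eq_ofReal (cutoff_nonneg _), ← ENNReal.ofReal_one]
    exact ENNReal.ofReal_le_ofReal (cutoff_le_one _)
  · rw [extTerm_eq_zero]
    · simp
    · rw [not_le, inv_lt_iff_one_lt_mul₀ (scale_pos j)] at ht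
      linarith [mul_comm (scale j) (y (Fin.last d))]

/-- Product rule: the vertical derivative of the cutoff costs `scale j`, the same factor as the
horizontal gradient of the increment. -/
theorem enorm_fderiv_extTerm_le {g : Euc d → ℝ} (hg : ∫⁻ x, ‖g x‖ₑ < ⊤) {M : ℝ} (hM0 : 0 ≤ M)
    (hM : ∀ s, |deriv cutoff s| ≤ M) (j : ℕ) {y : Euc (d + 1)} (hy : y ∈ upperHalf d) :
    ‖fderiv ℝ (extTerm g j) y‖ₑ ≤ (Set.Ioc 0 (scale j)⁻¹).indicator
      (fun _ => ‖fderiv ℝ (increment g j) (baseProj d y)‖ₑ +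
        ENNReal.ofReal (scale j) * ENNReal.ofReal M * ‖increment g j (baseProj d y)‖ₑ)
      (y (Fin.last d)) := by
  have hy' : 0 < y (Fin.last d) := hy
  have hs := scale_pos j
  by_cases ht : y (Fin.last d) ≤ (scale j)⁻¹
  · rw [Set.indicator_of_mem (show y (Fin.last d) ∈ Set.Ioc 0 (scale j)⁻¹ from ⟨hy', ht⟩)]
    set P : Euc (d + 1) →L[ℝ] ℝ := EuclideanSpace.proj (Fin.last d) with hP
    have hPn : ‖P‖ ≤ 1 := ContinuousLinearMap.opNorm_le_bound _ zero_le_one fun z => by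
      rw [one_mul]
      exact PiLp.norm_apply_le z _
    have hv : HasFDerivAt (fun z => increment g j (baseProj d z))
        ((fderiv ℝ (increment g j) (baseProj d y)).comp (baseProj d)) y :=
      ((contDiff_increment hg j).differentiable (by simp) _).hasFDerivAt.comp y
        (baseProj d).hasFDerivAt
    have hlin : HasFDerivAt (fun z : Euc (d + 1) => scale j * z (Fin.last d)) (scale j • P) y :=
      P.hasFDerivAt.const_mul (scale j)
    have hc : HasFDerivAt (fun z : Euc (d + 1) => cutoff (scale j * z (Fin.last d)))
        (deriv cutoff (scale j * y (Fin.last d)) • (scale j • P)) y :=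
      ((contDiff_cutoff.differentiable (by simp) _).hasDerivAt).comp_hasFDerivAt y hlin
    have hprod : fderiv ℝ (extTerm g j) y = _ := (hv.mul hc).fderiv
    rw [hprod]
    refine (enorm_add_le (E := Euc (d + 1) →L[ℝ] ℝ) _ _).trans ?_
    rw [add_comm]
    refine add_le_add ?_ ?_
    · rw [enorm_smul]
      refine (mul_le_mul' (b := 1) ?_ le_rfl).trans ?_
      · rw [Real.enorm_eq_ofReal (cutoff_nonneg _), ← ENNReal.ofReal_one]
        exact ENNReal.ofReal_le_ofReal (cutoff_le_one _)
      · rw [one_mul, ← ofReal_norm, ← ofReal_norm]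
        refine ENNReal.ofReal_le_ofReal ((ContinuousLinearMap.opNorm_comp_le _ _).trans ?_)
        exact mul_le_of_le_one_right (norm_nonneg _) (norm_baseProj_le d)
    · rw [enorm_smul, mul_comm]
      gcongr
      rw [← ofReal_norm, ← ENNReal.ofReal_mul hs.le]
      refine ENNReal.ofReal_le_ofReal ?_
      rw [norm_smul, norm_smul, Real.norm_of_nonneg hs.le, Real.norm_eq_abs]
      calc _ ≤ M * (scale j * 1) := by gcongr; exact hM _
        _ = _ := by ring
  · have hopen : IsOpen {z : Euc (d + 1) | (scale j)⁻¹ < z (Fin.last d)} :=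
      isOpen_lt continuous_const (by fun_prop)
    have h0 : extTerm g j =ᶠ[𝓝 y] fun _ => 0 := by
      filter_upwards [hopen.mem_nhds (not_le.1 ht)] with z hz
      refine extTerm_eq_zero g ?_
      have hz' : (scale j)⁻¹ < z (Fin.last d) := hz
      rw [inv_lt_iff_one_lt_mul₀ hs] at hz'
      linarith [mul_comm (scale j) (z (Fin.last d))]
    rw [h0.fderiv_eq, fderiv_fun_const, ← ofReal_norm, Pi.zero_apply, norm_zero,
      ENNReal.ofReal_zero]
    exact zero_le

theorem ae_mem_upperHalf (d : ℕ) (lam : ℝ) : ∀ᵐ y ∂weightedMeasure d 0 lam, y ∈ upperHalf d := by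
  refine Measure.ae_smul_measure ?_ _
  refine (withDensity_absolutelyContinuous _ _).ae_le ?_
  exact ae_restrict_mem (isOpen_upperHalf d).measurableSet

/-- Term by term, the horizontal norm times the height integral of the weight is at most a constant
times `(2^j+2)^λ` times `incrementBound g j`, which is summable by the finite energy. -/
theorem extension_mem_sobolevSpace {lam : ℝ} (hlam : 0 < lam) {g : Euc d → ℝ}
    (hg : ∫⁻ x, ‖g x‖ₑ < ⊤) (hE : besovEnergy d 1 lam g ≠ ⊤) :
    extension g ∈ sobolevSpace d 1 0 lam := by
  obtain ⟨M, hM0, hM⟩ := exists_bound_deriv_cutoff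
  obtain ⟨c, hc, hcH⟩ := exists_lintegral_heightWeight_le hlam
  have hsum := tsum_weight_mul_incrementBound_ne_top hlam hg hE
  set L : ENNReal := ENNReal.ofReal (1 / Real.log 4 ^ lam) with hL
  have hLt : L ≠ ⊤ := ENNReal.ofReal_ne_top
  set N : ENNReal := ((offsets d).card : ENNReal) with hN
  have hNt : N ≠ ⊤ := ENNReal.natCast_ne_top _
  set I : ℕ → ENNReal := fun j => ∫⁻ t in Set.Ioc 0 (scale j)⁻¹, heightWeight lam t with hI
  have hinv : ∀ j, (scale j)⁻¹ ≤ 1 := fun j => inv_le_one_of_one_le₀ (one_le_scale j)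
  have hvm : ∀ j, Measurable fun x => ‖increment g j x‖ₑ := fun j =>
    (contDiff_increment hg j).continuous.enorm.measurable
  have hdm : ∀ j, Measurable fun x => ‖fderiv ℝ (increment g j) x‖ₑ := fun j =>
    ((contDiff_increment hg j).continuous_fderiv (by simp)).enorm.measurable
  -- a bound for the terms suffices
  have hfin : ∀ (C : ENNReal) (h : ℕ → Euc (d + 1) → ENNReal) (H : Euc (d + 1) → ENNReal),
      C ≠ ⊤ → (∀ j, Measurable (h j)) →
      (∀ j, ∫⁻ y, h j y ∂weightedMeasure d 0 lam ≤ L * (C * (ENNReal.ofReal (scale j) * I j *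
        incrementBound g j))) → (∀ y ∈ upperHalf d, H y ≤ ∑' j, h j y) →
      ∫⁻ y, H y ∂weightedMeasure d 0 lam < ⊤ := by
    intro C h H hC hm hb hH
    calc ∫⁻ y, H y ∂weightedMeasure d 0 lam
        ≤ ∫⁻ y, ∑' j, h j y ∂weightedMeasure d 0 lam := by
          refine lintegral_mono_ae ?_
          filter_upwards [ae_mem_upperHalf d lam] with y hy using hH y hy
      _ = ∑' j, ∫⁻ y, h j y ∂weightedMeasure d 0 lam :=
          lintegral_tsum fun j => (hm j).aemeasurable
      _ ≤ ∑' j : ℕ, L * C * c * (ENNReal.ofReal (((2 : ℝ) ^ j + 2) ^ lam) * incrementBound g j) := by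
          refine ENNReal.tsum_le_tsum fun j => (hb j).trans ?_
          calc L * (C * (ENNReal.ofReal (scale j) * I j * incrementBound g j))
              ≤ L * (C * (c * ENNReal.ofReal (((2 : ℝ) ^ j + 2) ^ lam) * incrementBound g j)) := by
                exact mul_le_mul_right (mul_le_mul_right (mul_le_mul_left (hcH j) _) _) _
            _ = _ := by ring
      _ < ⊤ := by
          rw [ENNReal.tsum_mul_left]
          exact ENNReal.mul_lt_top (ENNReal.mul_lt_top (ENNReal.mul_lt_top hLt.lt_top hC.lt_top)
            hc.lt_top) hsum.lt_top
  refine ⟨gradient (extension g), isWeakGradient_gradient (contDiffOn_extension hg), ?_⟩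
  rw [ENNReal.ofReal_one, eLpNorm_one_eq_lintegral_enorm, eLpNorm_one_eq_lintegral_enorm]
  refine ENNReal.add_lt_top.2 ⟨?_, ?_⟩
  · refine hfin (N + 1) (fun j y => ‖extTerm g j y‖ₑ) _
      (ENNReal.add_ne_top.2 ⟨hNt, ENNReal.one_ne_top⟩)
      (fun j => (contDiff_extTerm hg j).continuous.enorm.measurable) (fun j => ?_)
      fun y hy => enorm_extension_le g hy
    refine (lintegral_weightedMeasure_le (hinv j) _ (hvm j)
      fun y hy => enorm_extTerm_le g j hy).trans ?_
    refine mul_le_mul_right ?_ _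
    calc (∫⁻ x, ‖increment g j x‖ₑ) * I j ≤ ((N + 1) * incrementBound g j) * (1 * I j) := by
          rw [one_mul]
          gcongr
          exact lintegral_increment_le hg j
      -- The function itself does not need the factor `scale j ≥ 1`; it is inserted so that one
      -- bound serves both norms.
      _ ≤ ((N + 1) * incrementBound g j) * (ENNReal.ofReal (scale j) * I j) := by
          gcongr
          rw [← ENNReal.ofReal_one]
          exact ENNReal.ofReal_le_ofReal (one_le_scale j)
      _ = _ := by ring
  · refine hfin (ENNReal.ofReal (kernelGradNorm d) * N + ENNReal.ofReal M * (N + 1))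
      (fun j y => ‖fderiv ℝ (extTerm g j) y‖ₑ) _
      (ENNReal.add_ne_top.2 ⟨ENNReal.mul_ne_top ENNReal.ofReal_ne_top hNt,
        ENNReal.mul_ne_top ENNReal.ofReal_ne_top (ENNReal.add_ne_top.2 ⟨hNt, ENNReal.one_ne_top⟩)⟩)
      (fun j => ((contDiff_extTerm hg j).continuous_fderiv (by simp)).enorm.measurable)
      (fun j => ?_) fun y hy => enorm_gradient_extension_le hg hy
    refine (lintegral_weightedMeasure_le (hinv j) _ ((hdm j).add ((hvm j).const_mul _))
      fun y hy => enorm_fderiv_extTerm_le hg hM0 hM j hy).trans ?_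
    refine mul_le_mul_right ?_ _
    have hq : ∫⁻ x, (‖fderiv ℝ (increment g j) x‖ₑ +
        ENNReal.ofReal (scale j) * ENNReal.ofReal M * ‖increment g j x‖ₑ) ≤
        ENNReal.ofReal (scale j) * (ENNReal.ofReal (kernelGradNorm d) * N * incrementBound g j) +
        ENNReal.ofReal (scale j) * ENNReal.ofReal M * ((N + 1) * incrementBound g j) := by
      rw [lintegral_add_left (hdm j), lintegral_const_mul _ (hvm j)]
      exact add_le_add (lintegral_fderiv_increment_le hg j)
        (mul_le_mul_right (lintegral_increment_le hg j) _)
    refine (mul_le_mul_left hq (I j)).trans (le_of_eq ?_)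
    ring

/-! ### The trace of the extension -/

theorem volume_real_toSet (Q : DyadicCube d) : volume.real Q.toSet = Q.edge ^ d := by
  rw [measureReal_def, volume_toSet, ENNReal.toReal_pow, ENNReal.toReal_ofReal (edge_pos Q).le]

/-- Enlarge the domain of integration from the cube to the ball; the constant is the ratio of their
volumes. The cube need not contain `x`. -/
theorem abs_setAverage_sub_le {g : Euc d → ℝ} (hg : LocallyIntegrable g volume) (Q : DyadicCube d)
    {x : Euc d} {R : ℝ} (hR : 0 < R) (hQ : Q.toSet ⊆ Metric.closedBall x (R * Q.edge)) (c : ℝ) :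
    |(⨍ z in Q.toSet, g z) - c| ≤ R ^ d * volume.real (Metric.ball (0 : Euc d) 1) *
      ⨍ z in Metric.closedBall x (R * Q.edge), ‖g z - c‖ := by
  have hQe := edge_pos Q
  set B := Metric.closedBall x (R * Q.edge) with hB
  have hgc : LocallyIntegrable (fun z => g z - c) volume := hg.sub (locallyIntegrable_const c)
  have hgB : IntegrableOn (fun z => g z - c) B volume :=
    hgc.integrableOn_isCompact (isCompact_closedBall _ _)
  have hV : 0 < volume.real (Metric.ball (0 : Euc d) 1) :=
    ENNReal.toReal_pos (Metric.measure_ball_pos _ _ one_pos).ne' measure_ball_lt_top.ne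
  have hBv : volume.real B = (R * Q.edge) ^ d * volume.real (Metric.ball (0 : Euc d) 1) := by
    rw [hB, Measure.addHaar_real_closedBall _ _ (by positivity), finrank_euclideanSpace_fin]
  have h1 : (⨍ z in Q.toSet, g z) - c = (Q.edge ^ d)⁻¹ * ∫ z in Q.toSet, (g z - c) := by
    rw [setAverage_eq, volume_real_toSet, integral_sub (integrableOn_toSet hg Q)
      (integrableOn_const (volume_toSet_ne_top Q)), setIntegral_const, volume_real_toSet,
      smul_eq_mul, smul_eq_mul, mul_sub, ← mul_assoc, inv_mul_cancel₀ (by positivity), one_mul]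
  have h2 : |∫ z in Q.toSet, (g z - c)| ≤ ∫ z in B, ‖g z - c‖ :=
    (norm_integral_le_integral_norm _).trans (setIntegral_mono_set hgB.norm
      (ae_of_all _ fun _ => norm_nonneg _) (ae_of_all _ hQ))
  rw [h1, abs_mul, abs_of_pos (by positivity : 0 < (Q.edge ^ d)⁻¹), setAverage_eq, hBv, smul_eq_mul]
  calc (Q.edge ^ d)⁻¹ * |∫ z in Q.toSet, (g z - c)| ≤ (Q.edge ^ d)⁻¹ * ∫ z in B, ‖g z - c‖ := by
        gcongr
    _ = _ := by
        rw [mul_pow]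
        field_simp

/-- At a Lebesgue point the smoothed averages near the point converge. -/
theorem eventually_abs_smoothAvg_sub_le {g : Euc d → ℝ} (hg : ∫⁻ x, ‖g x‖ₑ < ⊤)
    (hgl : LocallyIntegrable g volume) {x : Euc d}
    (hx : Tendsto (fun r : ℝ => ⨍ z in Metric.closedBall x r, ‖g z - g x‖) (𝓝[>] 0) (𝓝 0))
    {b : ℝ} (hb : 0 ≤ b) {ε : ℝ} (hε : 0 < ε) :
    ∀ᶠ j : ℕ in atTop, ∀ x' : Euc d, scale j * ‖x' - x‖ ≤ b →
      |smoothAvg (2 ^ j) g x' - g x| ≤ ε := by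
  -- In units of the edge: `d` bounds the diameter of a cube, `1` is the mollification radius, and
  -- `b` is the allowed distance of `x'` from `x`.
  set R : ℝ := d + 1 + b with hR
  have hR0 : 0 < R := by positivity
  have hr : Tendsto (fun j : ℕ => R * (scale j)⁻¹) atTop (𝓝[>] 0) := by
    refine tendsto_nhdsWithin_iff.2 ⟨?_, Eventually.of_forall fun j => ?_⟩
    · have h1 : Tendsto scale atTop atTop :=
        tendsto_atTop_mono natCast_le_scale tendsto_natCast_atTop_atTop
      simpa using h1.inv_tendsto_atTop.const_mul R
    · have := scale_pos j
      exact Set.mem_Ioi.2 (by positivity)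
  have hlim := (hx.comp hr).const_mul (R ^ d * volume.real (Metric.ball (0 : Euc d) 1))
  rw [mul_zero] at hlim
  filter_upwards [hlim.eventually (Iic_mem_nhds hε)] with j hj x' hx'
  have hs := scale_pos j
  refine abs_mollify_sub_le (locallyIntegrable_cubeAvg_smul _ hg) hε.le fun w hw => ?_
  set x'' : Euc d := (2 : ℝ) ^ (-(2 : ℤ) ^ j) • w with hx''
  have he : (cubeAt (2 ^ j) x'').edge = (scale j)⁻¹ := by rw [edge_cubeAt, scale, zpow_neg]
  have hw' : ‖x'' - x'‖ ≤ (scale j)⁻¹ := by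
    rw [Metric.mem_closedBall, dist_eq_norm] at hw
    have e : x'' - x' = (scale j)⁻¹ • (w - scale j • x') := by
      rw [smul_sub, smul_smul, inv_mul_cancel₀ hs.ne', one_smul, hx'', zpow_neg]
      rfl
    rw [e, norm_smul, Real.norm_of_nonneg (by positivity)]
    exact mul_le_of_le_one_right (by positivity) hw
  have hsub : (cubeAt (2 ^ j) x'').toSet ⊆ Metric.closedBall x (R * (cubeAt (2 ^ j) x'').edge) := by
    intro z hz
    have h1 : ‖z - x''‖ ≤ d * (scale j)⁻¹ := by
      refine norm_le_of_abs_apply_le _ (by positivity) fun i => ?_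
      have hz1 := hz i
      have hz2 := mem_cubeAt (2 ^ j) x'' i
      rw [he, Set.mem_Ioc] at hz1 hz2
      rw [PiLp.sub_apply, abs_le]
      constructor <;> linarith [hz1.1, hz1.2, hz2.1, hz2.2]
    have h2 : ‖x' - x‖ ≤ b * (scale j)⁻¹ := by
      rwa [← div_eq_mul_inv, le_div_iff₀ hs, mul_comm]
    rw [Metric.mem_closedBall, dist_eq_norm, he]
    calc ‖z - x‖ = ‖(z - x'') + (x'' - x') + (x' - x)‖ := by congr 1; abel
      _ ≤ d * (scale j)⁻¹ + (scale j)⁻¹ + b * (scale j)⁻¹ :=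
          (norm_add_le _ _).trans (add_le_add ((norm_add_le _ _).trans (add_le_add h1 hw')) h2)
      _ = _ := by rw [hR]; ring
  refine (abs_setAverage_sub_le hgl _ hR0 hsub (g x)).trans ?_
  rw [he]
  exact hj

/-- Near the boundary the extension is a convex combination of two consecutive smoothed
averages. -/
theorem extension_eq (g : Euc d → ℝ) {j : ℕ} {y : Euc (d + 1)}
    (h1 : scale j * y (Fin.last d) ≤ 1 / 2) (h2 : 1 / 2 < scale (j + 1) * y (Fin.last d)) :
    extension g y = smoothAvg (2 ^ j) g (baseProj d y) +
      (smoothAvg (2 ^ (j + 1)) g (baseProj d y) - smoothAvg (2 ^ j) g (baseProj d y)) *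
        cutoff (scale (j + 1) * y (Fin.last d)) := by
  have ht : 0 < y (Fin.last d) := by
    by_contra hcon
    nlinarith [scale_pos (j + 1), not_lt.1 hcon]
  -- The cutoffs with index at most `j` equal `1` and their increments telescope. Those from `j + 2`
  -- on vanish, because `scale (j + 2)` is the square of `scale (j + 1) ≥ 2`.
  rw [extension, tsum_eq_sum (s := Finset.range (j + 2)), Finset.sum_range_succ, ← sum_increment]
  · congr 1
    · refine Finset.sum_congr rfl fun i hi => ?_
      rw [extTerm, cutoff_of_le, mul_one]
      refine le_trans ?_ h1
      gcongr
      exact scale_mono (Nat.lt_succ_iff.1 (Finset.mem_range.1 hi))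
    · rw [sum_increment]
      rfl
  · intro i hi
    refine extTerm_eq_zero g ?_
    have h3 : scale (j + 2) ≤ scale i := scale_mono (by simpa using hi)
    have h4 : scale (j + 2) = scale (j + 1) * scale (j + 1) := by
      rw [scale, scale, ← zpow_add₀ two_ne_zero]
      congr 1
      ring
    have h5 : 2 ≤ scale (j + 1) := by
      rw [scale, show (2 : ℝ) = 2 ^ (1 : ℤ) by norm_num, zpow_one]
      calc (2 : ℝ) = 2 ^ (1 : ℤ) := by norm_num
        _ ≤ _ := zpow_le_zpow_right₀ (by norm_num) (one_le_pow₀ (by norm_num))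
    calc (1 : ℝ) ≤ 2 * (scale (j + 1) * y (Fin.last d)) := by linarith
      _ ≤ scale (j + 1) * (scale (j + 1) * y (Fin.last d)) := by gcongr
      _ = scale (j + 2) * y (Fin.last d) := by rw [h4]; ring
      _ ≤ scale i * y (Fin.last d) := by gcongr

/-- The extension converges nontangentially at the Lebesgue points of `g`. -/
theorem exists_abs_extension_sub_le {g : Euc d → ℝ} (hg : ∫⁻ x, ‖g x‖ₑ < ⊤)
    (hgl : LocallyIntegrable g volume) {x : Euc d}
    (hx : Tendsto (fun r : ℝ => ⨍ z in Metric.closedBall x r, ‖g z - g x‖) (𝓝[>] 0) (𝓝 0))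
    {b : ℝ} (hb : 0 ≤ b) {ε : ℝ} (hε : 0 < ε) :
    ∃ τ > 0, ∀ y ∈ upperHalf d, y (Fin.last d) ≤ τ →
      ‖baseProj d y - x‖ ≤ b * y (Fin.last d) → |extension g y - g x| ≤ ε := by
  obtain ⟨J, hJ⟩ := eventually_atTop.1 (eventually_abs_smoothAvg_sub_le hg hgl hx hb hε)
  have hsJ := scale_pos J
  refine ⟨(2 * scale J)⁻¹, by positivity, fun y hy hyt hyx => ?_⟩
  have ht : 0 < y (Fin.last d) := hy
  set t := y (Fin.last d) with htdef
  have hJt : scale J * t ≤ 1 / 2 := by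
    rw [← one_div, le_div_iff₀ (by positivity)] at hyt
    linarith
  have hex : ∃ n, 1 / 2 < scale n * t := by
    obtain ⟨n, hn⟩ := exists_nat_gt (1 / t)
    refine ⟨n, ?_⟩
    rw [div_lt_iff₀ ht] at hn
    have := mul_le_mul_of_nonneg_right (natCast_le_scale n) ht.le
    linarith
  classical
  -- The first layer whose cutoff is no longer guaranteed to be `1` at height `t`; its predecessor
  -- is the index `j` of `extension_eq`.
  set n := Nat.find hex with hn
  have hnJ : J < n := by
    rw [hn, Nat.lt_find_iff]
    intro m hm
    rw [not_lt]
    exact (mul_le_mul_of_nonneg_right (scale_mono hm) ht.le).trans hJt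
  obtain ⟨j, hj⟩ : ∃ j, n = j + 1 := ⟨n - 1, by omega⟩
  have h2 : 1 / 2 < scale (j + 1) * t := by rw [← hj]; exact Nat.find_spec hex
  have h1 : scale j * t ≤ 1 / 2 := not_lt.1 (Nat.find_min hex (by omega))
  have hnear : ∀ i, scale i * t ≤ 1 → scale i * ‖baseProj d y - x‖ ≤ b := by
    intro i hi
    calc scale i * ‖baseProj d y - x‖ ≤ scale i * (b * t) := by
          have := scale_pos i
          gcongr
      _ = b * (scale i * t) := by ring
      _ ≤ b * 1 := by gcongr
      _ = b := mul_one b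
  have hu := hJ j (by omega) (baseProj d y) (hnear j (by linarith))
  rw [extension_eq g h1 h2]
  -- If `scale (j + 1) * t` is large, the finer average may be taken too far from `x` on its own
  -- scale, but then its coefficient is zero.
  rcases le_or_gt 1 (scale (j + 1) * t) with h | h
  · rw [cutoff_of_ge h, mul_zero, add_zero]
    exact hu
  · have hu' := hJ (j + 1) (by omega) (baseProj d y) (hnear (j + 1) h.le)
    have hθ0 := cutoff_nonneg (scale (j + 1) * t)
    have hθ1 := cutoff_le_one (scale (j + 1) * t)
    rw [abs_le] at hu hu' ⊢
    constructor <;> nlinarith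

/-- At a Lebesgue point the extension is close to `g x` on the whole enlarged box above `x`, and an
average of values in a closed ball stays in that ball. -/
theorem isTrace_extension {g : Euc d → ℝ} (hg : ∫⁻ x, ‖g x‖ₑ < ⊤)
    (hgl : LocallyIntegrable g volume) : IsTrace d (extension g) g := by
  filter_upwards [IsUnifLocDoublingMeasure.ae_tendsto_average_norm_sub
    (volume : Measure (Euc d)) hgl 1] with x hx
  have hx' : Tendsto (fun r : ℝ => ⨍ z in Metric.closedBall x r, ‖g z - g x‖) (𝓝[>] 0) (𝓝 0) := by
    refine hx (fun _ => x) id tendsto_id ?_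
    filter_upwards [self_mem_nhdsWithin] with r hr
    refine Metric.mem_closedBall_self ?_
    have : (0 : ℝ) < r := hr
    simpa using this.le
  simp only [traceApprox_eq]
  refine Metric.tendsto_atTop.2 fun ε hε => ?_
  -- In the enlarged box each coordinate is within `5/4` edges of `x` while the height exceeds `3/4`
  -- of an edge, so twice the height suffices per coordinate.
  obtain ⟨τ, hτ, H⟩ := exists_abs_extension_sub_le hg hgl hx' (b := d * 2) (by positivity)
    (half_pos hε)
  -- Heights in the box are below `9/4` edges, hence below `τ` once the edge is at most `τ/3`.
  obtain ⟨K, hK⟩ := exists_pow_lt_of_lt_one (show 0 < τ / 3 by positivity)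
    (show (1 / 2 : ℝ) < 1 by norm_num)
  refine ⟨K, fun k hk => ?_⟩
  set Q : DyadicCube d := cubeAt (k : ℤ) x with hQ
  have he : Q.edge ≤ τ / 3 := by
    refine le_trans (le_of_eq ?_) ((pow_le_pow_of_le_one (by norm_num) (by norm_num) hk).trans hK.le)
    rw [hQ, edge_cubeAt, zpow_neg, zpow_natCast, one_div, inv_pow]
  have hQe := edge_pos Q
  have hclose : ∀ y ∈ Q.enlarged, extension g y ∈ Metric.closedBall (g x) (ε / 2) := by
    intro y hy
    obtain ⟨hb1, hb2⟩ := enlarged_bounds hy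
    rw [Metric.mem_closedBall, Real.dist_eq]
    refine H y hy.1 (by linarith [hb2.2]) ?_
    refine (norm_le_of_abs_apply_le _ (c := 2 * y (Fin.last d)) (by linarith [hb2.1])
      fun i => ?_).trans (le_of_eq (by ring))
    have h1 := hb1 i
    have h2 := mem_cubeAt (k : ℤ) x i
    rw [← hQ, Set.mem_Ioc] at h2
    rw [PiLp.sub_apply, baseProj_apply, abs_le]
    constructor <;> linarith [h1.1, h1.2, h2.1, h2.2, hb2.1]
  have hsub : Q.enlarged ⊆ closedHull Q :=
    (enlarged_subset_hull_of_neighbor (k : ℤ) _ _ (by simp [mem_offsets])).trans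
      (hull_subset_closedHull _)
  have hint : IntegrableOn (extension g) Q.enlarged volume :=
    (((contDiffOn_extension hg).continuousOn.mono (closedHull_subset Q)).integrableOn_compact
      (isCompact_closedHull Q)).mono_set hsub
  have hmem := (convex_closedBall (g x) (ε / 2)).set_average_mem Metric.isClosed_closedBall
    ((isOpen_enlarged Q).measure_pos volume (nonempty_enlarged Q)).ne'
    ((measure_mono hsub).trans_lt (isCompact_closedHull Q).measure_lt_top).ne
    ((ae_restrict_iff' (isOpen_enlarged Q).measurableSet).2 (ae_of_all _ hclose)) hint
  rw [Metric.mem_closedBall] at hmem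
  exact hmem.trans_lt (half_lt_self hε)

end TraceBesov

end

theorem corollary1p5 (d : ℕ) (hd : 1 ≤ d) (lam : ℝ) (hlam : 0 < lam) :
    TraceBesov.IsTraceSpace d (TraceBesov.besovSpace d 1 lam)
      (TraceBesov.sobolevSpace d 1 0 lam) := by
  refine ⟨fun f hf => TraceBesov.exists_trace_of_mem_sobolevSpace hlam hf, fun g hg => ?_⟩
  obtain ⟨hgl, hgn⟩ := hg
  rw [TraceBesov.besovNorm, ENNReal.ofReal_one, eLpNorm_one_eq_lintegral_enorm, div_one,
    ENNReal.rpow_one, ENNReal.add_lt_top] at hgn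
  exact ⟨TraceBesov.extension g,
    TraceBesov.extension_mem_sobolevSpace hlam hgn.1 hgn.2.ne,
    TraceBesov.isTrace_extension hgn.1 hgl⟩
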